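/- Let $M$ be a smooth $7$-manifold with a Riemannian metric $g$ and Levi-Civita connection $\nabla$, and let $\varphi$ be a $G_2$-structure on $M$ with associated metric $g$, that is, a smooth $3$-form which at each point is identified with $\varphi_0=e^{123}+e^{145}+e^{167}+e^{246}-e^{257}-e^{347}-e^{356}$ by a linear isometry $T_xM\cong\mathbb{R}^7$. Put $\psi=*\varphi$, with the orientation determined by $g(u,v)\,\mathrm{vol}=\frac16(u\lrcorner\varphi)\wedge(v\lrcorner\varphi)\wedge\varphi$. Sections of the octonion bundle $\mathbb{O}M=\Lambda^0\oplus TM$ are multiplied by $$(a,\alpha)(b,\beta)=\bigl(ab-\langle\alpha,\beta\rangle,\ a\beta+b\alpha+\alpha\times\beta\bigr),\qquad \langle\alpha\times\beta,\gamma\rangle=\varphi(\alpha,\beta,\gamma).$$ The torsion $T$ of $\varphi$ is the $\operatorname{Im}\mathbb{O}M$-valued $1$-form with $\nabla_a\varphi_{bcd}=2T_a{}^e\psi_{ebcd}$, i.e. $T_a{}^m=\frac1{48}(\nabla_a\varphi_{bcd})\psi^{mbcd}$. Put $D_iA=\nabla_iA-A\,T_i$ for sections $A$ of $\mathbb{O}M$,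 and $(D_iP)_a=(\nabla_iP)_a-P_aT_i$ for $\mathbb{O}M$-valued $1$-forms $P$. With $\delta_i=(0,\partial_i)$ and $\delta^i=g^{ij}\delta_j$, put $\slashed{D}A=\delta^i(D_iA)$ and $(\slashed{D}P)_a=\delta^i\bigl((D_iP)_a\bigr)$, and define the transpose $P^t$ by $(P^t)_i=(\operatorname{Re}P_i)\,1+\langle\delta_i,P_j\rangle\,\delta^j$. Let $V=(v_0,v)$ be a nowhere-vanishing smooth section of $\mathbb{O}M$ and $$\varphi_V=\sigma_V(\varphi)=|V|^{-2}\bigl((v_0^2-|v|^2)\varphi-2v_0\,v\lrcorner\psi+2\,v^\flat\wedge(v\lrcorner\varphi)\bigr),$$ which is a $G_2$-structure with the same metric $g$. Let $T^{(V)}$ be its torsion and let $\slashed{D}^{(V)}1$ be its octonion Dirac operator applied to the section $1$; both are formed as above with $\varphi_V$ (and its octonion product) in place of $\varphi$. Let $\hat\partial\ln|V|=(0,\nabla\ln|V|)$. Then, with all products and the operators $D$, $\slashed{D}$ below taken with respect to $\varphi$, for every index $j$, $$\bigl((\slashed{D}T)V\bigr)_j-\bigl(\slashed{D}(T^{(V)}V)\bigr)_j=D_j\bigl((\slashed{D}^{(V)}1)V\bigr)-(D_j\slashed{D}1)V-(\hat\partial\ln|V|)\bigl(T^{(V)}_jV\bigr)-(\partial_j\ln|V|)\,(\slashed{D}^{(V)}1)V,$$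 and, equivalently, $$\bigl((\slashed{D}T)^tV\bigr)_j-\bigl(\slashed{D}(T^{(V)}V)\bigr)_j=D_j\bigl((\slashed{D}^{(V)}1)V\bigr)-\bigl((D\slashed{D}1)^tV\bigr)_j-(\hat\partial\ln|V|)\bigl(T^{(V)}_jV\bigr)-(\partial_j\ln|V|)\,(\slashed{D}^{(V)}1)V.$$ -/

import Mathlib

open scoped Manifold ContDiff

noncomputable section

namespace G2

/-! ### Data on a smooth 7-manifold -/

/-- The model space `ℝ⁷`. -/
abbrev E7 : Type := EuclideanSpace ℝ (Fin 7)

/-- A smooth Riemannian metric on `M`. -/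
abbrev Metric (M : Type*) [TopologicalSpace M] [ChartedSpace E7 M] [IsManifold (𝓡 7) ∞ M] :=
  Bundle.ContMDiffRiemannianMetric (𝓡 7) ∞ E7 (fun x : M => TangentSpace (𝓡 7) x)

/-- A (not necessarily smooth) field of alternating 3-forms on the tangent spaces of `M`. -/
abbrev ThreeForm (M : Type*) [TopologicalSpace M] [ChartedSpace E7 M] :=
  (x : M) → (TangentSpace (𝓡 7) x) [⋀^Fin 3]→L[ℝ] ℝ

/-- The form `dxⁱ ∧ dxʲ ∧ dxᵏ` on `ℝ⁷`. -/
def wedge3 (i j k : Fin 7) (u v w : E7) : ℝ :=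
  Matrix.det !![u i, u j, u k; v i, v j, v k; w i, w j, w k]

/-- The standard `G₂` 3-form
`φ₀ = e¹²³ + e¹⁴⁵ + e¹⁶⁷ + e²⁴⁶ - e²⁵⁷ - e³⁴⁷ - e³⁵⁶` on `ℝ⁷` (indices start at 0 below). -/
def phi0 (u v w : E7) : ℝ :=
  wedge3 0 1 2 u v w + wedge3 0 3 4 u v w + wedge3 0 5 6 u v w + wedge3 1 3 5 u v w
    - wedge3 1 4 6 u v w - wedge3 2 3 6 u v w - wedge3 2 4 5 u v w

/-- The coordinate vector `∂/∂xᵃ` of the chart `e`, at the point with coordinates `y`. -/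
def coordVec {M : Type*} [TopologicalSpace M] [ChartedSpace E7 M]
    (e : OpenPartialHomeomorph M E7) (y : E7) (a : Fin 7) : TangentSpace (𝓡 7) (e.symm y) :=
  mfderiv (𝓡 7) (𝓡 7) e.symm y (EuclideanSpace.single a (1 : ℝ))

/-- Components `φ_{abc}` of a 3-form in the chart `e`, as functions of the coordinates. -/
def formComp {M : Type*} [TopologicalSpace M] [ChartedSpace E7 M] (φ : ThreeForm M)
    (e : OpenPartialHomeomorph M E7) (y : E7) (a b c : Fin 7) : ℝ :=
  φ (e.symm y) ![coordVec e y a, coordVec e y b, coordVec e y c]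

/-- Components `g_{ab}` of a metric in the chart `e`, as functions of the coordinates. -/
def metricComp {M : Type*} [TopologicalSpace M] [ChartedSpace E7 M] [IsManifold (𝓡 7) ∞ M]
    (g : Metric M) (e : OpenPartialHomeomorph M E7) (y : E7) : Matrix (Fin 7) (Fin 7) ℝ :=
  Matrix.of fun a b => g.inner (e.symm y) (coordVec e y a) (coordVec e y b)

/-- `φ` is a `G₂`-structure on `M` with associated metric `g`: a smooth 3-form such that each
tangent space has a linear identification with `ℝ⁷` taking `φ` to the standard form `φ₀` and `g`
to the Euclidean metric. -/
structure IsG2Structure {M : Type*} [TopologicalSpace M] [ChartedSpace E7 M]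
    [IsManifold (𝓡 7) ∞ M] (g : Metric M) (φ : ThreeForm M) : Prop where
  smooth : ∀ e ∈ IsManifold.maximalAtlas (𝓡 7) ∞ M, ∀ a b c : Fin 7,
    ContDiffOn ℝ ∞ (fun y => formComp φ e y a b c) e.target
  adapted : ∀ x : M, ∃ L : TangentSpace (𝓡 7) x ≃ₗ[ℝ] E7,
    (∀ u v w, φ x ![u, v, w] = phi0 (L u) (L v) (L w)) ∧
    (∀ u v, g.inner x u v = inner ℝ (L u) (L v))

/-- A smooth section `(re, im)` of the octonion bundle `𝕆M = Λ⁰ ⊕ TM`. -/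
structure OctSection (M : Type*) [TopologicalSpace M] [ChartedSpace E7 M]
    [IsManifold (𝓡 7) ∞ M] where
  re : M → ℝ
  im : (x : M) → TangentSpace (𝓡 7) x
  smooth_re : ContMDiff (𝓡 7) 𝓘(ℝ, ℝ) ∞ re
  smooth_im : ContMDiff (𝓡 7) (𝓡 7).tangent ∞
    (fun x => (⟨x, im x⟩ : TangentBundle (𝓡 7) M))

/-- An octonion at a point, in coordinates: real part and components of the imaginary part. -/
abbrev Oct : Type := ℝ × (Fin 7 → ℝ)

/-- Coordinate expression of a section of the octonion bundle in the chart `e`. -/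
def octComp {M : Type*} [TopologicalSpace M] [ChartedSpace E7 M] [IsManifold (𝓡 7) ∞ M]
    (V : OctSection M) (e : OpenPartialHomeomorph M E7) (y : E7) : Oct :=
  (V.re (e.symm y),
    fun a => (show E7 from mfderiv (𝓡 7) (𝓡 7) e (e.symm y) (V.im (e.symm y))) a)

/-! ### Pointwise algebra in components

`G` is the matrix `g_{ab}` of the metric, `p` the components `φ_{abc}` of a 3-form. -/

/-- Components of a 3-form at a point. -/
abbrev Form3 : Type := Fin 7 → Fin 7 → Fin 7 → ℝ

/-- The permutation symbol. -/
def levi (s : Fin 7 → Fin 7) : ℝ := Matrix.det ((1 : Matrix (Fin 7) (Fin 7) ℝ).submatrix s id)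

/-- The coefficient of `dx¹ ∧ ⋯ ∧ dx⁷` in
`B_φ(∂_i, ∂_j) = (1/6) (∂_i ⌟ φ) ∧ (∂_j ⌟ φ) ∧ φ`. -/
def bForm (p : Form3) (i j : Fin 7) : ℝ :=
  (1 / 6) * ((1 / (2 * 2 * 6)) *
    ∑ s : Fin 7 → Fin 7, levi s * p i (s 0) (s 1) * p j (s 2) (s 3) * p (s 4) (s 5) (s 6))

/-- The coefficient of the volume form `vol_φ` in `g_φ(u,v) vol_φ = B_φ(u,v)`, obtained by taking
the trace with respect to `g`. Its sign is the orientation given by `φ`. -/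
def volCoeff (G : Matrix (Fin 7) (Fin 7) ℝ) (p : Form3) : ℝ :=
  (1 / 7) * ∑ i, ∑ j, G⁻¹ i j * bForm p i j

/-- The components of `ψ = *φ`, for the metric `G` and the orientation of `φ`. -/
def hodge (G : Matrix (Fin 7) (Fin 7) ℝ) (p : Form3) (a b c d : Fin 7) : ℝ :=
  (1 / 6) * ∑ i, ∑ j, ∑ k,
    (∑ l, ∑ m, ∑ n, G⁻¹ i l * G⁻¹ j m * G⁻¹ k n * p l m n) *
      (volCoeff G p * levi ![i, j, k, a, b, c, d])

/-- The inner product of two vectors. -/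
def ip (G : Matrix (Fin 7) (Fin 7) ℝ) (u v : Fin 7 → ℝ) : ℝ := ∑ a, ∑ b, G a b * u a * v b

/-- The squared norm of an octonion. -/
def normSq (G : Matrix (Fin 7) (Fin 7) ℝ) (A : Oct) : ℝ := A.1 ^ 2 + ip G A.2 A.2

/-- The cross product, `⟨u × v, w⟩ = φ(u, v, w)`. -/
def cross (G : Matrix (Fin 7) (Fin 7) ℝ) (p : Form3) (u v : Fin 7 → ℝ) : Fin 7 → ℝ :=
  fun k => ∑ c, G⁻¹ k c * ∑ a, ∑ b, p a b c * u a * v b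

/-- The octonion product determined by `φ`. -/
def omul (G : Matrix (Fin 7) (Fin 7) ℝ) (p : Form3) (A B : Oct) : Oct :=
  (A.1 * B.1 - ip G A.2 B.2, A.1 • B.2 + B.1 • A.2 + cross G p A.2 B.2)

/-- The imaginary octonion of a vector. -/
def imag (u : Fin 7 → ℝ) : Oct := (0, u)

/-- `δ_i`: the imaginary octonion of the `i`-th coordinate vector. -/
def delta (i : Fin 7) : Oct := imag (Pi.single i 1)

/-- `δⁱ = g^{ij} δ_j`. -/
def deltaUp (G : Matrix (Fin 7) (Fin 7) ℝ) (i : Fin 7) : Oct := ∑ j, G⁻¹ i j • delta j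

/-- `σ_A(φ) = |A|⁻² ((a² - |α|²) φ - 2 a α ⌟ (*φ) + 2 α ∧ (α ⌟ φ))` for `A = (a, α)`. -/
def sigma (G : Matrix (Fin 7) (Fin 7) ℝ) (p : Form3) (A : Oct) : Form3 :=
  fun b c d => (normSq G A)⁻¹ *
    ((A.1 ^ 2 - ip G A.2 A.2) * p b c d
      - 2 * A.1 * (∑ m, A.2 m * hodge G p m b c d)
      + 2 * ((∑ m, G b m * A.2 m) * (∑ m, A.2 m * p m c d)
        + (∑ m, G c m * A.2 m) * (∑ m, A.2 m * p m d b)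
        + (∑ m, G d m * A.2 m) * (∑ m, A.2 m * p m b c)))

/-- The transpose `(Pᵗ)_i = (Re P)_i 1 + ⟨δ_i, P_j⟩ δʲ` of an octonion-valued 1-form. -/
def transp (G : Matrix (Fin 7) (Fin 7) ℝ) (P : Fin 7 → Oct) : Fin 7 → Oct :=
  fun i => ((P i).1, 0) + ∑ j, ip G (delta i).2 (P j).2 • deltaUp G j

/-! ### Calculus in a chart

`g` and `φ` are now component functions of the coordinates. -/

/-- Component functions of a metric in a chart. -/
abbrev LMetric : Type := E7 → Matrix (Fin 7) (Fin 7) ℝ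

/-- Component functions of a 3-form in a chart. -/
abbrev LForm : Type := E7 → Form3

/-- The partial derivative `∂_i f`. -/
def pd (i : Fin 7) (f : E7 → ℝ) (y : E7) : ℝ := fderiv ℝ f y (EuclideanSpace.single i (1 : ℝ))

/-- Christoffel symbols `Γᵏ_{ij}` of the Levi-Civita connection. -/
def chris (g : LMetric) (y : E7) (k i j : Fin 7) : ℝ :=
  (1 / 2) * ∑ l, (g y)⁻¹ k l *
    (pd i (fun z => g z j l) y + pd j (fun z => g z i l) y - pd l (fun z => g z i j) y)

/-- `∇_a φ_{bcd}`. -/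
def nablaForm (g : LMetric) (φ : LForm) (y : E7) (a b c d : Fin 7) : ℝ :=
  pd a (fun z => φ z b c d) y - ∑ l, chris g y l a b * φ y l c d
    - ∑ l, chris g y l a c * φ y b l d - ∑ l, chris g y l a d * φ y b c l

/-- The full torsion tensor `T_a{}^m = (1/48) (∇_a φ_{bcd}) ψ^{mbcd}`, equivalently
`∇_a φ_{bcd} = 2 T_a{}^e ψ_{ebcd}`. -/
def torsion (g : LMetric) (φ : LForm) (y : E7) (a m : Fin 7) : ℝ :=
  (1 / 48) * ∑ b, ∑ c, ∑ d, nablaForm g φ y a b c d *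
    ∑ m', ∑ b', ∑ c', ∑ d', (g y)⁻¹ m m' * (g y)⁻¹ b b' * (g y)⁻¹ c c' * (g y)⁻¹ d d' *
      hodge (g y) (φ y) m' b' c' d'

/-- The torsion as an imaginary-octonion-valued 1-form. -/
def torsionOct (g : LMetric) (φ : LForm) (y : E7) (a : Fin 7) : Oct := imag (torsion g φ y a)

/-- `∇_i A` for a section `A` of the octonion bundle. -/
def nablaOct (g : LMetric) (A : E7 → Oct) (y : E7) (i : Fin 7) : Oct :=
  (pd i (fun z => (A z).1) y,
    fun k => pd i (fun z => (A z).2 k) y + ∑ l, chris g y k i l * (A y).2 l)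

/-- `(∇_i P)_a` for an octonion-valued 1-form `P`. -/
def nablaOct1 (g : LMetric) (P : E7 → Fin 7 → Oct) (y : E7) (i a : Fin 7) : Oct :=
  nablaOct g (fun z => P z a) y i - ∑ l, chris g y l i a • P y l

/-- The octonion covariant derivative `D_i A = ∇_i A - A T_i`. -/
def octD (g : LMetric) (φ : LForm) (A : E7 → Oct) (y : E7) (i : Fin 7) : Oct :=
  nablaOct g A y i - omul (g y) (φ y) (A y) (torsionOct g φ y i)

/-- `(D_i P)_a = (∇_i P)_a - P_a T_i` for an octonion-valued 1-form `P`. -/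
def octD1 (g : LMetric) (φ : LForm) (P : E7 → Fin 7 → Oct) (y : E7) (i a : Fin 7) : Oct :=
  nablaOct1 g P y i a - omul (g y) (φ y) (P y a) (torsionOct g φ y i)

/-- The octonion Dirac operator `δⁱ (D_i A)` on sections of the octonion bundle. -/
def dirac (g : LMetric) (φ : LForm) (A : E7 → Oct) (y : E7) : Oct :=
  ∑ i, omul (g y) (φ y) (deltaUp (g y) i) (octD g φ A y i)

/-- The octonion Dirac operator `δⁱ (D_i P)_a` on octonion-valued 1-forms. -/
def dirac1 (g : LMetric) (φ : LForm) (P : E7 → Fin 7 → Oct) (y : E7) (a : Fin 7) : Oct :=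
  ∑ i, omul (g y) (φ y) (deltaUp (g y) i) (octD1 g φ P y i a)

/-- The constant octonion section `1`. -/
def one : E7 → Oct := fun _ => (1, 0)

/-- The 3-form `σ_V(φ)`. -/
def sigmaL (g : LMetric) (φ : LForm) (V : E7 → Oct) : LForm :=
  fun y => sigma (g y) (φ y) (V y)

/-- The 1-form `d ln |V|`. -/
def dlog (g : LMetric) (V : E7 → Oct) (y : E7) (j : Fin 7) : ℝ :=
  pd j (fun z => Real.log (Real.sqrt (normSq (g z) (V z)))) y

/-- The imaginary octonion of the gradient of `ln |V|`. -/
def gradLog (g : LMetric) (V : E7 → Oct) (y : E7) : Oct :=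
  imag fun i => ∑ j, (g y)⁻¹ i j * dlog g V y j

/-- The octonion-valued 1-form `T^{(V)} V`: the torsion of `σ_V(φ)` multiplied on the right by
`V`, with the product of `φ`. -/
def torsionVmulV (g : LMetric) (φ : LForm) (V : E7 → Oct) (y : E7) (j : Fin 7) : Oct :=
  omul (g y) (φ y) (torsionOct g (sigmaL g φ V) y j) (V y)

/-- The section `D̸^{(V)} 1`: the octonion Dirac operator of `σ_V(φ)` applied to `1`. -/
def diracV1 (g : LMetric) (φ : LForm) (V : E7 → Oct) : E7 → Oct :=
  dirac g (sigmaL g φ V) one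

/-- The `j`-th component of the octonion-valued 1-form
`D((D̸^{(V)} 1) V) - P V - (∂̂ ln|V|)(T^{(V)} V) - (d ln|V|) (D̸^{(V)} 1) V`. -/
def compRHS (g : LMetric) (φ : LForm) (V : E7 → Oct) (P : Fin 7 → Oct) (y : E7) (j : Fin 7) :
    Oct :=
  octD g φ (fun z => omul (g z) (φ z) (diracV1 g φ V z) (V z)) y j
    - omul (g y) (φ y) (P j) (V y)
    - omul (g y) (φ y) (gradLog g V y) (torsionVmulV g φ V y j)
    - dlog g V y j • omul (g y) (φ y) (diracV1 g φ V y) (V y)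

end G2

end

open scoped Manifold ContDiff

noncomputable section

namespace G2

set_option linter.unusedSimpArgs false

/-! Everything rests on the connection `D` and one algebraic fact: if `∘` is the product of
`σ_V(φ)`, then `(A ∘ B) V = A (B V)`, a Moufang identity (`IsFrame.omul_sigma_omul`). Right
multiplication by `V` thus carries the `σ_V(φ)`-picture to the `φ`-picture.

Differentiating `|uv| = |u||v|` gives `∇φ(u, v, u × v) = 0`, which puts `∇φ` in the 7-dimensional
summand of the 3-forms; hence the torsion determines `∇φ`, and `∇(AB) = (∇A)B + A(∇B) - [A, B, T]`
with `[A, B, C] = A(BC) - (AB)C`. Consequently `D(AB) = (∇A)B + A(DB)`: `D` is a Clifford connection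
for left multiplication. The same holds for `σ_V(φ)`, which again has frames for `g`;
differentiating `(A ∘ B)V = A(BV)` yields `T^(V) V = (d ln|V|) V - D V` (`LocalG2.torsionVmulV_eq`).

For any octonion-valued 1-form `P`, the torsion-free property of `∇` gives `(D̸P)_j - D_j(δⁱ P_i) =
δⁱ(D_i P_j - D_j P_i)`. For `P = T = -D1` the right side is `-δⁱ F_ij 1`, with `F` the curvature of
`D`. For `P = T^(V) V`, where `δⁱ P_i = -(D̸^(V) 1)V`, it is `-δⁱ F_ij V` plus the terms in `d
ln|V|` of the theorem, because `d ln|V|` is closed. What remains is `(δⁱ F_ij 1) V = δⁱ F_ij V`.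

This is a spin-geometry fact. The Leibniz rule and `Re F1 = 0` force `F` to be the spin curvature `¼
R_kl δᵏ δˡ` (`IsFrame.curvature_eq`), and the first Bianchi identity reduces `δⁱ F_ij` to left
multiplication by `w_jk δᵏ` with `w` symmetric, half the Ricci tensor up to sign. Left
multiplication by an octonion sends `1` to that octonion, which gives the first identity. Symmetry
of `w` makes `D̸T + DD̸1` equal to its transpose, which gives the second. -/

/-- Vectors in components. -/
abbrev Vec : Type := Fin 7 → ℝ

/-! ### The standard octonions -/

/-- The cross product of `φ₀`. -/
def cr {R : Type*} [CommRing R] (u v : Fin 7 → R) : Fin 7 → R :=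
  ![u 1 * v 2 - u 2 * v 1 + (u 3 * v 4 - u 4 * v 3) + (u 5 * v 6 - u 6 * v 5),
    u 2 * v 0 - u 0 * v 2 + (u 3 * v 5 - u 5 * v 3) - (u 4 * v 6 - u 6 * v 4),
    u 0 * v 1 - u 1 * v 0 - (u 3 * v 6 - u 6 * v 3) - (u 4 * v 5 - u 5 * v 4),
    u 4 * v 0 - u 0 * v 4 + (u 5 * v 1 - u 1 * v 5) - (u 6 * v 2 - u 2 * v 6),
    u 0 * v 3 - u 3 * v 0 - (u 6 * v 1 - u 1 * v 6) - (u 5 * v 2 - u 2 * v 5),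
    u 6 * v 0 - u 0 * v 6 + (u 1 * v 3 - u 3 * v 1) - (u 2 * v 4 - u 4 * v 2),
    u 0 * v 5 - u 5 * v 0 - (u 1 * v 4 - u 4 * v 1) - (u 2 * v 3 - u 3 * v 2)]

/-- The product of the standard octonions. -/
def mul0 (A B : Oct) : Oct :=
  (A.1 * B.1 - A.2 ⬝ᵥ B.2, A.1 • B.2 + B.1 • A.2 + cr A.2 B.2)

/-- Octonion conjugation. -/
def conj (A : Oct) : Oct := (A.1, -A.2)

/-- The standard inner product of octonions. -/
def oip0 (A B : Oct) : ℝ := A.1 * B.1 + A.2 ⬝ᵥ B.2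

/-- The associator of the standard octonions. -/
def asc0 (A B C : Oct) : Oct := mul0 A (mul0 B C) - mul0 (mul0 A B) C

theorem oct_ext {A B : Oct} (h : A.1 = B.1) (h0 : A.2 0 = B.2 0) (h1 : A.2 1 = B.2 1)
    (h2 : A.2 2 = B.2 2) (h3 : A.2 3 = B.2 3) (h4 : A.2 4 = B.2 4) (h5 : A.2 5 = B.2 5)
    (h6 : A.2 6 = B.2 6) : A = B := by
  refine Prod.ext h (funext fun i => ?_)
  fin_cases i <;> assumption

theorem cr_0 (u v : Vec) : cr u v 0 =
    u 1 * v 2 - u 2 * v 1 + (u 3 * v 4 - u 4 * v 3) + (u 5 * v 6 - u 6 * v 5) := rfl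
theorem cr_1 (u v : Vec) : cr u v 1 =
    u 2 * v 0 - u 0 * v 2 + (u 3 * v 5 - u 5 * v 3) - (u 4 * v 6 - u 6 * v 4) := rfl
theorem cr_2 (u v : Vec) : cr u v 2 =
    u 0 * v 1 - u 1 * v 0 - (u 3 * v 6 - u 6 * v 3) - (u 4 * v 5 - u 5 * v 4) := rfl
theorem cr_3 (u v : Vec) : cr u v 3 =
    u 4 * v 0 - u 0 * v 4 + (u 5 * v 1 - u 1 * v 5) - (u 6 * v 2 - u 2 * v 6) := rfl
theorem cr_4 (u v : Vec) : cr u v 4 =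
    u 0 * v 3 - u 3 * v 0 - (u 6 * v 1 - u 1 * v 6) - (u 5 * v 2 - u 2 * v 5) := rfl
theorem cr_5 (u v : Vec) : cr u v 5 =
    u 6 * v 0 - u 0 * v 6 + (u 1 * v 3 - u 3 * v 1) - (u 2 * v 4 - u 4 * v 2) := rfl
theorem cr_6 (u v : Vec) : cr u v 6 =
    u 0 * v 5 - u 5 * v 0 - (u 1 * v 4 - u 4 * v 1) - (u 2 * v 3 - u 3 * v 2) := rfl

theorem dot_seven (u v : Vec) : u ⬝ᵥ v =
    u 0 * v 0 + u 1 * v 1 + u 2 * v 2 + u 3 * v 3 + u 4 * v 4 + u 5 * v 5 + u 6 * v 6 := by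
  simp [dotProduct, Fin.sum_univ_seven]

theorem mul0_alt (A B : Oct) : mul0 A (mul0 A B) = mul0 (mul0 A A) B := by
  apply oct_ext <;>
  simp only [mul0, oip0, conj, asc0, dot_seven, Pi.add_apply, Pi.sub_apply, Pi.smul_apply, Pi.neg_apply,
    smul_eq_mul, Prod.fst_add, Prod.snd_add, Prod.fst_sub, Prod.snd_sub, Prod.smul_fst, Prod.smul_snd,
    Prod.fst_neg, Prod.snd_neg, cr_0, cr_1, cr_2, cr_3, cr_4, cr_5, cr_6] <;> ring

/-- A Moufang identity cleared of denominators: `conj a` stands for `|a|² a⁻¹`, so no nonvanishing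
is needed. Like the neighbouring identities it is polynomial in the coordinates and is verified
there. -/
theorem mul0_moufang_left (a x z : Oct) : mul0 (mul0 (mul0 a x) a) (mul0 (conj a) z) =
    oip0 a a • mul0 a (mul0 x z) := by
  apply oct_ext <;>
  simp only [mul0, oip0, conj, asc0, dot_seven, Pi.add_apply, Pi.sub_apply, Pi.smul_apply, Pi.neg_apply,
    smul_eq_mul, Prod.fst_add, Prod.snd_add, Prod.fst_sub, Prod.snd_sub, Prod.smul_fst, Prod.smul_snd,
    Prod.fst_neg, Prod.snd_neg, cr_0, cr_1, cr_2, cr_3, cr_4, cr_5, cr_6] <;> ring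

theorem mul0_moufang_right (a x w : Oct) : mul0 (mul0 w (conj a)) (mul0 (mul0 a x) a) =
    oip0 a a • mul0 (mul0 w x) a := by
  apply oct_ext <;>
  simp only [mul0, oip0, conj, asc0, dot_seven, Pi.add_apply, Pi.sub_apply, Pi.smul_apply, Pi.neg_apply,
    smul_eq_mul, Prod.fst_add, Prod.snd_add, Prod.fst_sub, Prod.snd_sub, Prod.smul_fst, Prod.smul_snd,
    Prod.fst_neg, Prod.snd_neg, cr_0, cr_1, cr_2, cr_3, cr_4, cr_5, cr_6] <;> ring

theorem mul0_mul_conj (A V : Oct) : mul0 (mul0 A V) (conj V) = oip0 V V • A := by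
  apply oct_ext <;>
  simp only [mul0, oip0, conj, asc0, dot_seven, Pi.add_apply, Pi.sub_apply, Pi.smul_apply, Pi.neg_apply,
    smul_eq_mul, Prod.fst_add, Prod.snd_add, Prod.fst_sub, Prod.snd_sub, Prod.smul_fst, Prod.smul_snd,
    Prod.fst_neg, Prod.snd_neg, cr_0, cr_1, cr_2, cr_3, cr_4, cr_5, cr_6] <;> ring

theorem conj_mul0_mul (A V : Oct) : mul0 V (mul0 (conj V) A) = oip0 V V • A := by
  apply oct_ext <;>
  simp only [mul0, oip0, conj, asc0, dot_seven, Pi.add_apply, Pi.sub_apply, Pi.smul_apply, Pi.neg_apply,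
    smul_eq_mul, Prod.fst_add, Prod.snd_add, Prod.fst_sub, Prod.snd_sub, Prod.smul_fst, Prod.smul_snd,
    Prod.fst_neg, Prod.snd_neg, cr_0, cr_1, cr_2, cr_3, cr_4, cr_5, cr_6] <;> ring

theorem mul0_flex (A B : Oct) : mul0 A (mul0 B A) = mul0 (mul0 A B) A := by
  apply oct_ext <;>
  simp only [mul0, oip0, conj, asc0, dot_seven, Pi.add_apply, Pi.sub_apply, Pi.smul_apply, Pi.neg_apply,
    smul_eq_mul, Prod.fst_add, Prod.snd_add, Prod.fst_sub, Prod.snd_sub, Prod.smul_fst, Prod.smul_snd,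
    Prod.fst_neg, Prod.snd_neg, cr_0, cr_1, cr_2, cr_3, cr_4, cr_5, cr_6] <;> ring

/-- Two octonions generate an associative subalgebra. This form and its mirror split off the factors
of the companion `B³` in `inner_map_mul0`. -/
theorem mul0_cube_right (x B : Oct) : mul0 x (mul0 B (mul0 B B)) = mul0 (mul0 (mul0 x B) B) B := by
  apply oct_ext <;>
  simp only [mul0, oip0, conj, asc0, dot_seven, Pi.add_apply, Pi.sub_apply, Pi.smul_apply, Pi.neg_apply,
    smul_eq_mul, Prod.fst_add, Prod.snd_add, Prod.fst_sub, Prod.snd_sub, Prod.smul_fst, Prod.smul_snd,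
    Prod.fst_neg, Prod.snd_neg, cr_0, cr_1, cr_2, cr_3, cr_4, cr_5, cr_6] <;> ring

theorem mul0_cube_left (x B : Oct) : mul0 (mul0 B (mul0 B B)) x = mul0 B (mul0 B (mul0 B x)) := by
  apply oct_ext <;>
  simp only [mul0, oip0, conj, asc0, dot_seven, Pi.add_apply, Pi.sub_apply, Pi.smul_apply, Pi.neg_apply,
    smul_eq_mul, Prod.fst_add, Prod.snd_add, Prod.fst_sub, Prod.snd_sub, Prod.smul_fst, Prod.smul_snd,
    Prod.fst_neg, Prod.snd_neg, cr_0, cr_1, cr_2, cr_3, cr_4, cr_5, cr_6] <;> ring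

theorem conj_mul0 (A B : Oct) : conj (mul0 A B) = mul0 (conj B) (conj A) := by
  apply oct_ext <;>
  simp only [mul0, oip0, conj, asc0, dot_seven, Pi.add_apply, Pi.sub_apply, Pi.smul_apply, Pi.neg_apply,
    smul_eq_mul, Prod.fst_add, Prod.snd_add, Prod.fst_sub, Prod.snd_sub, Prod.smul_fst, Prod.smul_snd,
    Prod.fst_neg, Prod.snd_neg, cr_0, cr_1, cr_2, cr_3, cr_4, cr_5, cr_6] <;> ring

theorem oip0_mul0_left (A B C : Oct) : oip0 (mul0 A B) (mul0 A C) = oip0 A A * oip0 B C := by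
  simp only [mul0, oip0, conj, asc0, dot_seven, Pi.add_apply, Pi.sub_apply, Pi.smul_apply, Pi.neg_apply,
    smul_eq_mul, Prod.fst_add, Prod.snd_add, Prod.fst_sub, Prod.snd_sub, Prod.smul_fst, Prod.smul_snd,
    Prod.fst_neg, Prod.snd_neg, cr_0, cr_1, cr_2, cr_3, cr_4, cr_5, cr_6]
  ring

theorem oip0_mul0_right (A B C : Oct) : oip0 (mul0 A C) (mul0 B C) = oip0 A B * oip0 C C := by
  simp only [mul0, oip0, conj, asc0, dot_seven, Pi.add_apply, Pi.sub_apply, Pi.smul_apply, Pi.neg_apply,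
    smul_eq_mul, Prod.fst_add, Prod.snd_add, Prod.fst_sub, Prod.snd_sub, Prod.smul_fst, Prod.smul_snd,
    Prod.fst_neg, Prod.snd_neg, cr_0, cr_1, cr_2, cr_3, cr_4, cr_5, cr_6]
  ring

theorem mul0_conj_flex (B x : Oct) : mul0 (conj B) (mul0 x B) = mul0 (mul0 (conj B) x) B := by
  apply oct_ext <;>
  simp only [mul0, oip0, conj, asc0, dot_seven, Pi.add_apply, Pi.sub_apply, Pi.smul_apply, Pi.neg_apply,
    smul_eq_mul, Prod.fst_add, Prod.snd_add, Prod.fst_sub, Prod.snd_sub, Prod.smul_fst, Prod.smul_snd,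
    Prod.fst_neg, Prod.snd_neg, cr_0, cr_1, cr_2, cr_3, cr_4, cr_5, cr_6] <;> ring

theorem twisted_mul0_re (V : Oct) (x y : Vec) :
    (mul0 (mul0 (imag x) V) (mul0 (conj V) (imag y))).1 = - oip0 V V * (x ⬝ᵥ y) := by
  simp only [mul0, imag, oip0, conj, asc0, dot_seven, Pi.add_apply, Pi.sub_apply, Pi.smul_apply, Pi.neg_apply,
    smul_eq_mul, Prod.fst_add, Prod.snd_add, Prod.fst_sub, Prod.snd_sub, Prod.smul_fst, Prod.smul_snd,
    Prod.fst_neg, Prod.snd_neg, cr_0, cr_1, cr_2, cr_3, cr_4, cr_5, cr_6]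
  ring

/-- The twisted product `(xV)(V̄y)` is `|V|²` times the product of `σ_V(φ₀)`. The associator term
becomes `-2 v₀ v ⌟ ψ₀` through `psi0_eq_asc0`. -/
theorem twisted_mul0_im (V : Oct) (x y z : Vec) :
    (mul0 (mul0 (imag x) V) (mul0 (conj V) (imag y))).2 ⬝ᵥ z =
    (V.1 ^ 2 - V.2 ⬝ᵥ V.2) * (cr x y ⬝ᵥ z) + V.1 * (asc0 (imag x) (imag y) (imag V.2)).2 ⬝ᵥ z
    + 2 * ((V.2 ⬝ᵥ x) * (cr V.2 y ⬝ᵥ z) + (V.2 ⬝ᵥ y) * (cr V.2 z ⬝ᵥ x)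
      + (V.2 ⬝ᵥ z) * (cr V.2 x ⬝ᵥ y)) := by
  simp only [mul0, imag, oip0, conj, asc0, dot_seven, Pi.add_apply, Pi.sub_apply, Pi.smul_apply, Pi.neg_apply,
    smul_eq_mul, Prod.fst_add, Prod.snd_add, Prod.fst_sub, Prod.snd_sub, Prod.smul_fst, Prod.smul_snd,
    Prod.fst_neg, Prod.snd_neg, cr_0, cr_1, cr_2, cr_3, cr_4, cr_5, cr_6]
  ring

/-! ### Linearity of the component operations -/

/-- The trilinear map with components `p`. -/
def tri (p : Form3) (u v w : Vec) : ℝ := ∑ a, ∑ b, ∑ c, p a b c * u a * v b * w c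

/-- The inner product of octonions. -/
def oip (G : Matrix (Fin 7) (Fin 7) ℝ) (A B : Oct) : ℝ := A.1 * B.1 + ip G A.2 B.2

variable (G : Matrix (Fin 7) (Fin 7) ℝ) (p : Form3)

theorem ip_eq_dot (u v : Vec) : ip G u v = u ⬝ᵥ G.mulVec v := by
  simp only [ip, dotProduct, Matrix.mulVec, Finset.mul_sum]
  exact Finset.sum_congr rfl fun a _ => Finset.sum_congr rfl fun b _ => by ring

theorem ip_add_left (u u' v : Vec) : ip G (u + u') v = ip G u v + ip G u' v := by
  simp only [ip_eq_dot, add_dotProduct]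

theorem ip_add_right (u v v' : Vec) : ip G u (v + v') = ip G u v + ip G u v' := by
  simp only [ip_eq_dot, Matrix.mulVec_add, dotProduct_add]

theorem ip_smul_left (c : ℝ) (u v : Vec) : ip G (c • u) v = c * ip G u v := by
  simp only [ip_eq_dot, smul_dotProduct, smul_eq_mul]

theorem ip_smul_right (c : ℝ) (u v : Vec) : ip G u (c • v) = c * ip G u v := by
  simp only [ip_eq_dot, Matrix.mulVec_smul, dotProduct_smul, smul_eq_mul]

theorem ip_single (i j : Fin 7) : ip G (Pi.single i 1) (Pi.single j 1) = G i j := by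
  simp [ip_eq_dot]

/-- The inner product of octonions as a bilinear map. -/
def oipB : Oct →ₗ[ℝ] Oct →ₗ[ℝ] ℝ :=
  LinearMap.mk₂ ℝ (oip G)
    (fun A A' B => by simp only [oip, Prod.fst_add, Prod.snd_add, ip_add_left]; ring)
    (fun c A B => by
      simp only [oip, Prod.smul_fst, Prod.smul_snd, ip_smul_left, smul_eq_mul]; ring)
    (fun A B B' => by simp only [oip, Prod.fst_add, Prod.snd_add, ip_add_right]; ring)
    (fun c A B => by
      simp only [oip, Prod.smul_fst, Prod.smul_snd, ip_smul_right, smul_eq_mul]; ring)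

theorem oipB_apply (A B : Oct) : oipB G A B = oip G A B := rfl

theorem cross_add_left (u u' v : Vec) : cross G p (u + u') v = cross G p u v + cross G p u' v := by
  ext k
  simp only [cross, Pi.add_apply, mul_add, add_mul, Finset.sum_add_distrib]

theorem cross_add_right (u v v' : Vec) :
    cross G p u (v + v') = cross G p u v + cross G p u v' := by
  ext k
  simp only [cross, Pi.add_apply, mul_add, Finset.sum_add_distrib]

theorem cross_smul_left (c : ℝ) (u v : Vec) : cross G p (c • u) v = c • cross G p u v := by
  ext k
  simp only [cross, Pi.smul_apply, smul_eq_mul, Finset.mul_sum]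
  exact Finset.sum_congr rfl fun _ _ => Finset.sum_congr rfl fun _ _ =>
    Finset.sum_congr rfl fun _ _ => by ring

theorem cross_smul_right (c : ℝ) (u v : Vec) : cross G p u (c • v) = c • cross G p u v := by
  ext k
  simp only [cross, Pi.smul_apply, smul_eq_mul, Finset.mul_sum]
  exact Finset.sum_congr rfl fun _ _ => Finset.sum_congr rfl fun _ _ =>
    Finset.sum_congr rfl fun _ _ => by ring

/-- The octonion product as a bilinear map. -/
def omulB : Oct →ₗ[ℝ] Oct →ₗ[ℝ] Oct :=
  LinearMap.mk₂ ℝ (omul G p)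
    (fun A A' B => by
      ext i <;> simp only [omul, Prod.fst_add, Prod.snd_add, ip_add_left, cross_add_left,
        Pi.add_apply, Pi.smul_apply, smul_eq_mul] <;> ring)
    (fun c A B => by
      ext i <;> simp only [omul, Prod.smul_fst, Prod.smul_snd, ip_smul_left, cross_smul_left,
        Pi.add_apply, Pi.smul_apply, smul_eq_mul] <;> ring)
    (fun A B B' => by
      ext i <;> simp only [omul, Prod.fst_add, Prod.snd_add, ip_add_right, cross_add_right,
        Pi.add_apply, Pi.smul_apply, smul_eq_mul] <;> ring)
    (fun c A B => by
      ext i <;> simp only [omul, Prod.smul_fst, Prod.smul_snd, ip_smul_right, cross_smul_right,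
        Pi.add_apply, Pi.smul_apply, smul_eq_mul] <;> ring)

theorem omulB_apply (A B : Oct) : omulB G p A B = omul G p A B := rfl

theorem omul_add_left (A A' B : Oct) : omul G p (A + A') B = omul G p A B + omul G p A' B :=
  (omulB G p).map_add₂ A A' B
theorem omul_sub_left (A A' B : Oct) : omul G p (A - A') B = omul G p A B - omul G p A' B :=
  (omulB G p).map_sub₂ A A' B
theorem omul_neg_left (A B : Oct) : omul G p (-A) B = - omul G p A B :=
  (omulB G p).map_neg₂ A B
theorem omul_smul_left (c : ℝ) (A B : Oct) : omul G p (c • A) B = c • omul G p A B :=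
  (omulB G p).map_smul₂ c A B
theorem omul_add_right (A B B' : Oct) : omul G p A (B + B') = omul G p A B + omul G p A B' :=
  (omulB G p A).map_add B B'
theorem omul_sub_right (A B B' : Oct) : omul G p A (B - B') = omul G p A B - omul G p A B' :=
  (omulB G p A).map_sub B B'
theorem omul_neg_right (A B : Oct) : omul G p A (-B) = - omul G p A B := (omulB G p A).map_neg B
theorem omul_smul_right (c : ℝ) (A B : Oct) : omul G p A (c • B) = c • omul G p A B :=
  (omulB G p A).map_smul c B
theorem omul_zero_right (A : Oct) : omul G p A 0 = 0 := (omulB G p A).map_zero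
theorem omul_sum_left {ι : Type*} (s : Finset ι) (A : ι → Oct) (B : Oct) :
    omul G p (∑ i ∈ s, A i) B = ∑ i ∈ s, omul G p (A i) B :=
  (omulB G p).map_sum₂ s A B
theorem omul_sum_right {ι : Type*} (s : Finset ι) (A : Oct) (B : ι → Oct) :
    omul G p A (∑ i ∈ s, B i) = ∑ i ∈ s, omul G p A (B i) :=
  map_sum (omulB G p A) B s

theorem oip_add_left (A A' B : Oct) : oip G (A + A') B = oip G A B + oip G A' B :=
  (oipB G).map_add₂ A A' B
theorem oip_sub_left (A A' B : Oct) : oip G (A - A') B = oip G A B - oip G A' B :=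
  (oipB G).map_sub₂ A A' B
theorem oip_neg_left (A B : Oct) : oip G (-A) B = - oip G A B := (oipB G).map_neg₂ A B
theorem oip_smul_left (c : ℝ) (A B : Oct) : oip G (c • A) B = c * oip G A B :=
  (oipB G).map_smul₂ c A B
theorem oip_add_right (A B B' : Oct) : oip G A (B + B') = oip G A B + oip G A B' :=
  (oipB G A).map_add B B'
theorem oip_sub_right (A B B' : Oct) : oip G A (B - B') = oip G A B - oip G A B' :=
  (oipB G A).map_sub B B'
theorem oip_smul_right (c : ℝ) (A B : Oct) : oip G A (c • B) = c * oip G A B :=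
  (oipB G A).map_smul c B
theorem oip_sum_left {ι : Type*} (s : Finset ι) (A : ι → Oct) (B : Oct) :
    oip G (∑ i ∈ s, A i) B = ∑ i ∈ s, oip G (A i) B :=
  (oipB G).map_sum₂ s A B
theorem oip_sum_right {ι : Type*} (s : Finset ι) (A : Oct) (B : ι → Oct) :
    oip G A (∑ i ∈ s, B i) = ∑ i ∈ s, oip G A (B i) :=
  map_sum (oipB G A) B s

/-- The trilinear map with components `p`, as a linear map in each argument. -/
def triB : Vec →ₗ[ℝ] Vec →ₗ[ℝ] Vec →ₗ[ℝ] ℝ :=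
  LinearMap.mk₂ ℝ (fun u v =>
    { toFun := fun w => tri p u v w
      map_add' := fun w w' => by
        simp only [tri, Pi.add_apply, mul_add, Finset.sum_add_distrib]
      map_smul' := fun c w => by
        simp only [tri, Pi.smul_apply, smul_eq_mul, RingHom.id_apply, Finset.mul_sum]
        exact Finset.sum_congr rfl fun _ _ => Finset.sum_congr rfl fun _ _ =>
          Finset.sum_congr rfl fun _ _ => by ring })
    (fun u u' v => by
      ext w; simp [tri, mul_add, add_mul, Finset.sum_add_distrib])
    (fun c u v => by
      refine LinearMap.ext fun w => ?_
      simp only [tri, Pi.smul_apply, smul_eq_mul, LinearMap.smul_apply, LinearMap.coe_mk,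
        AddHom.coe_mk, Finset.mul_sum]
      exact Finset.sum_congr rfl fun _ _ => Finset.sum_congr rfl fun _ _ =>
          Finset.sum_congr rfl fun _ _ => by ring)
    (fun u v v' => by
      ext w; simp [tri, mul_add, add_mul, Finset.sum_add_distrib])
    (fun c u v => by
      refine LinearMap.ext fun w => ?_
      simp only [tri, Pi.smul_apply, smul_eq_mul, LinearMap.smul_apply, LinearMap.coe_mk,
        AddHom.coe_mk, Finset.mul_sum]
      exact Finset.sum_congr rfl fun _ _ => Finset.sum_congr rfl fun _ _ =>
          Finset.sum_congr rfl fun _ _ => by ring)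

theorem triB_apply (u v w : Vec) : triB p u v w = tri p u v w := rfl

theorem tri_single (a b c : Fin 7) :
    tri p (Pi.single a 1) (Pi.single b 1) (Pi.single c 1) = p a b c := by
  simp [tri, Pi.single_apply]

theorem omul_one (A : Oct) : omul G p A (1, 0) = A := by
  have h : cross G p A.2 0 = 0 := by simpa using cross_smul_right G p 0 A.2 0
  have h' : ip G A.2 0 = 0 := by simpa using ip_smul_right G 0 A.2 0
  simp [omul, h, h']

theorem one_omul (A : Oct) : omul G p (1, 0) A = A := by
  have h : cross G p 0 A.2 = 0 := by simpa using cross_smul_left G p 0 0 A.2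
  have h' : ip G 0 A.2 = 0 := by simpa using ip_smul_left G 0 0 A.2
  simp [omul, h, h']

theorem imag_add (u v : Vec) : imag (u + v) = imag u + imag v := by simp [imag]
theorem imag_smul (c : ℝ) (u : Vec) : imag (c • u) = c • imag u := by simp [imag]

/-- `imag` as a linear map. -/
def imagL : Vec →ₗ[ℝ] Oct where
  toFun := imag
  map_add' := imag_add
  map_smul' := imag_smul

theorem imagL_apply (u : Vec) : imagL u = imag u := rfl

theorem imag_eq_sum (u : Vec) : imag u = ∑ i, u i • delta i := by
  conv_lhs => rw [← imagL_apply, pi_eq_sum_univ' u]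
  rw [map_sum]
  refine Finset.sum_congr rfl fun i _ => ?_
  rw [map_smul, imagL_apply, delta]

theorem oct_eq (A : Oct) : A = A.1 • (1, 0) + imag A.2 := by
  ext <;> simp [imag]

variable {G p}

/-! ### Frames -/

/-- `L` identifies the metric and the 3-form with the Euclidean metric and `φ₀`. -/
structure IsFrame (G : Matrix (Fin 7) (Fin 7) ℝ) (p : Form3) (L : Vec ≃ₗ[ℝ] Vec) : Prop where
  ip_eq : ∀ u v, ip G u v = L u ⬝ᵥ L v
  tri_eq : ∀ u v w, tri p u v w = cr (L u) (L v) ⬝ᵥ L w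

/-- A linear automorphism of the imaginary part, extended to the octonions. -/
def lam (L : Vec ≃ₗ[ℝ] Vec) : Oct ≃ₗ[ℝ] Oct := (LinearEquiv.refl ℝ ℝ).prodCongr L

theorem lam_apply (L : Vec ≃ₗ[ℝ] Vec) (A : Oct) : lam L A = (A.1, L A.2) := rfl

theorem lam_imag (L : Vec ≃ₗ[ℝ] Vec) (u : Vec) : lam L (imag u) = imag (L u) := rfl

theorem lam_conj (L : Vec ≃ₗ[ℝ] Vec) (A : Oct) : lam L (conj A) = conj (lam L A) := by
  simp [lam_apply, conj]

namespace IsFrame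

variable {L : Vec ≃ₗ[ℝ] Vec} (h : IsFrame G p L)
include h

theorem symm (i j : Fin 7) : G i j = G j i := by
  rw [← ip_single G, ← ip_single G, h.ip_eq, h.ip_eq, dotProduct_comm]

theorem isUnit_det : IsUnit G.det := by
  rw [← Matrix.isUnit_iff_isUnit_det, ← Matrix.mulVec_injective_iff_isUnit]
  refine (injective_iff_map_eq_zero (Matrix.mulVecLin G)).2 fun v hv => ?_
  have h1 : L v ⬝ᵥ L v = 0 := by
    rw [← h.ip_eq, ip_eq_dot]
    rw [Matrix.mulVecLin_apply] at hv
    simp [hv]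
  simpa using dotProduct_self_eq_zero.1 h1

theorem inv_mul : G⁻¹ * G = 1 := Matrix.nonsing_inv_mul _ h.isUnit_det
theorem mul_inv : G * G⁻¹ = 1 := Matrix.mul_nonsing_inv _ h.isUnit_det

theorem ip_comm (u v : Vec) : ip G u v = ip G v u := by
  rw [h.ip_eq, h.ip_eq, dotProduct_comm]

theorem inv_symm (i j : Fin 7) : G⁻¹ i j = G⁻¹ j i := by
  have hs : G.transpose = G := by ext a b; exact h.symm b a
  have : G⁻¹.transpose = G⁻¹ := by rw [Matrix.transpose_nonsing_inv, hs]
  exact congrFun (congrFun this j) i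

theorem ip_inv (u w : Vec) : ip G (G⁻¹.mulVec w) u = w ⬝ᵥ u := by
  rw [h.ip_comm, ip_eq_dot, Matrix.mulVec_mulVec, h.mul_inv, Matrix.one_mulVec, dotProduct_comm]

theorem ip_cross (q : Form3) (u v w : Vec) : ip G (cross G q u v) w = tri q u v w := by
  have : cross G q u v = G⁻¹.mulVec (fun c => ∑ a, ∑ b, q a b c * u a * v b) := rfl
  rw [this, h.ip_inv]
  simp only [dotProduct, tri, Finset.sum_mul]
  rw [Finset.sum_comm]
  exact Finset.sum_congr rfl fun a _ => Finset.sum_comm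

theorem map_cross (u v : Vec) : L (cross G p u v) = cr (L u) (L v) := by
  refine dotProduct_eq _ _ fun w => ?_
  have := h.ip_cross p u v (L.symm w)
  rwa [h.ip_eq, h.tri_eq, L.apply_symm_apply] at this

theorem lam_omul (A B : Oct) : lam L (omul G p A B) = mul0 (lam L A) (lam L B) := by
  simp only [lam_apply, omul, mul0, map_add, map_smul, h.map_cross, h.ip_eq]

theorem oip_eq (A B : Oct) : oip G A B = oip0 (lam L A) (lam L B) := by
  simp only [oip, oip0, lam_apply, h.ip_eq]

theorem normSq_eq (A : Oct) : normSq G A = oip0 (lam L A) (lam L A) := by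
  simp only [normSq, oip0, lam_apply, h.ip_eq, sq]

theorem oip_self (A : Oct) : oip G A A = normSq G A := by
  rw [h.oip_eq, h.normSq_eq]

theorem oip_comm (A B : Oct) : oip G A B = oip G B A := by
  simp only [oip, h.ip_comm A.2, mul_comm A.1]

theorem ext_oip {A B : Oct} (hAB : ∀ C, oip G A C = oip G B C) : A = B := by
  have h1 := hAB (A - B)
  rw [← sub_eq_zero, ← oip_sub_left, h.oip_eq, oip0] at h1
  have h2 : 0 ≤ (lam L (A - B)).2 ⬝ᵥ (lam L (A - B)).2 := by
    simpa using dotProduct_star_self_nonneg (lam L (A - B)).2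
  have h3 : (lam L (A - B)).1 = 0 := by nlinarith [mul_self_nonneg (lam L (A - B)).1]
  have h4 : (lam L (A - B)).2 = 0 := by
    refine dotProduct_self_eq_zero.1 ?_
    nlinarith [mul_self_nonneg (lam L (A - B)).1]
  rw [← sub_eq_zero, ← (lam L).map_eq_zero_iff]
  exact Prod.ext h3 h4

theorem normSq_pos {A : Oct} (hA : A ≠ 0) : 0 < normSq G A := by
  have h1 : 0 ≤ normSq G A := by
    have := dotProduct_star_self_nonneg (lam L A).2
    rw [h.normSq_eq, oip0]
    simp only [star_trivial] at this
    nlinarith [mul_self_nonneg (lam L A).1]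
  refine lt_of_le_of_ne h1 fun h0 => hA ?_
  rw [h.normSq_eq, oip0] at h0
  have h2 : 0 ≤ (lam L A).2 ⬝ᵥ (lam L A).2 := by
    simpa using dotProduct_star_self_nonneg (lam L A).2
  have h3 : (lam L A).1 = 0 := by nlinarith [mul_self_nonneg (lam L A).1]
  have h4 : (lam L A).2 = 0 := by
    refine dotProduct_self_eq_zero.1 ?_
    nlinarith [mul_self_nonneg (lam L A).1]
  rw [← (lam L).map_eq_zero_iff]
  exact Prod.ext h3 h4

theorem omul_alt (A B : Oct) : omul G p A (omul G p A B) = omul G p (omul G p A A) B := by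
  apply (lam L).injective
  simp only [h.lam_omul, mul0_alt]

theorem omul_omul_conj (A V : Oct) : omul G p (omul G p A V) (conj V) = normSq G V • A := by
  apply (lam L).injective
  simp only [h.lam_omul, lam_conj, map_smul, h.normSq_eq, mul0_mul_conj]

theorem oip_omul_left (A B C : Oct) :
    oip G (omul G p A B) (omul G p A C) = normSq G A * oip G B C := by
  simp only [h.oip_eq, h.lam_omul, h.normSq_eq, oip0_mul0_left]

theorem oip_omul_right (A B C : Oct) :
    oip G (omul G p A C) (omul G p B C) = oip G A B * normSq G C := by
  simp only [h.oip_eq, h.lam_omul, h.normSq_eq, oip0_mul0_right]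

theorem omul_right_cancel {A B V : Oct} (hV : V ≠ 0) (hAB : omul G p A V = omul G p B V) :
    A = B := by
  have h1 := h.omul_omul_conj A V
  rw [hAB, h.omul_omul_conj] at h1
  exact (smul_right_injective _ (h.normSq_pos hV).ne' h1).symm

/-- The Clifford relation. -/
theorem clifford (u v : Vec) (A : Oct) :
    omul G p (imag u) (omul G p (imag v) A) + omul G p (imag v) (omul G p (imag u) A)
      = (-2 * ip G u v) • A := by
  have sq : ∀ w : Vec, omul G p (imag w) (omul G p (imag w) A) = (- ip G w w) • A := by
    intro w
    have h0 : cross G p w w = 0 := by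
      apply L.injective
      rw [h.map_cross, map_zero]
      ext i
      fin_cases i <;> simp [cr] <;> ring
    have h1 : omul G p (imag w) (imag w) = (- ip G w w) • (1, 0) := by
      ext <;> simp [omul, imag, h0]
    rw [h.omul_alt, h1, omul_smul_left, one_omul]
  have h1 := sq (u + v)
  have h2 := sq u
  have h3 := sq v
  have h4 : ip G v u = ip G u v := h.ip_comm v u
  simp only [imag_add, omul_add_left, omul_add_right, h2, h3, ip_add_left, ip_add_right, h4] at h1
  linear_combination (norm := module) h1

end IsFrame

/-! ### Integer tables for `φ₀`, `ψ₀` and the permutation symbol -/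

/-- Integer components of `φ₀`. -/
def phiZ (a b c : Fin 7) : ℤ :=
  match a.val, b.val, c.val with
  | 0,1,2 | 1,2,0 | 2,0,1 | 0,3,4 | 3,4,0 | 4,0,3 | 0,5,6 | 5,6,0 | 6,0,5 | 1,3,5 | 3,5,1 | 5,1,3
  | 1,6,4 | 6,4,1 | 4,1,6 | 2,6,3 | 6,3,2 | 3,2,6 | 2,5,4 | 5,4,2 | 4,2,5 => 1
  | 0,2,1 | 2,1,0 | 1,0,2 | 0,4,3 | 4,3,0 | 3,0,4 | 0,6,5 | 6,5,0 | 5,0,6 | 1,5,3 | 5,3,1 | 3,1,5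
  | 1,4,6 | 4,6,1 | 6,1,4 | 2,3,6 | 3,6,2 | 6,2,3 | 2,4,5 | 4,5,2 | 5,2,4 => -1
  | _,_,_ => 0

/-- The Kronecker symbol. -/
def kron (a b : Fin 7) : ℤ := if a = b then 1 else 0

theorem cr_single_int : ∀ a b c : Fin 7,
    cr (Pi.single a (1 : ℤ)) (Pi.single b 1) c = phiZ a b c := by
  decide +kernel

/-- Integer components of `ψ₀ = *φ₀`. -/
def psiZ (a b c d : Fin 7) : ℤ :=
  (∑ k, phiZ a b k * phiZ k c d) + kron b c * kron a d - kron a c * kron b d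

/-- The sign of `b - a`. -/
def sgnZ (a b : Fin 7) : ℤ := if a < b then 1 else if b < a then -1 else 0

/-- The permutation symbol of seven indices. -/
def leviZ (a b c d e f g : Fin 7) : ℤ :=
  sgnZ a b * (sgnZ a c * (sgnZ a d * (sgnZ a e * (sgnZ a f * (sgnZ a g *
    (sgnZ b c * (sgnZ b d * (sgnZ b e * (sgnZ b f * (sgnZ b g *
    (sgnZ c d * (sgnZ c e * (sgnZ c f * (sgnZ c g *
    (sgnZ d e * (sgnZ d f * (sgnZ d g * (sgnZ e f * (sgnZ e g * sgnZ f g)))))))))))))))))))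

/-- This is `*φ₀ = ψ₀` on components: each of the seven monomials of `φ₀` is filled up to a
permutation of all seven indices. Working over `ℤ` makes it a finite computation. -/
theorem levi_lines : ∀ a b c d : Fin 7,
    leviZ 0 1 2 a b c d + leviZ 0 3 4 a b c d + leviZ 0 5 6 a b c d + leviZ 1 3 5 a b c d
      - leviZ 1 4 6 a b c d - leviZ 2 3 6 a b c d - leviZ 2 4 5 a b c d = psiZ a b c d := by
  decide +kernel

/-- The value `168` normalises the volume form: `6 · 168 / (7 · 144) = 1` in `IsFrame.volCoeff_eq`.
-/
theorem trace_phi_phi_psi : ∑ i, ∑ a, ∑ b, ∑ c, ∑ d, phiZ i a b * (phiZ i c d * psiZ a b c d) = 168 := by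
  decide +kernel

/-- The value `24` accounts for the constant `1/48` in the torsion, since `∇φ` is twice a
contraction of `ψ`. -/
theorem psi_psi : ∀ x s : Fin 7,
    ∑ y, ∑ z, ∑ t, psiZ x y z t * psiZ s y z t = 24 * kron x s := by
  decide +kernel

theorem levi_lines_right : ∀ a b c d : Fin 7,
    leviZ a b c d 0 1 2 + leviZ a b c d 0 3 4 + leviZ a b c d 0 5 6 + leviZ a b c d 1 3 5
      - leviZ a b c d 1 4 6 - leviZ a b c d 2 3 6 - leviZ a b c d 2 4 5 = psiZ a b c d := by
  decide +kernel

theorem cr_single (a b c : Fin 7) :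
    cr (Pi.single a (1 : ℝ)) (Pi.single b 1) c = phiZ a b c := by
  have hc : ∀ (u v : Fin 7 → ℤ), cr (fun i => (u i : ℝ)) (fun i => (v i : ℝ)) c = (cr u v c : ℤ) := by
    intro u v
    fin_cases c <;> simp [cr]
  have hs : ∀ a : Fin 7, (Pi.single a (1 : ℝ) : Vec) = fun i => ((Pi.single a (1 : ℤ) : Fin 7 → ℤ) i : ℝ) := by
    intro a
    ext i
    by_cases h : i = a
    · subst h; simp
    · simp [h]
  rw [hs, hs, hc, cr_single_int]

theorem cr_eq_sum (u v : Vec) (k : Fin 7) : cr u v k = ∑ a, ∑ b, (phiZ a b k : ℝ) * u a * v b := by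
  simp only [← cr_single, Fin.sum_univ_seven]
  fin_cases k <;> simp [cr] <;> ring

/-- The 4-form `ψ₀`. -/
def psi0 (s u v w : Vec) : ℝ := ∑ a, ∑ b, ∑ c, ∑ d, (psiZ a b c d : ℝ) * s a * u b * v c * w d

/-! ### Permutation symbols, determinants and the Hodge dual of `φ` -/

theorem leviZ_eq_prod (s : Fin 7 → Fin 7) :
    leviZ (s 0) (s 1) (s 2) (s 3) (s 4) (s 5) (s 6) =
      ∏ j, ∏ i ∈ Finset.Iio j, sgnZ (s i) (s j) := by
  have h : ∀ F : Fin 7 → Fin 7 → ℤ, ∏ j, ∏ i ∈ Finset.Iio j, F i j =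
      F 0 1 * (F 0 2 * (F 0 3 * (F 0 4 * (F 0 5 * (F 0 6 * (F 1 2 * (F 1 3 * (F 1 4 * (F 1 5 *
      (F 1 6 * (F 2 3 * (F 2 4 * (F 2 5 * (F 2 6 * (F 3 4 * (F 3 5 * (F 3 6 * (F 4 5 *
      (F 4 6 * F 5 6))))))))))))))))))) := by
    intro F
    have h4 : ∀ j : Fin 7, Finset.Iio j = Finset.univ.filter (· < j) := by decide
    simp only [h4, Finset.prod_filter, Fin.prod_univ_seven]
    simp
    ring
  rw [h]
  rfl

/-- For a permutation, both sides are its sign, counted by inversions. With a repeated index, the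
determinant has two equal rows and one of the factors `sgnZ` vanishes. -/
theorem levi_eq (s : Fin 7 → Fin 7) :
    levi s = leviZ (s 0) (s 1) (s 2) (s 3) (s 4) (s 5) (s 6) := by
  rw [leviZ_eq_prod]
  by_cases hs : Function.Injective s
  · have h2 := Matrix.det_permute (Equiv.ofBijective s (Finite.injective_iff_bijective.1 hs))
      (1 : Matrix (Fin 7) (Fin 7) ℝ)
    rw [Matrix.det_one, mul_one] at h2
    refine Eq.trans h2 ?_
    rw [Equiv.Perm.sign_eq_prod_prod_Iio]
    push_cast
    refine Finset.prod_congr rfl fun j _ => Finset.prod_congr rfl fun i hi => ?_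
    rw [Equiv.ofBijective_apply, Equiv.ofBijective_apply]
    rcases lt_trichotomy (s i) (s j) with h | h | h
    · simp [sgnZ, h]
    · exact absurd (hs h) (Finset.mem_Iio.1 hi).ne
    · simp [sgnZ, h, not_lt_of_gt h]
  · have key : ∃ i j, i < j ∧ s i = s j := by
      simp only [Function.Injective, not_forall] at hs
      obtain ⟨i, j, hij, hne⟩ := hs
      rcases lt_or_gt_of_ne hne with h | h
      · exact ⟨i, j, h, hij⟩
      · exact ⟨j, i, h, hij.symm⟩
    obtain ⟨i, j, hlt, hij⟩ := key
    have h1 : levi s = 0 := by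
      refine Matrix.det_zero_of_row_eq hlt.ne ?_
      ext k
      rw [Matrix.submatrix_apply, Matrix.submatrix_apply, hij]
    rw [h1, Finset.prod_eq_zero (Finset.mem_univ j)
      (Finset.prod_eq_zero (Finset.mem_Iio.2 hlt) (by rw [hij, sgnZ]; simp))]
    simp

/-- Functions on `Fin 7` as tuples. -/
def funEquivTuple : (Fin 7 → Fin 7) ≃
    Fin 7 × Fin 7 × Fin 7 × Fin 7 × Fin 7 × Fin 7 × Fin 7 where
  toFun s := (s 0, s 1, s 2, s 3, s 4, s 5, s 6)
  invFun t := ![t.1, t.2.1, t.2.2.1, t.2.2.2.1, t.2.2.2.2.1, t.2.2.2.2.2.1, t.2.2.2.2.2.2]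
  left_inv s := by ext i; fin_cases i <;> rfl
  right_inv _ := rfl

theorem sum_fun_seven (f : (Fin 7 → Fin 7) → ℝ) :
    ∑ s, f s = ∑ a, ∑ b, ∑ c, ∑ d, ∑ e, ∑ g, ∑ h, f ![a, b, c, d, e, g, h] := by
  rw [← funEquivTuple.symm.sum_comp]
  simp only [Fintype.sum_prod_type]
  rfl

/-- The determinant of the matrix with given rows. -/
def det7 (r : Fin 7 → Vec) : ℝ := (Matrix.detRowAlternating (R := ℝ) (n := Fin 7)) r

theorem vec_eq_sum (x : Vec) : x = ∑ k, x k • (Pi.single k (1 : ℝ) : Vec) := by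
  rw [← pi_eq_sum_univ']

/-- The determinant of the rows, as a multilinear map. -/
def det7M : MultilinearMap ℝ (fun _ : Fin 7 => Vec) ℝ :=
  (Matrix.detRowAlternating (R := ℝ) (n := Fin 7)).toMultilinearMap

theorem det7M_apply (r : Fin 7 → Vec) : det7M r = det7 r := rfl

theorem det7_eq_det (r : Fin 7 → Vec) : det7 r = Matrix.det (Matrix.of r) := by
  rw [det7, Matrix.det]
  exact congrArg _ rfl

theorem multilinear_eq_sum {n : ℕ} (f : MultilinearMap ℝ (fun _ : Fin n => Vec) ℝ)
    (r : Fin n → Vec) :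
    f r = ∑ s : Fin n → Fin 7, (∏ i, r i (s i)) * f (fun i => Pi.single (s i) (1 : ℝ)) := by
  have hr : (fun n => ∑ k, r n k • (Pi.single k (1 : ℝ) : Vec)) = r :=
    funext fun n => (vec_eq_sum (r n)).symm
  have key := f.map_sum (fun n k => r n k • (Pi.single k (1 : ℝ) : Vec))
  rw [hr] at key
  rw [key]
  refine Finset.sum_congr rfl fun s _ => ?_
  rw [MultilinearMap.map_smul_univ, smul_eq_mul]

theorem det7M_single (s : Fin 7 → Fin 7) : det7M (fun n => Pi.single (s n) (1 : ℝ)) = levi s := by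
  rw [det7M_apply, det7_eq_det, levi]
  congr 1
  ext i j
  rw [Matrix.submatrix_apply, Matrix.one_apply]
  simp [Pi.single_apply, eq_comm]

theorem det7_eq_sum (r : Fin 7 → Vec) : det7 r = ∑ s, levi s * ∏ n, r n (s n) := by
  rw [← det7M_apply, multilinear_eq_sum]
  exact Finset.sum_congr rfl fun s _ => by rw [det7M_single, mul_comm]

theorem det7_map (M : Matrix (Fin 7) (Fin 7) ℝ) (r : Fin 7 → Vec) :
    det7 (fun n => M.mulVec (r n)) = M.det * det7 r := by
  rw [det7_eq_det, det7_eq_det, mul_comm, ← Matrix.det_transpose M, ← Matrix.det_mul]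
  congr 1
  ext i j
  simp [Matrix.mul_apply, Matrix.mulVec, dotProduct, mul_comm]

theorem det7_eq_nested (x y z u v w t : Vec) : det7 ![x, y, z, u, v, w, t] =
    ∑ i, ∑ j, ∑ k, x i * y j * z k *
      ∑ a, ∑ b, ∑ c, ∑ d, levi ![i, j, k, a, b, c, d] * (u a * v b * w c * t d) := by
  rw [det7_eq_sum, sum_fun_seven]
  simp only [Finset.mul_sum]
  refine Finset.sum_congr rfl fun i _ => Finset.sum_congr rfl fun j _ =>
    Finset.sum_congr rfl fun k _ => Finset.sum_congr rfl fun a _ =>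
    Finset.sum_congr rfl fun b _ => Finset.sum_congr rfl fun c _ =>
    Finset.sum_congr rfl fun d _ => ?_
  simp [Fin.prod_univ_seven]
  ring

/-- The support of `φ₀` consists of the six orderings of seven triples. On each triple the two sign
changes cancel, so the orderings contribute equally. -/
theorem sum_phiZ (F : Fin 7 → Fin 7 → Fin 7 → ℝ) (h1 : ∀ a b c, F b a c = - F a b c)
    (h2 : ∀ a b c, F a c b = - F a b c) :
    ∑ a, ∑ b, ∑ c, (phiZ a b c : ℝ) * F a b c =
      6 * (F 0 1 2 + F 0 3 4 + F 0 5 6 + F 1 3 5 - F 1 4 6 - F 2 3 6 - F 2 4 5) := by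
  have h : ∀ a b c, F b c a = F a b c ∧ F c a b = F a b c ∧ F b a c = - F a b c ∧
      F a c b = - F a b c ∧ F c b a = - F a b c := fun a b c =>
    ⟨by rw [h2 b a c, h1 a b c, neg_neg], by rw [h1 a c b, h2 a b c, neg_neg], h1 a b c, h2 a b c,
      by rw [h1 b c a, h2 b a c, h1 a b c, neg_neg]⟩
  obtain ⟨a1, a2, a3, a4, a5⟩ := h 0 1 2
  obtain ⟨b1, b2, b3, b4, b5⟩ := h 0 3 4
  obtain ⟨c1, c2, c3, c4, c5⟩ := h 0 5 6
  obtain ⟨d1, d2, d3, d4, d5⟩ := h 1 3 5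
  obtain ⟨e1, e2, e3, e4, e5⟩ := h 1 4 6
  obtain ⟨f1, f2, f3, f4, f5⟩ := h 2 3 6
  obtain ⟨g1, g2, g3, g4, g5⟩ := h 2 4 5
  have h0 : ∀ a b, ∑ c, (phiZ a b c : ℝ) * F a b c = ∑ c, cr (Pi.single a (1 : ℝ)) (Pi.single b 1) c * F a b c := by
    intro a b; simp only [cr_single]
  simp only [h0, Fin.sum_univ_seven, cr_0, cr_1, cr_2, cr_3, cr_4, cr_5, cr_6]
  simp
  linarith

theorem levi_swap (s : Fin 7 → Fin 7) {i j : Fin 7} (hij : i ≠ j) :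
    levi (s ∘ Equiv.swap i j) = - levi s := by
  have := Matrix.det_permute (Equiv.swap i j) ((1 : Matrix (Fin 7) (Fin 7) ℝ).submatrix s id)
  rw [Equiv.Perm.sign_swap hij] at this
  simpa [levi] using this

theorem sum_phiZ_levi (a b c d : Fin 7) :
    ∑ i, ∑ j, ∑ k, (phiZ i j k : ℝ) * levi ![i, j, k, a, b, c, d] = 6 * psiZ a b c d := by
  rw [sum_phiZ, ← levi_lines]
  · simp [levi_eq]
  · intro i j k
    rw [← levi_swap _ (show (0 : Fin 7) ≠ 1 by decide)]
    congr 1; ext n; fin_cases n <;> rfl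
  · intro i j k
    rw [← levi_swap _ (show (1 : Fin 7) ≠ 2 by decide)]
    congr 1; ext n; fin_cases n <;> rfl

theorem sum_levi_phiZ (a b c d : Fin 7) :
    ∑ i, ∑ j, ∑ k, (phiZ i j k : ℝ) * levi ![a, b, c, d, i, j, k] = 6 * psiZ a b c d := by
  rw [sum_phiZ, ← levi_lines_right]
  · simp [levi_eq]
  · intro i j k
    rw [← levi_swap _ (show (4 : Fin 7) ≠ 5 by decide)]
    congr 1; ext n; fin_cases n <;> rfl
  · intro i j k
    rw [← levi_swap _ (show (5 : Fin 7) ≠ 6 by decide)]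
    congr 1; ext n; fin_cases n <;> rfl

theorem sum_comm_three_three {f : Fin 7 → Fin 7 → Fin 7 → Fin 7 → Fin 7 → Fin 7 → ℝ} :
    ∑ i, ∑ j, ∑ k, ∑ x, ∑ y, ∑ z, f i j k x y z = ∑ x, ∑ y, ∑ z, ∑ i, ∑ j, ∑ k, f i j k x y z := by
  have := Finset.sum_comm (s := (Finset.univ : Finset (Fin 7 × Fin 7 × Fin 7)))
    (t := (Finset.univ : Finset (Fin 7 × Fin 7 × Fin 7)))
    (f := fun x y => f x.1 x.2.1 x.2.2 y.1 y.2.1 y.2.2)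
  simpa only [Fintype.sum_prod_type] using this

theorem sum_comm_four_three {f : Fin 7 → Fin 7 → Fin 7 → Fin 7 → Fin 7 → Fin 7 → Fin 7 → ℝ} :
    ∑ a, ∑ b, ∑ c, ∑ d, ∑ x, ∑ y, ∑ z, f a b c d x y z
      = ∑ x, ∑ y, ∑ z, ∑ a, ∑ b, ∑ c, ∑ d, f a b c d x y z := by
  have := Finset.sum_comm (s := (Finset.univ : Finset (Fin 7 × Fin 7 × Fin 7 × Fin 7)))
    (t := (Finset.univ : Finset (Fin 7 × Fin 7 × Fin 7)))
    (f := fun x y => f x.1 x.2.1 x.2.2.1 x.2.2.2 y.1 y.2.1 y.2.2)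
  simpa only [Fintype.sum_prod_type] using this

/-- The 4-linear map with components `h`. -/
def quad (h : Fin 7 → Fin 7 → Fin 7 → Fin 7 → ℝ) (s u v w : Vec) : ℝ :=
  ∑ a, ∑ b, ∑ c, ∑ d, h a b c d * s a * u b * v c * w d

theorem quad_of_dual (P : Form3) (D : ℝ) (s u v w : Vec) :
    quad (fun a b c d => (1 / 6) * ∑ i, ∑ j, ∑ k, P i j k * (D * levi ![i, j, k, a, b, c, d]))
      s u v w = (1 / 6) * ∑ i, ∑ j, ∑ k, P i j k *
        (D * ∑ a, ∑ b, ∑ c, ∑ d, levi ![i, j, k, a, b, c, d] * (s a * u b * v c * w d)) := by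
  simp only [quad, Finset.mul_sum, Finset.sum_mul]
  rw [sum_comm_four_three]
  exact Finset.sum_congr rfl fun _ _ => Finset.sum_congr rfl fun _ _ =>
    Finset.sum_congr rfl fun _ _ => Finset.sum_congr rfl fun _ _ =>
    Finset.sum_congr rfl fun _ _ => Finset.sum_congr rfl fun _ _ =>
    Finset.sum_congr rfl fun _ _ => by ring

theorem cr_dot_eq_sum (u v w : Vec) :
    cr u v ⬝ᵥ w = ∑ a, ∑ b, ∑ c, (phiZ a b c : ℝ) * u a * v b * w c := by
  simp only [dotProduct, cr_eq_sum, Finset.sum_mul]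
  rw [Finset.sum_comm]
  exact Finset.sum_congr rfl fun a _ => Finset.sum_comm

/-- `ψ₀` measures the failure of associativity. From here on `ψ` is handled through the associator,
where the octonion identities apply. -/
theorem psi0_eq_asc0 (s u v w : Vec) :
    psi0 s u v w = -(1 / 2) * (asc0 (imag u) (imag v) (imag s)).2 ⬝ᵥ w := by
  -- The definition of `psiZ` as a contraction of `φ₀` with itself plus Kronecker terms, read off as
  -- cross and inner products.
  have h1 : psi0 s u v w = cr (cr s u) v ⬝ᵥ w + (u ⬝ᵥ v) * (s ⬝ᵥ w) - (s ⬝ᵥ v) * (u ⬝ᵥ w) := by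
    have hk : ∀ a b : Fin 7, (kron a b : ℝ) = if a = b then 1 else 0 := by
      intro a b; simp [kron]
    have h2 : cr (cr s u) v ⬝ᵥ w =
        ∑ a, ∑ b, ∑ c, ∑ d, (∑ k, (phiZ a b k : ℝ) * phiZ k c d) * s a * u b * v c * w d := by
      rw [cr_dot_eq_sum]
      simp only [cr_eq_sum, Finset.mul_sum, Finset.sum_mul]
      have := Finset.sum_comm (s := (Finset.univ : Finset (Fin 7 × Fin 7 × Fin 7)))
        (t := (Finset.univ : Finset (Fin 7 × Fin 7)))
        (f := fun x y => (phiZ x.1 x.2.1 x.2.2 : ℝ) * (phiZ y.1 y.2 x.1 * s y.1 * u y.2)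
          * v x.2.1 * w x.2.2)
      simp only [Fintype.sum_prod_type] at this
      rw [this]
      refine Finset.sum_congr rfl fun a _ => Finset.sum_congr rfl fun b _ => ?_
      rw [Finset.sum_comm]
      refine Finset.sum_congr rfl fun c _ => ?_
      rw [Finset.sum_comm]
      exact Finset.sum_congr rfl fun d _ => Finset.sum_congr rfl fun k _ => by ring
    have h3 : (u ⬝ᵥ v) * (s ⬝ᵥ w) = ∑ a, ∑ b, ∑ c, ∑ d,
        ((kron b c * kron a d : ℤ) : ℝ) * s a * u b * v c * w d := by
      simp [hk, dotProduct, Finset.sum_mul_sum]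
      rw [Finset.sum_comm]
      exact Finset.sum_congr rfl fun _ _ => Finset.sum_congr rfl fun _ _ => by ring
    have h4 : (s ⬝ᵥ v) * (u ⬝ᵥ w) = ∑ a, ∑ b, ∑ c, ∑ d,
        ((kron a c * kron b d : ℤ) : ℝ) * s a * u b * v c * w d := by
      simp [hk, dotProduct, Finset.sum_mul_sum]
      exact Finset.sum_congr rfl fun _ _ => Finset.sum_congr rfl fun _ _ => by ring
    rw [h2, h3, h4]
    simp only [← Finset.sum_add_distrib, ← Finset.sum_sub_distrib, psi0, psiZ]
    refine Finset.sum_congr rfl fun a _ => Finset.sum_congr rfl fun b _ =>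
      Finset.sum_congr rfl fun c _ => Finset.sum_congr rfl fun d _ => ?_
    push_cast
    ring
  rw [h1]
  simp only [asc0, mul0, imag, dot_seven, Pi.add_apply, Pi.sub_apply, Pi.smul_apply,
    Prod.snd_sub, smul_eq_mul, cr_0, cr_1, cr_2, cr_3, cr_4, cr_5, cr_6]
  ring

namespace IsFrame

variable {G : Matrix (Fin 7) (Fin 7) ℝ} {p : Form3} {L : Vec ≃ₗ[ℝ] Vec} (h : IsFrame G p L)
include h

/-- The vectors `L⁻¹ e_x` are orthonormal for `G`, so the inverse metric is the sum of their
squares. This turns every raised index into a frame index. -/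
theorem inv_eq (i l : Fin 7) :
    G⁻¹ i l = ∑ x, L.symm (Pi.single x 1) i * L.symm (Pi.single x 1) l := by
  have key : Matrix.of (fun i l => ∑ x, L.symm (Pi.single x 1) i * L.symm (Pi.single x 1) l) * G
      = 1 := by
    ext i j
    rw [Matrix.mul_apply]
    have h1 : ∀ x, ∑ l, L.symm (Pi.single x 1) l * G l j = L (Pi.single j 1) x := by
      intro x
      have := h.ip_eq (L.symm (Pi.single x 1)) (Pi.single j 1)
      rw [L.apply_symm_apply, single_one_dotProduct, ip_eq_dot] at this
      rw [← this]
      simp [dotProduct]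
    have h2 : ∀ x, ∑ l, L.symm (Pi.single x 1) i * L.symm (Pi.single x 1) l * G l j
        = L (Pi.single j 1) x * L.symm (Pi.single x 1) i := by
      intro x
      rw [← h1 x, Finset.sum_mul]
      exact Finset.sum_congr rfl fun _ _ => by ring
    simp only [Matrix.of_apply, Finset.sum_mul]
    rw [Finset.sum_comm]
    simp only [h2]
    have h3 : L.symm (L (Pi.single j 1)) = ∑ x, L (Pi.single j 1) x • L.symm (Pi.single x 1) := by
      conv_lhs => rw [vec_eq_sum (L (Pi.single j 1))]
      simp only [map_sum, map_smul]
    rw [L.symm_apply_apply] at h3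
    have h4 := congrFun h3 i
    simp only [Finset.sum_apply, Pi.smul_apply, smul_eq_mul] at h4
    rw [← h4, Matrix.one_apply, Pi.single_apply]
  rw [Matrix.inv_eq_left_inv key, Matrix.of_apply]

theorem map_inv_row (i : Fin 7) : L (G⁻¹ i) = fun x => L.symm (Pi.single x 1) i := by
  have h1 : G⁻¹ i = ∑ x, L.symm (Pi.single x 1) i • L.symm (Pi.single x 1) := by
    ext l
    rw [h.inv_eq]
    simp
  rw [h1]
  simp only [map_sum, map_smul, L.apply_symm_apply]
  exact (vec_eq_sum _).symm

theorem raise_three (i j k : Fin 7) :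
    ∑ l, ∑ m, ∑ n, G⁻¹ i l * G⁻¹ j m * G⁻¹ k n * p l m n =
      ∑ x, ∑ y, ∑ z, (phiZ x y z : ℝ) * L.symm (Pi.single x 1) i * L.symm (Pi.single y 1) j
        * L.symm (Pi.single z 1) k := by
  have h1 := h.tri_eq (G⁻¹ i) (G⁻¹ j) (G⁻¹ k)
  rw [h.map_inv_row, h.map_inv_row, h.map_inv_row, cr_dot_eq_sum] at h1
  rw [← h1, tri]
  exact Finset.sum_congr rfl fun _ _ => Finset.sum_congr rfl fun _ _ =>
    Finset.sum_congr rfl fun _ _ => by ring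

theorem contract_frame (x a b : Fin 7) : ∑ i, L.symm (Pi.single x 1) i * p i a b =
    ∑ y, ∑ z, (phiZ x y z : ℝ) * (L (Pi.single a 1) y * L (Pi.single b 1) z) := by
  have h1 := h.tri_eq (L.symm (Pi.single x 1)) (Pi.single a 1) (Pi.single b 1)
  rw [L.apply_symm_apply, cr_dot_eq_sum] at h1
  have h2 : tri p (L.symm (Pi.single x 1)) (Pi.single a 1) (Pi.single b 1) =
      ∑ i, L.symm (Pi.single x 1) i * p i a b := by
    simp [tri, Pi.single_apply, mul_comm]
  rw [← h2, h1]
  simp [Pi.single_apply, mul_assoc]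

theorem comp_eq (a b c : Fin 7) : p a b c = ∑ x, ∑ y, ∑ z, (phiZ x y z : ℝ) *
    (L (Pi.single a 1) x * L (Pi.single b 1) y * L (Pi.single c 1) z) := by
  rw [← tri_single p, h.tri_eq, cr_dot_eq_sum]
  simp only [mul_assoc]

/-- In a frame, `B_φ` has the table of `φ₀` contracted with the permutation symbol, and changing the
basis costs `det L`. The sign of `det L` is kept: a frame need not preserve the orientation of the
chart. -/
theorem volCoeff_eq : volCoeff G p = (LinearMap.toMatrix' (L : Vec →ₗ[ℝ] Vec)).det := by
  set M := LinearMap.toMatrix' (L : Vec →ₗ[ℝ] Vec) with hM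
  have hMa : ∀ x a, L (Pi.single a 1) x = M x a := by
    intro x a; simp [hM, LinearMap.toMatrix'_apply]
  -- Here `144 = 6 · (2 · 2 · 6)` comes from the constants in `bForm`, and the trace is taken over
  -- the orthonormal frame.
  have h1 : ∑ i, ∑ j, G⁻¹ i j * bForm p i j = (1 / 144) * ∑ x, ∑ s : Fin 7 → Fin 7, levi s *
      ((∑ i, L.symm (Pi.single x 1) i * p i (s 0) (s 1)) *
       (∑ j, L.symm (Pi.single x 1) j * p j (s 2) (s 3)) * p (s 4) (s 5) (s 6)) := by
    have hx : ∀ (x : Fin 7) (s : Fin 7 → Fin 7), levi s *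
      ((∑ i, L.symm (Pi.single x 1) i * p i (s 0) (s 1)) *
       (∑ j, L.symm (Pi.single x 1) j * p j (s 2) (s 3)) * p (s 4) (s 5) (s 6)) =
        ∑ i, ∑ j, L.symm (Pi.single x 1) i * L.symm (Pi.single x 1) j *
          (levi s * p i (s 0) (s 1) * p j (s 2) (s 3) * p (s 4) (s 5) (s 6)) := by
      intro x s
      rw [Finset.sum_mul_sum, Finset.sum_mul, Finset.mul_sum]
      refine Finset.sum_congr rfl fun i _ => ?_
      rw [Finset.sum_mul, Finset.mul_sum]
      exact Finset.sum_congr rfl fun j _ => by ring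
    simp only [hx, bForm]
    have h2 : ∀ x : Fin 7, ∑ s : Fin 7 → Fin 7, ∑ i, ∑ j,
        L.symm (Pi.single x 1) i * L.symm (Pi.single x 1) j *
          (levi s * p i (s 0) (s 1) * p j (s 2) (s 3) * p (s 4) (s 5) (s 6)) =
        ∑ i, ∑ j, L.symm (Pi.single x 1) i * L.symm (Pi.single x 1) j *
          ∑ s : Fin 7 → Fin 7, levi s * p i (s 0) (s 1) * p j (s 2) (s 3) * p (s 4) (s 5) (s 6) := by
      intro x
      rw [Finset.sum_comm]
      refine Finset.sum_congr rfl fun i _ => ?_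
      rw [Finset.sum_comm]
      exact Finset.sum_congr rfl fun j _ => by rw [Finset.mul_sum]
    simp only [h2]
    have h9 : ∀ E : Fin 7 → Fin 7 → Fin 7 → ℝ,
        ∑ x, ∑ i, ∑ j, E x i j = ∑ i, ∑ j, ∑ x, E x i j := by
      intro E
      rw [Finset.sum_comm]
      exact Finset.sum_congr rfl fun i _ => Finset.sum_comm
    rw [h9, Finset.mul_sum]
    refine Finset.sum_congr rfl fun i _ => ?_
    rw [Finset.mul_sum]
    refine Finset.sum_congr rfl fun j _ => ?_
    rw [h.inv_eq, ← Finset.sum_mul]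
    ring
  -- Multiplicativity of the determinant, applied to a matrix whose rows are the rows of `M`
  -- selected by `y`.
  have h3 : ∀ y : Fin 7 → Fin 7, ∑ s : Fin 7 → Fin 7, levi s * ∏ n, M (y n) (s n)
      = levi y * M.det := by
    intro y
    rw [← det7_eq_sum (fun n => M (y n)), det7_eq_det, levi, ← Matrix.det_mul]
    congr 1
    ext i j
    simp [Matrix.mul_apply, Matrix.one_apply]
  have h4 : ∀ (x : Fin 7) (s : Fin 7 → Fin 7),
      (∑ i, L.symm (Pi.single x 1) i * p i (s 0) (s 1)) *
       (∑ j, L.symm (Pi.single x 1) j * p j (s 2) (s 3)) * p (s 4) (s 5) (s 6) =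
      ∑ y : Fin 7 → Fin 7, (phiZ x (y 0) (y 1) : ℝ) * phiZ x (y 2) (y 3) * phiZ (y 4) (y 5) (y 6)
        * ∏ n, M (y n) (s n) := by
    intro x s
    rw [h.contract_frame, h.contract_frame, h.comp_eq, sum_fun_seven, mul_assoc]
    simp only [hMa, Finset.sum_mul]
    refine Finset.sum_congr rfl fun a _ => Finset.sum_congr rfl fun b _ => ?_
    simp only [Finset.mul_sum]
    refine Finset.sum_congr rfl fun c _ => Finset.sum_congr rfl fun d _ =>
      Finset.sum_congr rfl fun e _ => Finset.sum_congr rfl fun f _ =>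
      Finset.sum_congr rfl fun g _ => ?_
    simp [Fin.prod_univ_seven]
    ring
  -- The last three frame indices are summed against `φ₀` by `sum_levi_phiZ`, which produces the `6`
  -- and `ψ₀`.
  have h5 : ∀ x, ∑ s : Fin 7 → Fin 7, levi s *
      ((∑ i, L.symm (Pi.single x 1) i * p i (s 0) (s 1)) *
       (∑ j, L.symm (Pi.single x 1) j * p j (s 2) (s 3)) * p (s 4) (s 5) (s 6)) =
      M.det * (6 * ∑ a, ∑ b, ∑ c, ∑ d, (phiZ x a b : ℝ) * (phiZ x c d * psiZ a b c d)) := by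
    intro x
    simp only [h4]
    simp only [Finset.mul_sum]
    rw [Finset.sum_comm]
    have h6 : ∀ y : Fin 7 → Fin 7, ∑ s : Fin 7 → Fin 7, levi s *
        ((phiZ x (y 0) (y 1) : ℝ) * phiZ x (y 2) (y 3) * phiZ (y 4) (y 5) (y 6)
        * ∏ n, M (y n) (s n)) =
        (phiZ x (y 0) (y 1) : ℝ) * phiZ x (y 2) (y 3) * phiZ (y 4) (y 5) (y 6) *
          (levi y * M.det) := by
      intro y
      rw [← h3, Finset.mul_sum]
      exact Finset.sum_congr rfl fun _ _ => by ring
    simp only [h6]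
    rw [sum_fun_seven]
    refine Finset.sum_congr rfl fun a _ => Finset.sum_congr rfl fun b _ =>
      Finset.sum_congr rfl fun c _ => Finset.sum_congr rfl fun d _ => ?_
    have h7 := sum_levi_phiZ a b c d
    calc _ = ((phiZ x a b : ℝ) * phiZ x c d * M.det) *
        ∑ i, ∑ j, ∑ k, (phiZ i j k : ℝ) * levi ![a, b, c, d, i, j, k] := by
          simp only [Finset.mul_sum]
          refine Finset.sum_congr rfl fun _ _ => Finset.sum_congr rfl fun _ _ =>
            Finset.sum_congr rfl fun _ _ => ?_
          simp
          ring
      _ = _ := by rw [h7]; ring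
  have h8 : ∑ x, ∑ a, ∑ b, ∑ c, ∑ d, (phiZ x a b : ℝ) * (phiZ x c d * psiZ a b c d) = 168 := by
    exact_mod_cast congrArg (Int.cast : ℤ → ℝ) trace_phi_phi_psi
  rw [volCoeff, h1]
  simp only [h5]
  rw [← Finset.mul_sum, ← Finset.mul_sum, h8]
  ring

/-- The factor `det L` of the volume form is absorbed by the determinant: multiplying `det(L⁻¹e_x,
L⁻¹e_y, L⁻¹e_z, s, …)` by it gives `det(e_x, e_y, e_z, Ls, …)`. The sign of `det L` therefore drops
out, and only `*φ₀ = ψ₀` remains. -/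
theorem quad_hodge (s u v w : Vec) :
    quad (hodge G p) s u v w = psi0 (L s) (L u) (L v) (L w) := by
  set M := LinearMap.toMatrix' (L : Vec →ₗ[ℝ] Vec) with hM
  have hMv : ∀ v, M.mulVec v = L v := by
    intro v; simp [hM, LinearMap.toMatrix'_mulVec]
  have h1 : quad (hodge G p) s u v w = (1 / 6) * ∑ i, ∑ j, ∑ k,
      (∑ x, ∑ y, ∑ z, (phiZ x y z : ℝ) * L.symm (Pi.single x 1) i * L.symm (Pi.single y 1) j
        * L.symm (Pi.single z 1) k) *
      (M.det * ∑ a, ∑ b, ∑ c, ∑ d, levi ![i, j, k, a, b, c, d] * (s a * u b * v c * w d)) := by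
    simp only [quad, hodge, h.raise_three, h.volCoeff_eq, ← hM]
    exact quad_of_dual _ _ _ _ _ _
  have h2 : quad (hodge G p) s u v w = (1 / 6) * ∑ x, ∑ y, ∑ z, (phiZ x y z : ℝ) *
      (M.det * det7 ![L.symm (Pi.single x 1), L.symm (Pi.single y 1), L.symm (Pi.single z 1),
        s, u, v, w]) := by
    rw [h1]
    simp only [Finset.sum_mul]
    rw [sum_comm_three_three]
    refine congrArg _ (Finset.sum_congr rfl fun x _ => Finset.sum_congr rfl fun y _ =>
      Finset.sum_congr rfl fun z _ => ?_)
    rw [det7_eq_nested]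
    simp only [Finset.mul_sum (ι := Fin 7) (a := M.det), Finset.mul_sum (a := (phiZ x y z : ℝ))]
    refine Finset.sum_congr rfl fun i _ => Finset.sum_congr rfl fun j _ =>
      Finset.sum_congr rfl fun k _ => ?_
    simp only [Finset.mul_sum]
    exact Finset.sum_congr rfl fun _ _ => Finset.sum_congr rfl fun _ _ =>
      Finset.sum_congr rfl fun _ _ => Finset.sum_congr rfl fun _ _ => by ring
  have h3 : ∀ x y z : Fin 7, M.det * det7 ![L.symm (Pi.single x 1), L.symm (Pi.single y 1),
      L.symm (Pi.single z 1), s, u, v, w] = ∑ a, ∑ b, ∑ c, ∑ d, levi ![x, y, z, a, b, c, d] *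
        (L s a * L u b * L v c * L w d) := by
    intro x y z
    rw [← det7_map]
    have : (fun n => M.mulVec ((![L.symm (Pi.single x 1), L.symm (Pi.single y 1),
      L.symm (Pi.single z 1), s, u, v, w] : Fin 7 → Vec) n)) =
      ![Pi.single x 1, Pi.single y 1, Pi.single z 1, L s, L u, L v, L w] := by
      funext n
      rw [hMv]
      fin_cases n <;> simp
    rw [this, det7_eq_nested]
    simp [Pi.single_apply]
  rw [h2]
  simp only [h3, Finset.mul_sum]
  have := sum_comm_four_three (f := fun a b c d x y z => (1 / 6 : ℝ) * ((phiZ x y z : ℝ) *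
    (levi ![x, y, z, a, b, c, d] * (L s a * L u b * L v c * L w d))))
  rw [← this, psi0]
  refine Finset.sum_congr rfl fun a _ => Finset.sum_congr rfl fun b _ =>
    Finset.sum_congr rfl fun c _ => Finset.sum_congr rfl fun d _ => ?_
  have h4 := sum_phiZ_levi a b c d
  calc _ = (1 / 6) * (L s a * L u b * L v c * L w d) *
      ∑ i, ∑ j, ∑ k, (phiZ i j k : ℝ) * levi ![i, j, k, a, b, c, d] := by
        simp only [Finset.mul_sum]
        exact Finset.sum_congr rfl fun _ _ => Finset.sum_congr rfl fun _ _ =>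
          Finset.sum_congr rfl fun _ _ => by ring
    _ = _ := by rw [h4]; ring

end IsFrame

/-! ### The octonion product of `σ_V(φ)` -/

theorem oip0_smul (c d : ℝ) (A B : Oct) : oip0 (c • A) (d • B) = c * d * oip0 A B := by
  simp only [oip0, Prod.smul_fst, Prod.smul_snd, smul_dotProduct, dotProduct_smul, smul_eq_mul]
  ring

theorem oip0_conj (A : Oct) : oip0 (conj A) (conj A) = oip0 A A := by
  simp [oip0, conj]

theorem conj_conj (A : Oct) : conj (conj A) = A := by simp [conj]

theorem oip0_self_pos {A : Oct} (hA : A ≠ 0) : 0 < oip0 A A := by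
  have h2 : 0 ≤ A.2 ⬝ᵥ A.2 := by simpa using dotProduct_star_self_nonneg A.2
  refine lt_of_le_of_ne (add_nonneg (mul_self_nonneg _) h2) fun h0 => hA ?_
  rw [oip0] at h0
  have h3 : A.1 = 0 := by nlinarith [mul_self_nonneg A.1]
  have h4 : A.2 = 0 := dotProduct_self_eq_zero.1 (by nlinarith [mul_self_nonneg A.1])
  exact Prod.ext h3 h4

theorem mul0_smul_left (c : ℝ) (A B : Oct) : mul0 (c • A) B = c • mul0 A B := by
  apply oct_ext <;>
  simp only [mul0, dot_seven, Pi.add_apply, Pi.smul_apply, smul_eq_mul, Prod.smul_fst,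
    Prod.smul_snd, cr_0, cr_1, cr_2, cr_3, cr_4, cr_5, cr_6] <;> ring

theorem mul0_smul_right (c : ℝ) (A B : Oct) : mul0 A (c • B) = c • mul0 A B := by
  apply oct_ext <;>
  simp only [mul0, dot_seven, Pi.add_apply, Pi.smul_apply, smul_eq_mul, Prod.smul_fst,
    Prod.smul_snd, cr_0, cr_1, cr_2, cr_3, cr_4, cr_5, cr_6] <;> ring

theorem mul0_add_left (A A' B : Oct) : mul0 (A + A') B = mul0 A B + mul0 A' B := by
  apply oct_ext <;>
  simp only [mul0, dot_seven, Pi.add_apply, Pi.smul_apply, smul_eq_mul, Prod.fst_add,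
    Prod.snd_add, cr_0, cr_1, cr_2, cr_3, cr_4, cr_5, cr_6] <;> ring

theorem mul0_add_right (A B B' : Oct) : mul0 A (B + B') = mul0 A B + mul0 A B' := by
  apply oct_ext <;>
  simp only [mul0, dot_seven, Pi.add_apply, Pi.smul_apply, smul_eq_mul, Prod.fst_add,
    Prod.snd_add, cr_0, cr_1, cr_2, cr_3, cr_4, cr_5, cr_6] <;> ring

/-- The right Moufang identity with `a = V`, `w = AV` and `x = V̄B`, after cancelling `|V|²`. -/
theorem mul0_twisted_mul0 (A B : Oct) {V : Oct} (hV : V ≠ 0) :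
    mul0 (mul0 (mul0 A V) (mul0 (conj V) B)) V = oip0 V V • mul0 A (mul0 B V) := by
  have h := mul0_moufang_right V (mul0 (conj V) B) (mul0 A V)
  rw [mul0_mul_conj, conj_mul0_mul, mul0_smul_left, mul0_smul_left, mul0_smul_right] at h
  exact (smul_right_injective _ (oip0_self_pos hV).ne' h).symm

/-- The companion identity of the inner map of `B`, whose companion is `B³`. -/
theorem inner_map_mul0 (x y : Oct) {B : Oct} (hB : B ≠ 0) :
    (oip0 B B * oip0 B B) • mul0 (mul0 (mul0 (conj B) x) B) (mul0 (mul0 (conj B) y) B) =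
      mul0 (mul0 (conj B) (mul0 (mul0 x (mul0 B (mul0 B B)))
        (mul0 (conj (mul0 B (mul0 B B))) y))) B := by
  set n := oip0 B B with hn
  set W := mul0 x (mul0 B (mul0 B B)) with hW
  set Z := mul0 (conj (mul0 B (mul0 B B))) y with hZ
  have hW' : W = mul0 (mul0 (mul0 x B) B) B := mul0_cube_right x B
  have hZ' : Z = mul0 (conj B) (mul0 (conj B) (mul0 (conj B) y)) := by
    rw [hZ, conj_mul0, conj_mul0, ← mul0_flex, mul0_cube_left]
  set w := mul0 (mul0 (conj B) (mul0 (conj B) y)) B with hw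
  set P := mul0 (mul0 x B) B with hP
  -- With `P = (xB)B` and `w = (B̄(B̄y))B`, the two factors on the left are brought into the shape
  -- `(aPa)(ā⁻w)` with `a = B̄`, where `ā⁻ = B`, required by the left Moufang identity.
  have h1 : mul0 (mul0 (conj B) P) (conj B) = n • mul0 (mul0 (conj B) x) B := by
    rw [← mul0_flex, hP, mul0_mul_conj, mul0_smul_right, mul0_conj_flex]
  have h2 : mul0 B w = n • mul0 (mul0 (conj B) y) B := by
    rw [hw, mul0_flex, conj_mul0_mul, mul0_smul_left]
  have h3 := mul0_moufang_left (conj B) P w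
  rw [conj_conj, h1, h2, oip0_conj, mul0_smul_left, mul0_smul_right] at h3
  have h4 := mul0_moufang_right B Z W
  rw [hW', mul0_mul_conj, hZ', conj_mul0_mul, mul0_smul_left, mul0_smul_left, mul0_smul_right,
    ← hW', ← hZ'] at h4
  have h5 := smul_right_injective _ (oip0_self_pos hB).ne' h4
  have h6 : (n * n) • mul0 (mul0 (mul0 (conj B) x) B) (mul0 (mul0 (conj B) y) B)
      = n • mul0 (conj B) (mul0 P w) := by rw [mul_smul]; exact h3
  rw [h6, ← mul0_smul_right]
  have h7 : n • mul0 P w = mul0 (mul0 W Z) B := h5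
  rw [h7, mul0_conj_flex]

/-- `V` lies in a plane spanned by `1` and a unit imaginary `u`, a copy of `ℂ`, where cube roots
exist. -/
theorem exists_cube_root (V : Oct) : ∃ B : Oct, mul0 B (mul0 B B) = V := by
  obtain ⟨r, u, hu, hr⟩ : ∃ (r : ℝ) (u : Vec), u ⬝ᵥ u = 1 ∧ V.2 = r • u := by
    by_cases h0 : V.2 = 0
    -- A real `V` lies in every such plane, so any unit vector serves.
    · exact ⟨0, Pi.single 0 1, by simp, by simp [h0]⟩
    · have hp : 0 < V.2 ⬝ᵥ V.2 := by
        have := dotProduct_star_self_nonneg V.2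
        rw [star_trivial] at this
        exact lt_of_le_of_ne this fun h => h0 (dotProduct_self_eq_zero.1 h.symm)
      have hs := Real.sqrt_pos.2 hp
      refine ⟨Real.sqrt (V.2 ⬝ᵥ V.2), (Real.sqrt (V.2 ⬝ᵥ V.2))⁻¹ • V.2, ?_, ?_⟩
      · rw [smul_dotProduct, dotProduct_smul, smul_eq_mul, smul_eq_mul, ← mul_assoc, ← mul_inv,
          Real.mul_self_sqrt hp.le, inv_mul_cancel₀ hp.ne']
      · rw [smul_smul, mul_inv_cancel₀ hs.ne', one_smul]
  obtain ⟨z, hz⟩ := IsAlgClosed.exists_pow_nat_eq (⟨V.1, r⟩ : ℂ) (n := 3) (by norm_num)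
  have hm : ∀ a b c d : ℝ, mul0 (a, b • u) (c, d • u) = (a * c - b * d, (a * d + b * c) • u) := by
    intro a b c d
    have hc : cr (b • u) (d • u) = 0 := by
      ext i
      fin_cases i <;> simp [cr] <;> ring
    ext i
    · simp [mul0, hu, mul_comm b]
    · simp [mul0, hc]; ring
  refine ⟨(z.re, z.im • u), ?_⟩
  rw [hm, hm]
  have h1 := congrArg Complex.re hz
  have h2 := congrArg Complex.im hz
  simp only [pow_succ, pow_zero, one_mul, Complex.mul_re, Complex.mul_im] at h1 h2
  refine Prod.ext ?_ ?_
  · simp only; linarith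
  · simp only
    rw [hr]
    congr 1
    linarith

/-- The associator of the product of `G` and `p`. -/
def asc (G : Matrix (Fin 7) (Fin 7) ℝ) (p : Form3) (A B C : Oct) : Oct :=
  omul G p A (omul G p B C) - omul G p (omul G p A B) C

namespace IsFrame

variable {G : Matrix (Fin 7) (Fin 7) ℝ} {p : Form3} {L : Vec ≃ₗ[ℝ] Vec} (h : IsFrame G p L)
include h

theorem lam_asc (A B C : Oct) : lam L (asc G p A B C) = asc0 (lam L A) (lam L B) (lam L C) := by
  simp only [asc, asc0, map_sub, h.lam_omul]

/-- The three terms of `σ_V(φ)` are matched with those of `twisted_mul0_im`: `quad_hodge` sends `ψ`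
to `ψ₀`, and `psi0_eq_asc0` makes it an associator. -/
theorem tri_sigma (V : Oct) (u v w : Vec) : tri (sigma G p V) u v w = (normSq G V)⁻¹ *
    ((mul0 (mul0 (imag (L u)) (lam L V)) (mul0 (conj (lam L V)) (imag (L v)))).2 ⬝ᵥ L w) := by
  have h1 : tri (sigma G p V) u v w = (normSq G V)⁻¹ *
      ((V.1 ^ 2 - ip G V.2 V.2) * tri p u v w - 2 * V.1 * quad (hodge G p) V.2 u v w +
       2 * (ip G u V.2 * tri p V.2 v w + ip G v V.2 * tri p V.2 w u
        + ip G w V.2 * tri p V.2 u v)) := by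
    have e1 : quad (hodge G p) V.2 u v w =
        ∑ b, ∑ c, ∑ d, (∑ m, V.2 m * hodge G p m b c d) * u b * v c * w d := by
      have := Finset.sum_comm (s := (Finset.univ : Finset (Fin 7)))
        (t := (Finset.univ : Finset (Fin 7 × Fin 7 × Fin 7)))
        (f := fun m y => hodge G p m y.1 y.2.1 y.2.2 * V.2 m * u y.1 * v y.2.1 * w y.2.2)
      simp only [Fintype.sum_prod_type] at this
      rw [quad, this]
      refine Finset.sum_congr rfl fun b _ => Finset.sum_congr rfl fun c _ =>
        Finset.sum_congr rfl fun d _ => ?_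
      simp only [Finset.sum_mul]
      exact Finset.sum_congr rfl fun m _ => by ring
    have hi : ∀ (u v w : Vec) , ip G u V.2 * tri p V.2 v w = ∑ b, ∑ c, ∑ d,
        ((∑ m, G b m * V.2 m) * ∑ m, V.2 m * p m c d) * u b * v c * w d := by
      intro u v w
      have e2 : ip G u V.2 = ∑ b, (∑ m, G b m * V.2 m) * u b := by
        simp only [ip, Finset.sum_mul]
        exact Finset.sum_congr rfl fun _ _ => Finset.sum_congr rfl fun _ _ => by ring
      have e3 : tri p V.2 v w = ∑ c, ∑ d, (∑ m, V.2 m * p m c d) * v c * w d := by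
        have := Finset.sum_comm (s := (Finset.univ : Finset (Fin 7)))
          (t := (Finset.univ : Finset (Fin 7 × Fin 7)))
          (f := fun m y => p m y.1 y.2 * V.2 m * v y.1 * w y.2)
        simp only [Fintype.sum_prod_type] at this
        rw [tri, this]
        refine Finset.sum_congr rfl fun c _ => Finset.sum_congr rfl fun d _ => ?_
        simp only [Finset.sum_mul]
        exact Finset.sum_congr rfl fun m _ => by ring
      rw [e2, e3, Finset.sum_mul]
      refine Finset.sum_congr rfl fun b _ => ?_
      rw [Finset.mul_sum]
      refine Finset.sum_congr rfl fun c _ => ?_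
      rw [Finset.mul_sum]
      exact Finset.sum_congr rfl fun d _ => by ring
    have e4 : ip G v V.2 * tri p V.2 w u = ∑ b, ∑ c, ∑ d,
        ((∑ m, G c m * V.2 m) * ∑ m, V.2 m * p m d b) * u b * v c * w d := by
      rw [hi]
      have := Finset.sum_comm (s := (Finset.univ : Finset (Fin 7 × Fin 7)))
          (t := (Finset.univ : Finset (Fin 7)))
          (f := fun y b => ((∑ m, G y.1 m * V.2 m) * ∑ m, V.2 m * p m y.2 b) * v y.1 * w y.2 * u b)
      simp only [Fintype.sum_prod_type] at this
      rw [this]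
      exact Finset.sum_congr rfl fun _ _ => Finset.sum_congr rfl fun _ _ =>
        Finset.sum_congr rfl fun _ _ => by ring
    have e5 : ip G w V.2 * tri p V.2 u v = ∑ b, ∑ c, ∑ d,
        ((∑ m, G d m * V.2 m) * ∑ m, V.2 m * p m b c) * u b * v c * w d := by
      rw [hi]
      have := Finset.sum_comm (s := (Finset.univ : Finset (Fin 7)))
          (t := (Finset.univ : Finset (Fin 7 × Fin 7)))
          (f := fun d y => ((∑ m, G d m * V.2 m) * ∑ m, V.2 m * p m y.1 y.2) * w d * u y.1 * v y.2)
      simp only [Fintype.sum_prod_type] at this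
      rw [this]
      exact Finset.sum_congr rfl fun _ _ => Finset.sum_congr rfl fun _ _ =>
        Finset.sum_congr rfl fun _ _ => by ring
    rw [e1, hi, e4, e5]
    simp only [tri, sigma, Finset.mul_sum (ι := Fin 7) (a := V.1 ^ 2 - ip G V.2 V.2),
      ← Finset.sum_add_distrib]
    simp only [Finset.mul_sum (ι := Fin 7) (a := 2 * V.1), Finset.mul_sum (ι := Fin 7) (a := (2 : ℝ)),
      ← Finset.sum_add_distrib, ← Finset.sum_sub_distrib]
    simp only [Finset.mul_sum (ι := Fin 7) (a := (normSq G V)⁻¹)]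
    refine Finset.sum_congr rfl fun b _ => Finset.sum_congr rfl fun c _ =>
        Finset.sum_congr rfl fun d _ => ?_
    rw [← Finset.mul_sum]
    ring
  rw [h1, twisted_mul0_im, h.quad_hodge, psi0_eq_asc0]
  simp only [h.ip_eq, h.tri_eq, lam_apply]
  rw [dotProduct_comm (L u), dotProduct_comm (L v), dotProduct_comm (L w)]
  ring

/-- By bilinearity it suffices to treat `1`, where `V V̄ = |V|²`, and two imaginary factors, where
the real part is the inner product and the imaginary part is tested against all vectors with
`tri_sigma`. -/
theorem lam_omul_sigma {V : Oct} (hV : V ≠ 0) (A B : Oct) :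
    lam L (omul G (sigma G p V) A B) = (normSq G V)⁻¹ •
      mul0 (mul0 (lam L A) (lam L V)) (mul0 (conj (lam L V)) (lam L B)) := by
  have hn := (h.normSq_pos hV).ne'
  have hone : lam L (1, 0) = (1, 0) := by simp [lam_apply]
  have h1 : ∀ X : Oct, mul0 (1, 0) X = X := by
    intro X
    obtain ⟨X, rfl⟩ := (lam L).surjective X
    rw [← hone, ← h.lam_omul, one_omul]
  have h2 : ∀ X : Oct, mul0 X (1, 0) = X := by
    intro X
    obtain ⟨X, rfl⟩ := (lam L).surjective X
    rw [← hone, ← h.lam_omul, omul_one]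
  have him : ∀ u v : Vec, lam L (omul G (sigma G p V) (imag u) (imag v)) = (normSq G V)⁻¹ •
      mul0 (mul0 (lam L (imag u)) (lam L V)) (mul0 (conj (lam L V)) (lam L (imag v))) := by
    intro u v
    refine Prod.ext ?_ ?_
    · rw [lam_imag, lam_imag, Prod.smul_fst, twisted_mul0_re, ← h.normSq_eq, smul_eq_mul]
      simp only [lam_apply, omul, imag, h.ip_eq]
      field_simp
      ring
    · refine dotProduct_eq _ _ fun w => ?_
      obtain ⟨w, rfl⟩ := L.surjective w
      have := h.ip_cross (sigma G p V) u v w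
      rw [h.ip_eq, h.tri_sigma] at this
      rw [lam_imag, lam_imag, Prod.smul_snd, smul_dotProduct, smul_eq_mul, ← this]
      simp [lam_apply, omul, imag]
  have hl : ∀ B, lam L (omul G (sigma G p V) (1, 0) B) = (normSq G V)⁻¹ •
      mul0 (mul0 (lam L (1, 0)) (lam L V)) (mul0 (conj (lam L V)) (lam L B)) := by
    intro B
    rw [one_omul, hone, h1, conj_mul0_mul, ← h.normSq_eq, smul_smul, inv_mul_cancel₀ hn, one_smul]
  have hr : ∀ A, lam L (omul G (sigma G p V) A (1, 0)) = (normSq G V)⁻¹ •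
      mul0 (mul0 (lam L A) (lam L V)) (mul0 (conj (lam L V)) (lam L (1, 0))) := by
    intro A
    rw [omul_one, hone, h2, mul0_mul_conj, ← h.normSq_eq, smul_smul, inv_mul_cancel₀ hn, one_smul]
  have step : ∀ u : Vec, lam L (omul G (sigma G p V) (imag u) B) = (normSq G V)⁻¹ •
      mul0 (mul0 (lam L (imag u)) (lam L V)) (mul0 (conj (lam L V)) (lam L B)) := by
    intro u
    rw [oct_eq B, omul_add_right, omul_smul_right, map_add, map_smul, hr, him, map_add, map_smul,
      mul0_add_right, mul0_smul_right, mul0_add_right, mul0_smul_right, smul_add, smul_comm B.1]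
  rw [oct_eq A, omul_add_left, omul_smul_left, map_add, map_smul, hl, step, map_add, map_smul,
    mul0_add_left, mul0_smul_left, mul0_add_left, mul0_smul_left, smul_add, smul_comm A.1]

/-- The bridge between the two structures: right multiplication by `V` intertwines left
multiplication for `σ_V(φ)` with left multiplication for `φ`. -/
theorem omul_sigma_omul {V : Oct} (hV : V ≠ 0) (A B : Oct) :
    omul G p (omul G (sigma G p V) A B) V = omul G p A (omul G p B V) := by
  apply (lam L).injective
  have hV' : lam L V ≠ 0 := fun h0 => hV ((lam L).map_eq_zero_iff.1 h0)
  rw [h.lam_omul, h.lam_omul_sigma hV, mul0_smul_left, mul0_twisted_mul0 _ _ hV', h.lam_omul,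
    h.lam_omul, ← h.normSq_eq, smul_smul, inv_mul_cancel₀ (h.normSq_pos hV).ne', one_smul]

/-- `σ_V(φ)` has a frame at each point for the metric of `φ`. -/
theorem exists_isFrame_sigma {V : Oct} (hV : V ≠ 0) : ∃ L', IsFrame G (sigma G p V) L' := by
  -- Conjugation by `B` is not an automorphism, but it intertwines the standard product with the
  -- product twisted by `B³`. Choosing `B³ = V` makes it carry the product of `σ_V(φ)` to the
  -- standard one.
  obtain ⟨B, hB⟩ := exists_cube_root (lam L V)
  have hV' : lam L V ≠ 0 := fun h0 => hV ((lam L).map_eq_zero_iff.1 h0)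
  have hB0 : B ≠ 0 := by
    rintro rfl
    apply hV'
    rw [← hB]
    simpa using mul0_smul_left 0 0 (mul0 0 0)
  have hn := oip0_self_pos hB0
  set n := oip0 B B with hndef
  set Ad : Oct → Oct := fun x => n⁻¹ • mul0 (mul0 (conj B) x) B with hAd
  have hNV : normSq G V = n * (n * n) := by
    rw [h.normSq_eq, ← hB, oip0_mul0_left, oip0_mul0_left]
  have Ad_oip : ∀ x y, oip0 (Ad x) (Ad y) = oip0 x y := by
    intro x y
    simp only [hAd]
    rw [oip0_smul, oip0_mul0_right, oip0_mul0_left, oip0_conj, ← hndef]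
    field_simp
  have Ad_re : ∀ x : Vec, (Ad (imag x)).1 = 0 := by
    intro x
    simp only [hAd, Prod.smul_fst, smul_eq_mul]
    have : (mul0 (mul0 (conj B) (imag x)) B).1 = 0 := by
      simp only [mul0, conj, imag, dot_seven, Pi.add_apply, Pi.smul_apply, Pi.neg_apply,
        smul_eq_mul, cr_0, cr_1, cr_2, cr_3, cr_4, cr_5, cr_6]
      ring
    rw [this, mul_zero]
  have Ad_im : ∀ x : Vec, Ad (imag x) = imag (Ad (imag x)).2 := fun x =>
    Prod.ext (Ad_re x) rfl
  have Ad_mul : ∀ x y, mul0 (Ad x) (Ad y) = (n * (n * n))⁻¹ •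
      Ad (mul0 (mul0 x (lam L V)) (mul0 (conj (lam L V)) y)) := by
    intro x y
    have := inner_map_mul0 x y hB0
    rw [hB] at this
    simp only [hAd]
    rw [mul0_smul_left, mul0_smul_right, ← this, ← hndef, smul_smul, smul_smul, smul_smul]
    congr 1
    field_simp
  -- The new frame is the old one followed by `x ↦ B⁻¹ x B`, which preserves imaginary octonions and
  -- the inner product.
  let A0 : Vec →ₗ[ℝ] Vec :=
    { toFun := fun u => (Ad (imag (L u))).2
      map_add' := fun u v => by
        simp only [hAd, map_add, imag_add, mul0_add_right, mul0_add_left, smul_add, Prod.snd_add]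
      map_smul' := fun c u => by
        simp only [hAd, map_smul, imag_smul, mul0_smul_right, mul0_smul_left, Prod.smul_snd,
          RingHom.id_apply, smul_comm c] }
  have hA0 : ∀ u, imag (A0 u) = Ad (imag (L u)) := fun u => (Ad_im (L u)).symm
  have oi : ∀ u v : Vec, oip0 (imag u) (imag v) = u ⬝ᵥ v := by
    intro u v; simp [oip0, imag]
  have hdot : ∀ u v, A0 u ⬝ᵥ A0 v = L u ⬝ᵥ L v := by
    intro u v
    rw [← oi, hA0, hA0, Ad_oip, oi]
  have hinj : Function.Injective A0 := by
    refine (injective_iff_map_eq_zero A0).2 fun u hu => ?_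
    have h0 := hdot u u
    rw [hu, dotProduct_zero] at h0
    simpa using dotProduct_self_eq_zero.1 h0.symm
  refine ⟨LinearEquiv.ofInjectiveEndo A0 hinj, ⟨fun u v => ?_, fun u v w => ?_⟩⟩
  · simp only [LinearEquiv.coe_ofInjectiveEndo, hdot, h.ip_eq]
  · simp only [LinearEquiv.coe_ofInjectiveEndo]
    rw [h.tri_sigma, hNV]
    have h1 : cr (A0 u) (A0 v) ⬝ᵥ A0 w = oip0 (mul0 (imag (A0 u)) (imag (A0 v))) (imag (A0 w)) := by
      simp [oip0, mul0, imag]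
    have h2 : ∀ X : Oct, X.2 ⬝ᵥ L w = oip0 X (imag (L w)) := by
      intro X; simp [oip0, imag]
    have h3 := oip0_smul (n * (n * n))⁻¹ 1
      (Ad (mul0 (mul0 (imag (L u)) (lam L V)) (mul0 (conj (lam L V)) (imag (L v)))))
      (Ad (imag (L w)))
    rw [h1, hA0, hA0, hA0, Ad_mul, h2, ← Ad_oip]
    rw [one_smul, mul_one] at h3
    exact h3.symm

end IsFrame

/-! ### The 7-dimensional summand of the 3-forms and recovery of the torsion -/

theorem asc0_imag_snd (u v s : Vec) (c : Fin 7) : (asc0 (imag u) (imag v) (imag s)).2 c =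
    cr u (cr v s) c - (v ⬝ᵥ s) * u c + (u ⬝ᵥ v) * s c - cr (cr u v) s c := by
  simp only [asc0, mul0, imag, Prod.snd_sub, Pi.sub_apply, Pi.add_apply, Pi.smul_apply,
    smul_eq_mul, zero_smul, zero_add, Pi.zero_apply]
  ring

/-- An alternating 3-tensor vanishes if its components with increasing indices do. -/
theorem eq_zero_of_alternating (Y : Form3) (h1 : ∀ a b c, Y b a c = - Y a b c)
    (h2 : ∀ a b c, Y a c b = - Y a b c) (h : ∀ a b c, a < b → b < c → Y a b c = 0)
    (a b c : Fin 7) : Y a b c = 0 := by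
  have d1 : ∀ a c, Y a a c = 0 := fun a c => by linarith [h1 a a c]
  have d2 : ∀ a b, Y a b b = 0 := fun a b => by linarith [h2 a b b]
  rcases lt_trichotomy a b with hab | rfl | hab
  · rcases lt_trichotomy b c with hbc | rfl | hbc
    · exact h a b c hab hbc
    · exact d2 a b
    · rcases lt_trichotomy a c with hac | rfl | hac
      · linarith [h2 a c b, h a c b hac hbc]
      · linarith [h2 a a b, d1 a b]
      · linarith [h2 a c b, h1 c a b, h c a b hac hab]
  · exact d1 a c
  · rcases lt_trichotomy a c with hac | rfl | hac
    · linarith [h1 b a c, h b a c hab hac]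
    · linarith [h1 b a a, d2 b a]
    · rcases lt_trichotomy b c with hbc | rfl | hbc
      · linarith [h1 b a c, h2 b c a, h b c a hbc hac]
      · linarith [h1 b a b, h2 b b a, d1 b a]
      · linarith [h1 b a c, h2 b c a, h1 c b a, h c b a hbc hab]

-- The hypothesis removes the summands of dimensions 1 and 27 from the 35-dimensional space of
-- 3-forms. Concretely, its polarisation at basis vectors gives 28 linear relations among the 35
-- components with increasing indices, and the 7 left over are the coordinates of `s` up to scale.
set_option maxHeartbeats 2000000 in
theorem exists_form_of_tri_cr_eq_zero (X : Form3) (hX1 : ∀ a b c, X b a c = - X a b c)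
    (hX2 : ∀ a b c, X a c b = - X a b c) (hX : ∀ u v, tri X u v (cr u v) = 0) :
    ∃ s : Vec, ∀ a b c, X a b c =
      - (asc0 (imag (Pi.single a 1)) (imag (Pi.single b 1)) (imag s)).2 c := by
  -- Polarisation of the quadratic condition in the second argument.
  have H : ∀ a b c, ∑ k, X a b k * cr (Pi.single a (1 : ℝ)) (Pi.single c 1) k
      + ∑ k, X a c k * cr (Pi.single a (1 : ℝ)) (Pi.single b 1) k = 0 := by
    have crB : ∀ u v w : Vec, cr u (v + w) = cr u v + cr u w := by
      intro u v w
      ext i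
      fin_cases i <;> simp [cr] <;> ring
    have h1 : ∀ (a b : Fin 7) (w : Vec), tri X (Pi.single a 1) (Pi.single b 1) w = ∑ k, X a b k * w k := by
      intro a b w
      simp [tri, Pi.single_apply]
    intro a b c
    have e1 := hX (Pi.single a 1) (Pi.single b 1 + Pi.single c 1)
    have e2 := hX (Pi.single a 1) (Pi.single b 1)
    have e3 := hX (Pi.single a 1) (Pi.single c 1)
    rw [← triB_apply] at e1
    simp only [crB, map_add, LinearMap.add_apply, triB_apply, h1] at e1 e2 e3
    linarith
  have hp : ∀ a b c, X b c a = X a b c ∧ X c a b = X a b c ∧ X b a c = - X a b c ∧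
      X a c b = - X a b c ∧ X c b a = - X a b c := fun a b c =>
    ⟨by rw [hX2 b a c, hX1 a b c, neg_neg], by rw [hX1 a c b, hX2 a b c, neg_neg], hX1 a b c,
      hX2 a b c, by rw [hX1 b c a, hX2 b a c, hX1 a b c, neg_neg]⟩
  -- The seven triples in the support of `φ₀`: taking `c = b` leaves one term.
  have x012 : X 0 1 2 = 0 := by
    have := H 0 1 1
    simp [Fin.sum_univ_seven, cr] at this
    linarith
  have x034 : X 0 3 4 = 0 := by
    have := H 0 3 3
    simp [Fin.sum_univ_seven, cr] at this
    linarith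
  have x056 : X 0 5 6 = 0 := by
    have := H 0 5 5
    simp [Fin.sum_univ_seven, cr] at this
    linarith
  have x135 : X 1 3 5 = 0 := by
    have := H 1 3 3
    simp [Fin.sum_univ_seven, cr] at this
    linarith
  have x146 : X 1 4 6 = 0 := by
    have := H 1 4 4
    simp [Fin.sum_univ_seven, cr] at this
    linarith
  have x236 : X 2 3 6 = 0 := by
    have := H 2 3 3
    simp [Fin.sum_univ_seven, cr] at this
    linarith
  have x245 : X 2 4 5 = 0 := by
    have := H 2 4 4
    simp [Fin.sum_univ_seven, cr] at this
    linarith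
  -- The other 28 triples fall into seven groups of four, on each of which the components agree up
  -- to sign. One representative per group is kept.
  have x145 : X 1 4 5 = X 1 3 6 := by
    have := H 1 3 4
    simp [Fin.sum_univ_seven, cr] at this
    linarith
  have x235 : X 2 3 5 = X 1 3 6 := by
    have := H 3 1 2
    simp [Fin.sum_univ_seven, cr] at this
    linarith [(hp 1 3 6).2.2.1, (hp 2 3 5).2.2.1]
  have x246 : X 2 4 6 = -X 1 3 6 := by
    have := H 6 1 2
    simp [Fin.sum_univ_seven, cr] at this
    linarith [(hp 1 3 6).2.1, (hp 2 4 6).2.1]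
  have x045 : X 0 4 5 = X 0 3 6 := by
    have := H 0 3 5
    simp [Fin.sum_univ_seven, cr] at this
    linarith [(hp 0 4 5).2.2.2.1]
  have x234 : X 2 3 4 = X 0 3 6 := by
    have := H 3 0 2
    simp [Fin.sum_univ_seven, cr] at this
    linarith [(hp 0 3 6).2.2.1, (hp 2 3 4).2.2.1]
  have x256 : X 2 5 6 = X 0 3 6 := by
    have := H 6 0 2
    simp [Fin.sum_univ_seven, cr] at this
    linarith [(hp 0 3 6).2.1, (hp 2 5 6).2.1]
  have x046 : X 0 4 6 = -X 0 3 5 := by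
    have := H 0 3 6
    simp [Fin.sum_univ_seven, cr] at this
    linarith [(hp 0 4 6).2.2.2.1]
  have x134 : X 1 3 4 = -X 0 3 5 := by
    have := H 3 0 1
    simp [Fin.sum_univ_seven, cr] at this
    linarith [(hp 0 3 5).2.2.1, (hp 1 3 4).2.2.1]
  have x156 : X 1 5 6 = -X 0 3 5 := by
    have := H 5 0 1
    simp [Fin.sum_univ_seven, cr] at this
    linarith [(hp 0 3 5).2.1, (hp 1 5 6).2.2.1]
  have x025 : X 0 2 5 = X 0 1 6 := by
    have := H 0 1 5
    simp [Fin.sum_univ_seven, cr] at this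
    linarith [(hp 0 2 5).2.2.2.1]
  have x124 : X 1 2 4 = -X 0 1 6 := by
    have := H 1 0 4
    simp [Fin.sum_univ_seven, cr] at this
    linarith [(hp 0 1 6).2.2.1, (hp 1 2 4).2.2.2.1]
  have x456 : X 4 5 6 = -X 0 1 6 := by
    have := H 6 0 4
    simp [Fin.sum_univ_seven, cr] at this
    linarith [(hp 0 1 6).2.1, (hp 4 5 6).2.1]
  have x026 : X 0 2 6 = -X 0 1 5 := by
    have := H 0 1 6
    simp [Fin.sum_univ_seven, cr] at this
    linarith [(hp 0 2 6).2.2.2.1]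
  have x123 : X 1 2 3 = X 0 1 5 := by
    have := H 1 0 3
    simp [Fin.sum_univ_seven, cr] at this
    linarith [(hp 0 1 5).2.2.1, (hp 1 2 3).2.2.2.1]
  have x356 : X 3 5 6 = X 0 1 5 := by
    have := H 5 0 3
    simp [Fin.sum_univ_seven, cr] at this
    linarith [(hp 0 1 5).2.1, (hp 3 5 6).2.2.1]
  have x023 : X 0 2 3 = X 0 1 4 := by
    have := H 0 1 3
    simp [Fin.sum_univ_seven, cr] at this
    linarith [(hp 0 2 3).2.2.2.1]
  have x126 : X 1 2 6 = X 0 1 4 := by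
    have := H 1 0 6
    simp [Fin.sum_univ_seven, cr] at this
    linarith [(hp 0 1 4).2.2.1, (hp 1 2 6).2.2.2.1]
  have x346 : X 3 4 6 = X 0 1 4 := by
    have := H 4 0 6
    simp [Fin.sum_univ_seven, cr] at this
    linarith [(hp 0 1 4).2.1, (hp 3 4 6).1]
  have x024 : X 0 2 4 = -X 0 1 3 := by
    have := H 0 1 4
    simp [Fin.sum_univ_seven, cr] at this
    linarith [(hp 0 2 4).2.2.2.1]
  have x125 : X 1 2 5 = -X 0 1 3 := by
    have := H 1 0 5
    simp [Fin.sum_univ_seven, cr] at this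
    linarith [(hp 0 1 3).2.2.1, (hp 1 2 5).2.2.2.1]
  have x345 : X 3 4 5 = -X 0 1 3 := by
    have := H 3 0 5
    simp [Fin.sum_univ_seven, cr] at this
    linarith [(hp 0 1 3).2.1, (hp 3 4 5).2.2.2.1]
  -- Each group involves one coordinate of `s`. The halves appear because nonzero associators of
  -- basis units have coefficient `±2`.
  refine ⟨![-X 1 3 6 / 2, X 0 3 6 / 2, X 0 3 5 / 2, -X 0 1 6 / 2, -X 0 1 5 / 2, X 0 1 4 / 2,
    X 0 1 3 / 2], fun a b c => ?_⟩
  generalize hs : (![-X 1 3 6 / 2, X 0 3 6 / 2, X 0 3 5 / 2, -X 0 1 6 / 2, -X 0 1 5 / 2,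
    X 0 1 4 / 2, X 0 1 3 / 2] : Vec) = s
  have hs0 : s 0 = -X 1 3 6 / 2 := by rw [← hs]; rfl
  have hs1 : s 1 = X 0 3 6 / 2 := by rw [← hs]; rfl
  have hs2 : s 2 = X 0 3 5 / 2 := by rw [← hs]; rfl
  have hs3 : s 3 = -X 0 1 6 / 2 := by rw [← hs]; rfl
  have hs4 : s 4 = -X 0 1 5 / 2 := by rw [← hs]; rfl
  have hs5 : s 5 = X 0 1 4 / 2 := by rw [← hs]; rfl
  have hs6 : s 6 = X 0 1 3 / 2 := by rw [← hs]; rfl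
  have key : ∀ a b c, X a b c
      + (asc0 (imag (Pi.single a 1)) (imag (Pi.single b 1)) (imag s)).2 c = 0 := by
    have sw1 : ∀ u v w : Vec, (asc0 (imag v) (imag u) (imag s)).2 ⬝ᵥ w =
        (- (asc0 (imag u) (imag v) (imag s)).2) ⬝ᵥ w := by
      intro u v w
      simp only [asc0, mul0, imag, dot_seven, Pi.add_apply, Pi.sub_apply, Pi.smul_apply, Pi.neg_apply,
        smul_eq_mul, Prod.snd_sub, cr_0, cr_1, cr_2, cr_3, cr_4, cr_5, cr_6]
      ring
    have sw2 : ∀ u v w : Vec, (asc0 (imag u) (imag w) (imag s)).2 ⬝ᵥ v =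
        (- (asc0 (imag u) (imag v) (imag s)).2) ⬝ᵥ w := by
      intro u v w
      simp only [asc0, mul0, imag, dot_seven, Pi.add_apply, Pi.sub_apply, Pi.smul_apply, Pi.neg_apply,
        smul_eq_mul, Prod.snd_sub, cr_0, cr_1, cr_2, cr_3, cr_4, cr_5, cr_6]
      ring
    refine eq_zero_of_alternating _ (fun a b c => ?_) (fun a b c => ?_) ?_
    · have := sw1 (Pi.single a 1) (Pi.single b 1) (Pi.single c 1)
      simp only [dotProduct_single, mul_one, Pi.neg_apply] at this
      rw [hX1, this]; ring
    · have := sw2 (Pi.single a 1) (Pi.single b 1) (Pi.single c 1)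
      simp only [dotProduct_single, mul_one, Pi.neg_apply] at this
      rw [hX2, this]; ring
    · clear hp H hX1 hX2 hX hs sw1 sw2
      intro a b c hab hbc
      fin_cases a <;> fin_cases b <;> first
        | exact absurd hab (by decide)
        | (fin_cases c <;> first
            | exact absurd hbc (by decide)
            | (rw [asc0_imag_snd]; set_option linter.unusedSimpArgs false in simp [cr, hs0, hs1, hs2, hs3, hs4, hs5, hs6, x012, x034, x056, x135, x146, x236, x245, x145, x235, x246, x045, x234, x256, x046, x134, x156, x025, x124, x456, x026, x123, x356, x023, x126, x346, x024, x125, x345] <;> linarith))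
  linarith [key a b c]

theorem vec_map_eq_sum (L : Vec ≃ₗ[ℝ] Vec) (u : Vec) :
    u = ∑ x, L u x • L.symm (Pi.single x 1) := by
  conv_lhs => rw [← L.symm_apply_apply u, vec_eq_sum (L u)]
  simp only [map_sum, map_smul]

theorem sum_reverse_three (f : Form3) :
    ∑ z, ∑ y, ∑ x, f x y z = ∑ x, ∑ y, ∑ z, f x y z := by
  rw [Finset.sum_comm]
  conv_rhs => rw [Finset.sum_comm]
  exact Finset.sum_congr rfl fun _ _ => Finset.sum_comm

theorem tri_eq_sum_frame (χ : Form3) (L : Vec ≃ₗ[ℝ] Vec) (u v w : Vec) :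
    tri χ u v w = tri (fun x y z => tri χ (L.symm (Pi.single x 1)) (L.symm (Pi.single y 1))
      (L.symm (Pi.single z 1))) (L u) (L v) (L w) := by
  conv_lhs => rw [vec_map_eq_sum L u, vec_map_eq_sum L v, vec_map_eq_sum L w]
  conv_rhs => rw [tri]
  rw [← triB_apply]
  simp only [map_sum, map_smul, LinearMap.sum_apply, LinearMap.smul_apply, smul_eq_mul,
    triB_apply, Finset.mul_sum]
  rw [sum_reverse_three]
  exact Finset.sum_congr rfl fun _ _ => Finset.sum_congr rfl fun _ _ =>
    Finset.sum_congr rfl fun _ _ => by ring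

theorem sum_mul_contract (χ K : Form3) (A : Fin 7 → Vec) :
    ∑ b, ∑ c, ∑ d, χ b c d * ∑ y, ∑ z, ∑ t, K y z t * (A y b * A z c * A t d) =
      ∑ y, ∑ z, ∑ t, K y z t * tri χ (A y) (A z) (A t) := by
  simp only [Finset.mul_sum, tri]
  rw [sum_comm_three_three]
  exact Finset.sum_congr rfl fun _ _ => Finset.sum_congr rfl fun _ _ =>
    Finset.sum_congr rfl fun _ _ => Finset.sum_congr rfl fun _ _ => Finset.sum_congr rfl fun _ _ =>
    Finset.sum_congr rfl fun _ _ => by ring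

theorem tri_swap_left {χ : Form3} (h : ∀ a b c, χ b a c = - χ a b c) (u v w : Vec) :
    tri χ v u w = - tri χ u v w := by
  rw [tri, Finset.sum_comm, tri]
  simp only [← Finset.sum_neg_distrib]
  exact Finset.sum_congr rfl fun a _ => Finset.sum_congr rfl fun b _ =>
    Finset.sum_congr rfl fun c _ => by rw [h a b c]; ring

theorem tri_swap_right {χ : Form3} (h : ∀ a b c, χ a c b = - χ a b c) (u v w : Vec) :
    tri χ u w v = - tri χ u v w := by
  simp only [tri, ← Finset.sum_neg_distrib]
  refine Finset.sum_congr rfl fun a _ => ?_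
  rw [Finset.sum_comm]
  exact Finset.sum_congr rfl fun b _ =>
    Finset.sum_congr rfl fun c _ => by rw [h a b c]; ring

theorem asc0_dot_eq_sum (u v s w : Vec) : - ((asc0 (imag u) (imag v) (imag s)).2 ⬝ᵥ w) =
    tri (fun b c d => 2 * ∑ a, (psiZ a b c d : ℝ) * s a) u v w := by
  have h1 := psi0_eq_asc0 s u v w
  have h2 : - ((asc0 (imag u) (imag v) (imag s)).2 ⬝ᵥ w) = 2 * psi0 s u v w := by
    rw [h1]; ring
  have := Finset.sum_comm (s := (Finset.univ : Finset (Fin 7)))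
        (t := (Finset.univ : Finset (Fin 7 × Fin 7 × Fin 7)))
        (f := fun a y => (psiZ a y.1 y.2.1 y.2.2 : ℝ) * s a * u y.1 * v y.2.1 * w y.2.2)
  simp only [Fintype.sum_prod_type] at this
  rw [h2, psi0, this, Finset.mul_sum]
  refine Finset.sum_congr rfl fun b _ => ?_
  rw [Finset.mul_sum]
  refine Finset.sum_congr rfl fun c _ => ?_
  rw [Finset.mul_sum]
  refine Finset.sum_congr rfl fun d _ => ?_
  simp only [Finset.sum_mul, Finset.mul_sum]
  exact Finset.sum_congr rfl fun _ _ => by ring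

namespace IsFrame

variable {G : Matrix (Fin 7) (Fin 7) ℝ} {p : Form3} {L : Vec ≃ₗ[ℝ] Vec} (h : IsFrame G p L)
include h

theorem ip_asc (u v s w : Vec) : ip G (asc G p (imag u) (imag v) (imag s)).2 w =
    (asc0 (imag (L u)) (imag (L v)) (imag (L s))).2 ⬝ᵥ L w := by
  have h1 := h.lam_asc (imag u) (imag v) (imag s)
  rw [lam_imag, lam_imag, lam_imag] at h1
  rw [h.ip_eq, ← h1, lam_apply]

/-- Only real octonions associate with all pairs. This is what makes torsions and curvature
endomorphisms unique up to a real part. -/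
theorem snd_eq_zero_of_asc {m : Oct} (hm : ∀ u v, asc G p (imag u) (imag v) m = 0) : m.2 = 0 := by
  have h1 : ∀ u v, asc0 (imag u) (imag v) (lam L m) = 0 := by
    intro u v
    obtain ⟨u, rfl⟩ := L.surjective u
    obtain ⟨v, rfl⟩ := L.surjective v
    rw [← lam_imag, ← lam_imag, ← h.lam_asc, hm, map_zero]
  have h2 : ∀ (u v : Vec) (c : Fin 7), (asc0 (imag u) (imag v) (imag (L m.2))).2 c = 0 := by
    intro u v c
    have h3 : asc0 (imag u) (imag v) (imag (L m.2)) = asc0 (imag u) (imag v) (lam L m) := by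
      rw [oct_eq (lam L m)]
      simp only [asc0, mul0_add_right, mul0_smul_right]
      have : ∀ X : Oct, mul0 X (1, 0) = X := by
        intro X; ext i <;> simp [mul0]
        fin_cases i <;> simp [cr]
      rw [this, this, lam_apply]
      abel
    rw [h3, h1]; rfl
  -- A triple outside the support of `φ₀` lies in exactly one 4-set supporting `ψ₀`, so each of
  -- these components isolates one coordinate, named by the index of the hypothesis.
  have e6 := h2 (Pi.single 0 1) (Pi.single 1 1) 3
  have e5 := h2 (Pi.single 0 1) (Pi.single 1 1) 4
  have e4 := h2 (Pi.single 0 1) (Pi.single 1 1) 5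
  have e3 := h2 (Pi.single 0 1) (Pi.single 1 1) 6
  have e2 := h2 (Pi.single 0 1) (Pi.single 3 1) 5
  have e1 := h2 (Pi.single 0 1) (Pi.single 3 1) 6
  have e0 := h2 (Pi.single 1 1) (Pi.single 3 1) 6
  simp [asc0_imag_snd, cr] at e0 e1 e2 e3 e4 e5 e6
  rw [← L.map_eq_zero_iff]
  ext i
  fin_cases i <;> simp only [Pi.zero_apply] <;> first | linarith | (simp; linarith)

/-- In a frame `χ` is `2 S ⌟ ψ₀`, and contracting `ψ₀` with itself gives `24`; the constant is `2 ·
24 / 48 = 1`. -/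
theorem torsion_contract {χ : Form3} {S : Vec}
    (hχ : ∀ u v w, tri χ u v w = - ip G (asc G p (imag u) (imag v) (imag S)).2 w) (m : Fin 7) :
    (1 / 48) * ∑ b, ∑ c, ∑ d, χ b c d * ∑ m', ∑ b', ∑ c', ∑ d',
      G⁻¹ m m' * G⁻¹ b b' * G⁻¹ c c' * G⁻¹ d d' * hodge G p m' b' c' d' = S m := by
  set f : Fin 7 → Vec := fun x => L.symm (Pi.single x 1) with hf
  have h1 : ∀ b c d, ∑ m', ∑ b', ∑ c', ∑ d',
      G⁻¹ m m' * G⁻¹ b b' * G⁻¹ c c' * G⁻¹ d d' * hodge G p m' b' c' d' =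
      ∑ y, ∑ z, ∑ t, (∑ x, (psiZ x y z t : ℝ) * f x m) * (f y b * f z c * f t d) := by
    intro b c d
    have h2 := h.quad_hodge (G⁻¹ m) (G⁻¹ b) (G⁻¹ c) (G⁻¹ d)
    simp only [h.map_inv_row] at h2
    have h3 : quad (hodge G p) (G⁻¹ m) (G⁻¹ b) (G⁻¹ c) (G⁻¹ d) = ∑ m', ∑ b', ∑ c', ∑ d',
      G⁻¹ m m' * G⁻¹ b b' * G⁻¹ c c' * G⁻¹ d d' * hodge G p m' b' c' d' :=
      Finset.sum_congr rfl fun _ _ => Finset.sum_congr rfl fun _ _ =>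
        Finset.sum_congr rfl fun _ _ => Finset.sum_congr rfl fun _ _ => by ring
    have := Finset.sum_comm (s := (Finset.univ : Finset (Fin 7)))
        (t := (Finset.univ : Finset (Fin 7 × Fin 7 × Fin 7)))
        (f := fun x w => (psiZ x w.1 w.2.1 w.2.2 : ℝ) * f x m * f w.1 b * f w.2.1 c * f w.2.2 d)
    simp only [Fintype.sum_prod_type] at this
    rw [← h3, h2, psi0, this]
    refine Finset.sum_congr rfl fun _ _ => Finset.sum_congr rfl fun _ _ =>
        Finset.sum_congr rfl fun _ _ => ?_
    rw [Finset.sum_mul]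
    exact Finset.sum_congr rfl fun _ _ => by ring
  have h4 : ∑ b, ∑ c, ∑ d, χ b c d * ∑ m', ∑ b', ∑ c', ∑ d',
      G⁻¹ m m' * G⁻¹ b b' * G⁻¹ c c' * G⁻¹ d d' * hodge G p m' b' c' d' =
      ∑ y, ∑ z, ∑ t, (∑ x, (psiZ x y z t : ℝ) * f x m) * tri χ (f y) (f z) (f t) := by
    simp only [h1]
    exact sum_mul_contract χ (fun y z t => ∑ x, (psiZ x y z t : ℝ) * f x m) f
  have h5 : ∀ y z t, tri χ (f y) (f z) (f t) = 2 * ∑ a, (psiZ a y z t : ℝ) * L S a := by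
    intro y z t
    rw [hχ, h.ip_asc]
    simp only [hf, L.apply_symm_apply]
    rw [asc0_dot_eq_sum, tri_single]
  have h6 : ∀ x s, ∑ y, ∑ z, ∑ t, (psiZ x y z t : ℝ) * psiZ s y z t = 24 * if x = s then 1 else 0 := by
    intro x s
    have := congrArg (Int.cast : ℤ → ℝ) (psi_psi x s)
    rw [kron] at this
    exact_mod_cast this
  have h7 : ∑ y, ∑ z, ∑ t, (∑ x, (psiZ x y z t : ℝ) * f x m) *
      (2 * ∑ a, (psiZ a y z t : ℝ) * L S a) = ∑ x, ∑ a, 2 * (f x m * L S a) *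
        ∑ y, ∑ z, ∑ t, (psiZ x y z t : ℝ) * psiZ a y z t := by
    have := Finset.sum_comm (s := (Finset.univ : Finset (Fin 7 × Fin 7)))
        (t := (Finset.univ : Finset (Fin 7 × Fin 7 × Fin 7)))
        (f := fun x w => 2 * (f x.1 m * L S x.2) * ((psiZ x.1 w.1 w.2.1 w.2.2 : ℝ) *
          psiZ x.2 w.1 w.2.1 w.2.2))
    simp only [Fintype.sum_prod_type] at this
    simp only [Finset.mul_sum, Finset.sum_mul] at this ⊢
    rw [this]
    refine Finset.sum_congr rfl fun _ _ => Finset.sum_congr rfl fun _ _ =>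
        Finset.sum_congr rfl fun _ _ => ?_
    rw [Finset.sum_comm]
    exact Finset.sum_congr rfl fun _ _ => Finset.sum_congr rfl fun _ _ => by ring
  rw [h4]
  simp only [h5]
  rw [h7]
  simp only [h6]
  have h8 := congrFun (vec_map_eq_sum L S) m
  simp only [Finset.sum_apply, Pi.smul_apply, smul_eq_mul] at h8
  rw [h8]
  simp only [mul_ite, mul_one, mul_zero, Finset.sum_ite_eq, Finset.mem_univ, if_true,
    Finset.mul_sum, hf]
  exact Finset.sum_congr rfl fun _ _ => by ring

theorem exists_of_tri_cross_eq_zero {χ : Form3} (h1 : ∀ a b c, χ b a c = - χ a b c)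
    (h2 : ∀ a b c, χ a c b = - χ a b c) (h0 : ∀ u v, tri χ u v (cross G p u v) = 0) :
    ∃ S, ∀ u v w, tri χ u v w = - ip G (asc G p (imag u) (imag v) (imag S)).2 w := by
  obtain ⟨s, hs⟩ := exists_form_of_tri_cr_eq_zero
    (fun x y z => tri χ (L.symm (Pi.single x 1)) (L.symm (Pi.single y 1)) (L.symm (Pi.single z 1)))
    (fun a b c => tri_swap_left h1 _ _ _) (fun a b c => tri_swap_right h2 _ _ _) (fun u v => by
      have := h0 (L.symm u) (L.symm v)
      rw [tri_eq_sum_frame χ L, h.map_cross] at this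
      simpa only [L.apply_symm_apply] using this)
  refine ⟨L.symm s, fun u v w => ?_⟩
  rw [tri_eq_sum_frame χ L, h.ip_asc, L.apply_symm_apply, asc0_dot_eq_sum]
  congr 1
  funext a b c
  rw [hs]
  have := asc0_dot_eq_sum (Pi.single a 1) (Pi.single b 1) s (Pi.single c 1)
  rw [tri_single] at this
  rw [← this]
  simp

end IsFrame

/-! ### Calculus with component functions -/

theorem contDiffOn_pd {U : Set E7} (hU : IsOpen U) {f : E7 → ℝ} (hf : ContDiffOn ℝ ∞ f U)
    (i : Fin 7) : ContDiffOn ℝ ∞ (pd i f) U :=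
  (hf.fderiv_of_isOpen hU (m := ∞) (by simp)).clm_apply contDiffOn_const

theorem pd_congr {U : Set E7} (hU : IsOpen U) {f f' : E7 → ℝ} (h : Set.EqOn f f' U) {y : E7}
    (hy : y ∈ U) (i : Fin 7) : pd i f y = pd i f' y := by
  rw [pd, pd, Filter.EventuallyEq.fderiv_eq (h.eventuallyEq_of_mem (hU.mem_nhds hy))]

theorem pd_const (c : ℝ) (i : Fin 7) (y : E7) : pd i (fun _ => c) y = 0 := by
  simp [pd]

theorem pd_add {f f' : E7 → ℝ} {y : E7} (hf : DifferentiableAt ℝ f y)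
    (hf' : DifferentiableAt ℝ f' y) (i : Fin 7) :
    pd i (fun z => f z + f' z) y = pd i f y + pd i f' y := by
  simp [pd, fderiv_fun_add hf hf']

theorem pd_sub {f f' : E7 → ℝ} {y : E7} (hf : DifferentiableAt ℝ f y)
    (hf' : DifferentiableAt ℝ f' y) (i : Fin 7) :
    pd i (fun z => f z - f' z) y = pd i f y - pd i f' y := by
  simp [pd, fderiv_fun_sub hf hf']

theorem pd_mul {f f' : E7 → ℝ} {y : E7} (hf : DifferentiableAt ℝ f y)
    (hf' : DifferentiableAt ℝ f' y) (i : Fin 7) :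
    pd i (fun z => f z * f' z) y = pd i f y * f' y + f y * pd i f' y := by
  simp [pd, fderiv_fun_mul hf hf']
  ring

theorem pd_sum {ι : Type*} (s : Finset ι) {f : ι → E7 → ℝ} {y : E7}
    (hf : ∀ j ∈ s, DifferentiableAt ℝ (f j) y) (i : Fin 7) :
    pd i (fun z => ∑ j ∈ s, f j z) y = ∑ j ∈ s, pd i (f j) y := by
  simp [pd, fderiv_fun_sum hf]

theorem pd_comm {U : Set E7} (hU : IsOpen U) {f : E7 → ℝ} (hf : ContDiffOn ℝ ∞ f U) {y : E7}
    (hy : y ∈ U) (i j : Fin 7) : pd i (pd j f) y = pd j (pd i f) y := by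
  have h1 : ContDiffAt ℝ ∞ f y := hf.contDiffAt (hU.mem_nhds hy)
  have hd : DifferentiableAt ℝ (fderiv ℝ f) y :=
    (h1.fderiv_right (m := 1) (WithTop.coe_le_coe.2 (le_top : (1 + 1 : ℕ∞) ≤ ⊤))).differentiableAt (by simp)
  have h2 : ∀ i j : Fin 7, pd i (pd j f) y =
      fderiv ℝ (fderiv ℝ f) y (EuclideanSpace.single i 1) (EuclideanSpace.single j 1) := by
    intro i j
    have : pd j f = fun z => fderiv ℝ f z (EuclideanSpace.single j 1) := rfl
    rw [this, pd, fderiv_clm_apply hd (by fun_prop)]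
    simp
  rw [h2, h2]
  exact (h1.isSymmSndFDerivAt (by
    rw [minSmoothness_of_isRCLikeNormedField]
    exact WithTop.coe_le_coe.2 (le_top : (2 : ℕ∞) ≤ ⊤))).eq _ _

/-- The partial derivative of an octonion-valued function. -/
def pdO (i : Fin 7) (A : E7 → Oct) (y : E7) : Oct :=
  (pd i (fun z => (A z).1) y, fun k => pd i (fun z => (A z).2 k) y)

/-- The action of the Christoffel symbols on an octonion. -/
def gam (g : LMetric) (y : E7) (i : Fin 7) (A : Oct) : Oct :=
  (0, fun k => ∑ l, chris g y k i l * A.2 l)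

theorem nablaOct_eq (g : LMetric) (A : E7 → Oct) (y : E7) (i : Fin 7) :
    nablaOct g A y i = pdO i A y + gam g y i (A y) := by
  ext <;> simp [nablaOct, pdO, gam]

/-- An octonion-valued function is smooth on `U`. -/
def SmoothOct (U : Set E7) (A : E7 → Oct) : Prop :=
  ContDiffOn ℝ ∞ (fun z => (A z).1) U ∧ ∀ k, ContDiffOn ℝ ∞ (fun z => (A z).2 k) U

section Smooth

variable {U : Set E7}

theorem differentiableAt_of_contDiffOn (hU : IsOpen U) {f : E7 → ℝ} (hf : ContDiffOn ℝ ∞ f U)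
    {y : E7} (hy : y ∈ U) : DifferentiableAt ℝ f y :=
  (hf.contDiffAt (hU.mem_nhds hy)).differentiableAt (by simp)

theorem smoothOct_const (a : Oct) : SmoothOct U fun _ => a :=
  ⟨contDiffOn_const, fun _ => contDiffOn_const⟩

theorem SmoothOct.sub {A B : E7 → Oct} (hA : SmoothOct U A) (hB : SmoothOct U B) :
    SmoothOct U fun z => A z - B z :=
  ⟨hA.1.sub hB.1, fun k => (hA.2 k).sub (hB.2 k)⟩

theorem SmoothOct.neg {A : E7 → Oct} (hA : SmoothOct U A) : SmoothOct U fun z => - A z :=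
  ⟨hA.1.neg, fun k => (hA.2 k).neg⟩

theorem SmoothOct.smul {f : E7 → ℝ} {A : E7 → Oct} (hf : ContDiffOn ℝ ∞ f U)
    (hA : SmoothOct U A) : SmoothOct U fun z => f z • A z :=
  ⟨hf.mul hA.1, fun k => hf.mul (hA.2 k)⟩

theorem SmoothOct.sum {ι : Type*} (s : Finset ι) {A : ι → E7 → Oct}
    (hA : ∀ i, SmoothOct U (A i)) : SmoothOct U fun z => ∑ i ∈ s, A i z := by
  refine ⟨?_, fun k => ?_⟩
  · simp only [Prod.fst_sum]
    exact ContDiffOn.sum fun i _ => (hA i).1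
  · simp only [Prod.snd_sum, Finset.sum_apply]
    exact ContDiffOn.sum fun i _ => (hA i).2 k

variable (hU : IsOpen U) {y : E7} (hy : y ∈ U)
include hU hy

theorem pdO_add {A B : E7 → Oct} (hA : SmoothOct U A) (hB : SmoothOct U B) (i : Fin 7) :
    pdO i (fun z => A z + B z) y = pdO i A y + pdO i B y := by
  have d := fun {f} hf => differentiableAt_of_contDiffOn (f := f) hU hf hy
  ext
  · exact pd_add (d hA.1) (d hB.1) i
  · exact pd_add (d (hA.2 _)) (d (hB.2 _)) i

theorem pdO_smul {f : E7 → ℝ} {A : E7 → Oct} (hf : ContDiffOn ℝ ∞ f U) (hA : SmoothOct U A)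
    (i : Fin 7) : pdO i (fun z => f z • A z) y = pd i f y • A y + f y • pdO i A y := by
  have d := fun {f} hf => differentiableAt_of_contDiffOn (f := f) hU hf hy
  ext
  · exact pd_mul (d hf) (d hA.1) i
  · exact pd_mul (d hf) (d (hA.2 _)) i

end Smooth

/-! ### Levi-Civita calculus for component functions with pointwise frames -/

theorem contDiffOn_det {U : Set E7} {M : E7 → Matrix (Fin 7) (Fin 7) ℝ}
    (hM : ∀ a b, ContDiffOn ℝ ∞ (fun z => M z a b) U) :
    ContDiffOn ℝ ∞ (fun z => (M z).det) U := by
  simp only [Matrix.det_apply']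
  exact ContDiffOn.sum fun σ _ => contDiffOn_const.mul (contDiffOn_prod fun i _ => hM _ _)

/-- Smooth components on `U` of a metric and a 3-form with a `G₂` frame at each point. -/
structure LocalG2 (U : Set E7) (g : LMetric) (φ : LForm) : Prop where
  isOpen : IsOpen U
  metric : ∀ a b, ContDiffOn ℝ ∞ (fun z => g z a b) U
  form : ∀ a b c, ContDiffOn ℝ ∞ (fun z => φ z a b c) U
  frame : ∀ y ∈ U, ∃ L, IsFrame (g y) (φ y) L

namespace LocalG2

variable {U : Set E7} {g : LMetric} {φ : LForm} (H : LocalG2 U g φ)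
include H

theorem diff {f : E7 → ℝ} (hf : ContDiffOn ℝ ∞ f U) {y : E7} (hy : y ∈ U) :
    DifferentiableAt ℝ f y := differentiableAt_of_contDiffOn H.isOpen hf hy

/-- The entries of the inverse are cofactors over the determinant. Frames are used only pointwise,
here for the determinant to be nonzero; they need not vary smoothly. -/
theorem smooth_inv (i j : Fin 7) : ContDiffOn ℝ ∞ (fun z => (g z)⁻¹ i j) U := by
  have h1 : ∀ z ∈ U, (g z)⁻¹ i j = ((g z).det)⁻¹ *
      ((g z).updateRow j (Pi.single i 1)).det := by
    intro z hz
    rw [Matrix.inv_def, Ring.inverse_eq_inv', Matrix.smul_apply, Matrix.adjugate_apply, smul_eq_mul]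
  refine ContDiffOn.congr ?_ h1
  refine ContDiffOn.mul (ContDiffOn.inv (contDiffOn_det H.metric) fun z hz => ?_) ?_
  · obtain ⟨L, hL⟩ := H.frame z hz
    exact hL.isUnit_det.ne_zero
  · refine contDiffOn_det fun a b => ?_
    by_cases h : a = j
    · simp [Matrix.updateRow_apply, h, contDiffOn_const]
    · simp [Matrix.updateRow_apply, h, H.metric]

theorem smooth_chris (k i j : Fin 7) : ContDiffOn ℝ ∞ (fun z => chris g z k i j) U := by
  unfold chris
  refine contDiffOn_const.mul (ContDiffOn.sum fun l _ => (H.smooth_inv k l).mul ?_)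
  exact ((contDiffOn_pd H.isOpen (H.metric j l) i).add (contDiffOn_pd H.isOpen (H.metric i l) j)).sub
    (contDiffOn_pd H.isOpen (H.metric i j) l)

theorem smooth_ip {u v : E7 → Vec} (hu : ∀ k, ContDiffOn ℝ ∞ (fun z => u z k) U)
    (hv : ∀ k, ContDiffOn ℝ ∞ (fun z => v z k) U) :
    ContDiffOn ℝ ∞ (fun z => ip (g z) (u z) (v z)) U := by
  unfold ip
  exact ContDiffOn.sum fun a _ => ContDiffOn.sum fun b _ => ((H.metric a b).mul (hu a)).mul (hv b)

theorem smooth_oip {A B : E7 → Oct} (hA : SmoothOct U A) (hB : SmoothOct U B) :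
    ContDiffOn ℝ ∞ (fun z => oip (g z) (A z) (B z)) U :=
  (hA.1.mul hB.1).add (H.smooth_ip hA.2 hB.2)

theorem smooth_omul {A B : E7 → Oct} (hA : SmoothOct U A) (hB : SmoothOct U B) :
    SmoothOct U fun z => omul (g z) (φ z) (A z) (B z) := by
  refine ⟨(hA.1.mul hB.1).sub (H.smooth_ip hA.2 hB.2), fun k => ?_⟩
  refine ((hA.1.mul (hB.2 k)).add (hB.1.mul (hA.2 k))).add ?_
  exact ContDiffOn.sum fun c _ => (H.smooth_inv k c).mul <| ContDiffOn.sum fun a _ =>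
    ContDiffOn.sum fun b _ => ((H.form a b c).mul (hA.2 a)).mul (hB.2 b)

theorem smooth_nabla {A : E7 → Oct} (hA : SmoothOct U A) (i : Fin 7) :
    SmoothOct U fun z => nablaOct g A z i := by
  refine ⟨contDiffOn_pd H.isOpen hA.1 i, fun k => ?_⟩
  exact (contDiffOn_pd H.isOpen (hA.2 k) i).add
    (ContDiffOn.sum fun l _ => (H.smooth_chris k i l).mul (hA.2 l))

theorem smooth_hodge (a b c d : Fin 7) :
    ContDiffOn ℝ ∞ (fun z => hodge (g z) (φ z) a b c d) U := by
  have hb : ∀ i j, ContDiffOn ℝ ∞ (fun z => bForm (φ z) i j) U := by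
    intro i j
    unfold bForm
    exact contDiffOn_const.mul (contDiffOn_const.mul (ContDiffOn.sum fun s _ =>
      ((contDiffOn_const.mul (H.form _ _ _)).mul (H.form _ _ _)).mul (H.form _ _ _)))
  have hv : ContDiffOn ℝ ∞ (fun z => volCoeff (g z) (φ z)) U := by
    unfold volCoeff
    exact contDiffOn_const.mul (ContDiffOn.sum fun i _ => ContDiffOn.sum fun j _ =>
      (H.smooth_inv i j).mul (hb i j))
  unfold hodge
  refine contDiffOn_const.mul (ContDiffOn.sum fun i _ => ContDiffOn.sum fun j _ =>
    ContDiffOn.sum fun k _ => ContDiffOn.mul ?_ (hv.mul contDiffOn_const))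
  exact ContDiffOn.sum fun l _ => ContDiffOn.sum fun m _ => ContDiffOn.sum fun n _ =>
    (((H.smooth_inv i l).mul (H.smooth_inv j m)).mul (H.smooth_inv k n)).mul (H.form l m n)

theorem smooth_nablaForm (a b c d : Fin 7) :
    ContDiffOn ℝ ∞ (fun z => nablaForm g φ z a b c d) U := by
  unfold nablaForm
  exact (((contDiffOn_pd H.isOpen (H.form b c d) a).sub
    (ContDiffOn.sum fun l _ => (H.smooth_chris l a b).mul (H.form l c d))).sub
    (ContDiffOn.sum fun l _ => (H.smooth_chris l a c).mul (H.form b l d))).sub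
    (ContDiffOn.sum fun l _ => (H.smooth_chris l a d).mul (H.form b c l))

theorem smooth_torsionOct (i : Fin 7) : SmoothOct U fun z => torsionOct g φ z i := by
  refine ⟨contDiffOn_const, fun m => ?_⟩
  refine contDiffOn_const.mul (ContDiffOn.sum fun b _ => ContDiffOn.sum fun c _ =>
    ContDiffOn.sum fun d _ => (H.smooth_nablaForm i b c d).mul (ContDiffOn.sum fun m' _ =>
    ContDiffOn.sum fun b' _ => ContDiffOn.sum fun c' _ => ContDiffOn.sum fun d' _ => ?_))
  exact ((((H.smooth_inv m m').mul (H.smooth_inv b b')).mul (H.smooth_inv c c')).mul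
    (H.smooth_inv d d')).mul (H.smooth_hodge m' b' c' d')

theorem smooth_octD {A : E7 → Oct} (hA : SmoothOct U A) (i : Fin 7) :
    SmoothOct U fun z => octD g φ A z i :=
  (H.smooth_nabla hA i).sub (H.smooth_omul hA (H.smooth_torsionOct i))

theorem smooth_deltaUp (i : Fin 7) : SmoothOct U fun z => deltaUp (g z) i :=
  SmoothOct.sum _ fun j => SmoothOct.smul (H.smooth_inv i j) (smoothOct_const (delta j))

end LocalG2

theorem gam_add (g : LMetric) (y : E7) (i : Fin 7) (A B : Oct) :
    gam g y i (A + B) = gam g y i A + gam g y i B := by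
  ext <;> simp [gam, mul_add, Finset.sum_add_distrib]

theorem gam_smul (g : LMetric) (y : E7) (i : Fin 7) (c : ℝ) (A : Oct) :
    gam g y i (c • A) = c • gam g y i A := by
  ext <;> simp [gam, Finset.mul_sum, mul_left_comm]

theorem oip_omul_eq {G : Matrix (Fin 7) (Fin 7) ℝ} {p : Form3} {L : Vec ≃ₗ[ℝ] Vec}
    (h : IsFrame G p L) (q : Form3) (A B C : Oct) : oip G (omul G q A B) C =
      A.1 * B.1 * C.1 - ip G A.2 B.2 * C.1 + A.1 * ip G B.2 C.2 + B.1 * ip G A.2 C.2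
        + tri q A.2 B.2 C.2 := by
  simp only [oip, omul, ip_add_left, ip_smul_left, h.ip_cross]
  ring

namespace LocalG2

variable {U : Set E7} {g : LMetric} {φ : LForm} (H : LocalG2 U g φ)
include H

theorem metric_symm {z : E7} (hz : z ∈ U) (a b : Fin 7) : g z a b = g z b a := by
  obtain ⟨L, hL⟩ := H.frame z hz
  exact hL.symm a b

variable {y : E7} (hy : y ∈ U)
include hy

theorem pd_metric_symm (i a b : Fin 7) :
    pd i (fun z => g z a b) y = pd i (fun z => g z b a) y :=
  pd_congr H.isOpen (fun _ hz => H.metric_symm hz a b) hy i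

theorem chris_lower (i a b : Fin 7) : ∑ l, chris g y l i a * g y l b =
    (1 / 2) * (pd i (fun z => g z a b) y + pd a (fun z => g z i b) y
      - pd b (fun z => g z i a) y) := by
  obtain ⟨L, hL⟩ := H.frame y hy
  have h1 : ∀ m, ∑ l, (g y)⁻¹ l m * g y l b = if m = b then 1 else 0 := by
    intro m
    have := congrFun (congrFun hL.inv_mul m) b
    rw [Matrix.mul_apply, Matrix.one_apply] at this
    rw [← this]
    exact Finset.sum_congr rfl fun l _ => by rw [hL.inv_symm]
  have h2 : ∑ l, chris g y l i a * g y l b = (1 / 2) * ∑ m, (∑ l, (g y)⁻¹ l m * g y l b) *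
      (pd i (fun z => g z a m) y + pd a (fun z => g z i m) y - pd m (fun z => g z i a) y) := by
    simp only [chris, Finset.sum_mul, Finset.mul_sum]
    rw [Finset.sum_comm]
    exact Finset.sum_congr rfl fun m _ => Finset.sum_congr rfl fun l _ => by ring
  rw [h2]
  simp [h1]

theorem chris_symm (k i j : Fin 7) : chris g y k i j = chris g y k j i := by
  unfold chris
  congr 1
  refine Finset.sum_congr rfl fun l _ => ?_
  rw [H.pd_metric_symm hy l i j]
  ring

/-- Metric compatibility `∇g = 0`: in the sum of two lowered Christoffel symbols the other
derivatives cancel. -/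
theorem pd_metric (i a b : Fin 7) : pd i (fun z => g z a b) y =
    ∑ l, chris g y l i a * g y l b + ∑ l, chris g y l i b * g y a l := by
  have h1 : ∑ l, chris g y l i b * g y a l = ∑ l, chris g y l i b * g y l a :=
    Finset.sum_congr rfl fun l _ => by rw [H.metric_symm hy]
  rw [h1, H.chris_lower hy, H.chris_lower hy, H.pd_metric_symm hy i b a]
  ring

theorem pd_ip {A B : E7 → Oct} (hA : SmoothOct U A) (hB : SmoothOct U B) (i : Fin 7) :
    pd i (fun z => ip (g z) (A z).2 (B z).2) y =
      ip (g y) (nablaOct g A y i).2 (B y).2 + ip (g y) (A y).2 (nablaOct g B y i).2 := by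
  have d := fun {f} hf => H.diff (f := f) hf hy
  have dg := fun a b => d (H.metric a b)
  have da := fun a => d (hA.2 a)
  have db := fun a => d (hB.2 a)
  have h1 : pd i (fun z => ip (g z) (A z).2 (B z).2) y = ∑ a, ∑ b,
      (pd i (fun z => g z a b) y * (A y).2 a * (B y).2 b +
        g y a b * pd i (fun z => (A z).2 a) y * (B y).2 b +
        g y a b * (A y).2 a * pd i (fun z => (B z).2 b) y) := by
    unfold ip
    rw [pd_sum]
    · refine Finset.sum_congr rfl fun a _ => ?_
      rw [pd_sum]
      · refine Finset.sum_congr rfl fun b _ => ?_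
        rw [pd_mul ((dg a b).fun_mul (da a)) (db b), pd_mul (dg a b) (da a)]
        ring
      · exact fun b _ => ((dg a b).fun_mul (da a)).fun_mul (db b)
    · exact fun a _ => DifferentiableAt.fun_sum fun b _ => ((dg a b).fun_mul (da a)).fun_mul (db b)
  have h2 : ∑ a, ∑ b, (∑ l, chris g y l i a * g y l b) * (A y).2 a * (B y).2 b =
      ∑ a, ∑ b, g y a b * (∑ l, chris g y a i l * (A y).2 l) * (B y).2 b := by
    simp only [Finset.sum_mul, Finset.mul_sum]
    rw [Finset.sum_comm]
    conv_rhs => rw [Finset.sum_comm]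
    refine Finset.sum_congr rfl fun b _ => ?_
    rw [Finset.sum_comm]
    exact Finset.sum_congr rfl fun l _ => Finset.sum_congr rfl fun a _ => by ring
  have h3 : ∑ a, ∑ b, (∑ l, chris g y l i b * g y a l) * (A y).2 a * (B y).2 b =
      ∑ a, ∑ b, g y a b * (A y).2 a * (∑ l, chris g y b i l * (B y).2 l) := by
    simp only [Finset.sum_mul, Finset.mul_sum]
    refine Finset.sum_congr rfl fun a _ => ?_
    rw [Finset.sum_comm]
    exact Finset.sum_congr rfl fun l _ => Finset.sum_congr rfl fun a _ => by ring
  rw [h1]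
  simp only [H.pd_metric hy, add_mul, Finset.sum_add_distrib, h2, h3]
  simp only [nablaOct, ip, mul_add, add_mul, Finset.sum_add_distrib]
  ring

theorem pd_oip {A B : E7 → Oct} (hA : SmoothOct U A) (hB : SmoothOct U B) (i : Fin 7) :
    pd i (fun z => oip (g z) (A z) (B z)) y =
      oip (g y) (nablaOct g A y i) (B y) + oip (g y) (A y) (nablaOct g B y i) := by
  have d := fun {f} hf => H.diff (f := f) hf hy
  unfold oip
  rw [pd_add ((d hA.1).fun_mul (d hB.1)) (d (H.smooth_ip hA.2 hB.2)), pd_mul (d hA.1) (d hB.1),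
    H.pd_ip hy hA hB]
  simp only [nablaOct]
  ring

theorem pd_tri {A B C : E7 → Oct} (hA : SmoothOct U A) (hB : SmoothOct U B) (hC : SmoothOct U C)
    (i : Fin 7) : pd i (fun z => tri (φ z) (A z).2 (B z).2 (C z).2) y =
      tri (nablaForm g φ y i) (A y).2 (B y).2 (C y).2
      + tri (φ y) (nablaOct g A y i).2 (B y).2 (C y).2
      + tri (φ y) (A y).2 (nablaOct g B y i).2 (C y).2
      + tri (φ y) (A y).2 (B y).2 (nablaOct g C y i).2 := by
  have d := fun {f} hf => H.diff (f := f) hf hy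
  have dp := fun a b c => d (H.form a b c)
  have da := fun a => d (hA.2 a)
  have db := fun a => d (hB.2 a)
  have dc := fun a => d (hC.2 a)
  have h1 : pd i (fun z => tri (φ z) (A z).2 (B z).2 (C z).2) y = ∑ a, ∑ b, ∑ c,
      (pd i (fun z => φ z a b c) y * (A y).2 a * (B y).2 b * (C y).2 c +
        φ y a b c * pd i (fun z => (A z).2 a) y * (B y).2 b * (C y).2 c +
        φ y a b c * (A y).2 a * pd i (fun z => (B z).2 b) y * (C y).2 c +
        φ y a b c * (A y).2 a * (B y).2 b * pd i (fun z => (C z).2 c) y) := by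
    have dd := fun a b c => (((dp a b c).fun_mul (da a)).fun_mul (db b)).fun_mul (dc c)
    unfold tri
    rw [pd_sum]
    · refine Finset.sum_congr rfl fun a _ => ?_
      rw [pd_sum]
      · refine Finset.sum_congr rfl fun b _ => ?_
        rw [pd_sum]
        · refine Finset.sum_congr rfl fun c _ => ?_
          rw [pd_mul (((dp a b c).fun_mul (da a)).fun_mul (db b)) (dc c),
            pd_mul ((dp a b c).fun_mul (da a)) (db b), pd_mul (dp a b c) (da a)]
          ring
        · exact fun c _ => dd a b c
      · exact fun b _ => DifferentiableAt.fun_sum fun c _ => dd a b c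
    · exact fun a _ => DifferentiableAt.fun_sum fun b _ =>
        DifferentiableAt.fun_sum fun c _ => dd a b c
  have h2 : ∑ a, ∑ b, ∑ c, (∑ l, chris g y l i a * φ y l b c) * (A y).2 a * (B y).2 b * (C y).2 c =
      ∑ a, ∑ b, ∑ c, φ y a b c * (∑ l, chris g y a i l * (A y).2 l) * (B y).2 b * (C y).2 c := by
    simp only [Finset.sum_mul, Finset.mul_sum]
    have := Finset.sum_comm (s := (Finset.univ : Finset (Fin 7 × Fin 7 × Fin 7)))
      (t := (Finset.univ : Finset (Fin 7))) (f := fun w l =>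
        chris g y l i w.1 * φ y l w.2.1 w.2.2 * (A y).2 w.1 * (B y).2 w.2.1 * (C y).2 w.2.2)
    simp only [Fintype.sum_prod_type] at this
    rw [this]
    refine Finset.sum_congr rfl fun l _ => ?_
    rw [Finset.sum_comm]
    refine Finset.sum_congr rfl fun b _ => ?_
    rw [Finset.sum_comm]
    exact Finset.sum_congr rfl fun c _ => Finset.sum_congr rfl fun a _ => by ring
  have h3 : ∑ a, ∑ b, ∑ c, (∑ l, chris g y l i b * φ y a l c) * (A y).2 a * (B y).2 b * (C y).2 c =
      ∑ a, ∑ b, ∑ c, φ y a b c * (A y).2 a * (∑ l, chris g y b i l * (B y).2 l) * (C y).2 c := by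
    simp only [Finset.sum_mul, Finset.mul_sum]
    refine Finset.sum_congr rfl fun a _ => ?_
    rw [sum_reverse_three (fun l c b => chris g y l i b * φ y a l c * (A y).2 a * (B y).2 b * (C y).2 c)]
    refine Finset.sum_congr rfl fun l _ => Finset.sum_congr rfl fun c _ =>
      Finset.sum_congr rfl fun b _ => by ring
  have h4 : ∑ a, ∑ b, ∑ c, (∑ l, chris g y l i c * φ y a b l) * (A y).2 a * (B y).2 b * (C y).2 c =
      ∑ a, ∑ b, ∑ c, φ y a b c * (A y).2 a * (B y).2 b * (∑ l, chris g y c i l * (C y).2 l) := by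
    simp only [Finset.sum_mul, Finset.mul_sum]
    refine Finset.sum_congr rfl fun a _ => Finset.sum_congr rfl fun b _ => ?_
    rw [Finset.sum_comm]
    exact Finset.sum_congr rfl fun l _ => Finset.sum_congr rfl fun c _ => by ring
  rw [h1]
  simp only [tri, nablaForm, nablaOct, mul_add, add_mul, sub_mul, Finset.sum_add_distrib,
    Finset.sum_sub_distrib, h2, h3, h4]
  ring

/-- The derivative of the product of `φ`, in terms of `∇φ`. -/
theorem leibniz_oip {A B C : E7 → Oct} (hA : SmoothOct U A) (hB : SmoothOct U B)
    (hC : SmoothOct U C) (i : Fin 7) :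
    oip (g y) (nablaOct g (fun z => omul (g z) (φ z) (A z) (B z)) y i
      - omul (g y) (φ y) (nablaOct g A y i) (B y)
      - omul (g y) (φ y) (A y) (nablaOct g B y i)) (C y) =
    tri (nablaForm g φ y i) (A y).2 (B y).2 (C y).2 := by
  have d := fun {f} hf => H.diff (f := f) hf hy
  obtain ⟨L, hL⟩ := H.frame y hy
  have h1 := H.pd_oip hy (H.smooth_omul hA hB) hC i
  have hip := fun {A B} hA hB => d (H.smooth_ip (u := A) (v := B) hA hB)
  have htri : DifferentiableAt ℝ (fun z => tri (φ z) (A z).2 (B z).2 (C z).2) y := by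
    unfold tri
    exact DifferentiableAt.fun_sum fun a _ => DifferentiableAt.fun_sum fun b _ =>
      DifferentiableAt.fun_sum fun c _ =>
        (((d (H.form a b c)).fun_mul (d (hA.2 a))).fun_mul (d (hB.2 b))).fun_mul (d (hC.2 c))
  -- All terms of `⟨AB, C⟩` except the trilinear one involve only `g`, which is parallel, so they
  -- cancel in the Leibniz defect and only `∇φ` survives.
  have h2 : pd i (fun z => oip (g z) (omul (g z) (φ z) (A z) (B z)) (C z)) y =
      pd i (fun z => (A z).1 * (B z).1 * (C z).1 - ip (g z) (A z).2 (B z).2 * (C z).1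
        + (A z).1 * ip (g z) (B z).2 (C z).2 + (B z).1 * ip (g z) (A z).2 (C z).2
        + tri (φ z) (A z).2 (B z).2 (C z).2) y := by
    refine pd_congr H.isOpen (fun z hz => ?_) hy i
    obtain ⟨L, hL⟩ := H.frame z hz
    exact oip_omul_eq hL (φ z) _ _ _
  have a1 := d hA.1
  have b1 := d hB.1
  have c1 := d hC.1
  have ab := hip hA.2 hB.2
  have ac := hip hA.2 hC.2
  have bc := hip hB.2 hC.2
  rw [pd_add (((((a1.fun_mul b1).fun_mul c1).fun_sub (ab.fun_mul c1)).fun_add (a1.fun_mul bc)).fun_add (b1.fun_mul ac)) htri,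
    pd_add ((((a1.fun_mul b1).fun_mul c1).fun_sub (ab.fun_mul c1)).fun_add (a1.fun_mul bc)) (b1.fun_mul ac),
    pd_add (((a1.fun_mul b1).fun_mul c1).fun_sub (ab.fun_mul c1)) (a1.fun_mul bc),
    pd_sub ((a1.fun_mul b1).fun_mul c1) (ab.fun_mul c1), pd_mul (a1.fun_mul b1) c1, pd_mul a1 b1, pd_mul ab c1,
    pd_mul a1 bc, pd_mul b1 ac, H.pd_ip hy hA hB, H.pd_ip hy hA hC, H.pd_ip hy hB hC,
    H.pd_tri hy hA hB hC, h1] at h2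
  have e : ∀ (A : E7 → Oct), (nablaOct g A y i).1 = pd i (fun z => (A z).1) y := fun _ => rfl
  simp only [oip_sub_left, oip_omul_eq hL, e] at h2 ⊢
  linarith

theorem nabla_add {A B : E7 → Oct} (hA : SmoothOct U A) (hB : SmoothOct U B) (i : Fin 7) :
    nablaOct g (fun z => A z + B z) y i = nablaOct g A y i + nablaOct g B y i := by
  simp only [nablaOct_eq, pdO_add H.isOpen hy hA hB, gam_add]
  abel

theorem nabla_smul {f : E7 → ℝ} {A : E7 → Oct} (hf : ContDiffOn ℝ ∞ f U) (hA : SmoothOct U A)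
    (i : Fin 7) : nablaOct g (fun z => f z • A z) y i = pd i f y • A y + f y • nablaOct g A y i := by
  simp only [nablaOct_eq, pdO_smul H.isOpen hy hf hA, gam_smul, smul_add]
  abel

theorem nabla_neg {A : E7 → Oct} (hA : SmoothOct U A) (i : Fin 7) :
    nablaOct g (fun z => - A z) y i = - nablaOct g A y i := by
  have := H.nabla_smul hy (f := fun _ => (-1 : ℝ)) contDiffOn_const hA i
  simpa [pd_const] using this

theorem nabla_sub {A B : E7 → Oct} (hA : SmoothOct U A) (hB : SmoothOct U B) (i : Fin 7) :
    nablaOct g (fun z => A z - B z) y i = nablaOct g A y i - nablaOct g B y i := by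
  have := H.nabla_add hy hA hB.neg i
  rw [H.nabla_neg hy hB] at this
  simpa only [sub_eq_add_neg] using this

theorem nabla_sum {ι : Type*} (s : Finset ι) {A : ι → E7 → Oct} (hA : ∀ j, SmoothOct U (A j))
    (i : Fin 7) : nablaOct g (fun z => ∑ j ∈ s, A j z) y i = ∑ j ∈ s, nablaOct g (A j) y i := by
  classical
  induction s using Finset.induction_on with
  | empty =>
    have := H.nabla_smul hy (f := fun _ => (0 : ℝ)) contDiffOn_const
      (smoothOct_const (U := U) (0 : Oct)) i
    simpa [pd_const] using this
  | insert a s ha ih =>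
    simp only [Finset.sum_insert ha]
    rw [H.nabla_add hy (hA a) (SmoothOct.sum s hA), ih]

theorem nabla_congr {A B : E7 → Oct} (h : Set.EqOn A B U) (i : Fin 7) :
    nablaOct g A y i = nablaOct g B y i := by
  have e : ∀ k, pd i (fun z => (A z).2 k) y = pd i (fun z => (B z).2 k) y := fun k =>
    pd_congr H.isOpen (fun z hz => by simp only [h hz]) hy i
  have e1 : pd i (fun z => (A z).1) y = pd i (fun z => (B z).1) y :=
    pd_congr H.isOpen (fun z hz => by simp only [h hz]) hy i
  simp only [nablaOct, e, e1, h hy]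

end LocalG2

theorem nabla_const (g : LMetric) (y : E7) (i : Fin 7) (a : Oct) :
    nablaOct g (fun _ => a) y i = gam g y i a := by
  rw [nablaOct_eq]
  ext <;> simp [pdO, pd_const]

theorem nabla_one (g : LMetric) (y : E7) (i : Fin 7) : nablaOct g one y i = 0 := by
  rw [show one = fun _ => ((1, 0) : Oct) from rfl, nabla_const]
  ext <;> simp [gam]

theorem nabla_delta (g : LMetric) (y : E7) (i k : Fin 7) :
    nablaOct g (fun _ => delta k) y i = ∑ l, chris g y l i k • delta l := by
  rw [nabla_const]
  have := imag_eq_sum (fun l => chris g y l i k)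
  rw [← this]
  ext <;> simp [gam, delta, imag, Pi.single_apply]

/-! ### Compatibility of the connections with the octonion product -/

theorem cr_comm (u v : Vec) : cr v u = - cr u v := by
  ext i
  fin_cases i <;> simp [cr] <;> ring

theorem cr_dot_swap (u v w : Vec) : cr u w ⬝ᵥ v = - (cr u v ⬝ᵥ w) := by
  simp only [dot_seven, cr_0, cr_1, cr_2, cr_3, cr_4, cr_5, cr_6]
  ring

theorem asc0_eq (A B C : Oct) :
    asc0 A B C = imag (asc0 (imag A.2) (imag B.2) (imag C.2)).2 := by
  apply oct_ext <;>
  · simp only [asc0, mul0, imag, Prod.fst_sub, Prod.snd_sub, dot_seven, Pi.add_apply, Pi.sub_apply,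
      Pi.smul_apply, smul_eq_mul, cr_0, cr_1, cr_2, cr_3, cr_4, cr_5, cr_6]
    ring

theorem pd_neg (f : E7 → ℝ) (i : Fin 7) (y : E7) : pd i (fun z => - f z) y = - pd i f y := by
  simp [pd, fderiv_fun_neg]

theorem oip_one (G : Matrix (Fin 7) (Fin 7) ℝ) (A : Oct) : oip G A (1, 0) = A.1 := by
  simp [oip, ip]

namespace IsFrame

variable {G : Matrix (Fin 7) (Fin 7) ℝ} {p : Form3} {L : Vec ≃ₗ[ℝ] Vec} (h : IsFrame G p L)
include h

theorem form_swap_left (a b c : Fin 7) : p b a c = - p a b c := by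
  rw [← tri_single p b, ← tri_single p a, h.tri_eq, h.tri_eq, cr_comm, neg_dotProduct]

theorem form_swap_right (a b c : Fin 7) : p a c b = - p a b c := by
  rw [← tri_single p a c, ← tri_single p a b, h.tri_eq, h.tri_eq, cr_dot_swap]

theorem asc_eq (A B C : Oct) :
    asc G p A B C = imag (asc G p (imag A.2) (imag B.2) (imag C.2)).2 := by
  apply (lam L).injective
  have h1 := h.lam_asc (imag A.2) (imag B.2) (imag C.2)
  rw [h.lam_asc, asc0_eq, lam_imag]
  congr 1
  have h2 := congrArg Prod.snd h1
  simpa only [lam_apply, imag, map_zero] using h2.symm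

theorem omul_right_surjective {V : Oct} (hV : V ≠ 0) (A : Oct) : ∃ B, omul G p B V = A := by
  refine ⟨(normSq G V)⁻¹ • omul G p A (conj V), ?_⟩
  have h1 := h.omul_omul_conj A (conj V)
  have h2 : conj (conj V) = V := by ext <;> simp [conj]
  have h3 : normSq G (conj V) = normSq G V := by
    rw [h.normSq_eq, h.normSq_eq, lam_conj, oip0_conj]
  rw [h2, h3] at h1
  rw [omul_smul_left, h1, smul_smul, inv_mul_cancel₀ (h.normSq_pos hV).ne', one_smul]

end IsFrame

namespace LocalG2

variable {U : Set E7} {g : LMetric} {φ : LForm} (H : LocalG2 U g φ) {y : E7} (hy : y ∈ U)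
include H hy

theorem nablaForm_swap_left (i a b c : Fin 7) :
    nablaForm g φ y i b a c = - nablaForm g φ y i a b c := by
  obtain ⟨L, hL⟩ := H.frame y hy
  have h1 : pd i (fun z => φ z b a c) y = - pd i (fun z => φ z a b c) y := by
    rw [← pd_neg]
    refine pd_congr H.isOpen (fun z hz => ?_) hy i
    obtain ⟨L, hL⟩ := H.frame z hz
    exact hL.form_swap_left a b c
  have h2 : ∀ l a c, φ y l a c = - φ y a l c := fun l a c => hL.form_swap_left a l c
  have h3 : ∀ k a, ∑ l, chris g y l i k * φ y l a c = - ∑ l, chris g y l i k * φ y a l c := by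
    intro k a
    rw [← Finset.sum_neg_distrib]
    exact Finset.sum_congr rfl fun l _ => by rw [h2]; ring
  have h4 : ∑ l, chris g y l i c * φ y b a l = - ∑ l, chris g y l i c * φ y a b l := by
    rw [← Finset.sum_neg_distrib]
    exact Finset.sum_congr rfl fun l _ => by rw [h2]; ring
  simp only [nablaForm]
  rw [h1, h3 b a, show ∑ l, chris g y l i a * φ y b l c = - ∑ l, chris g y l i a * φ y l b c by
    rw [h3, neg_neg], h4]
  ring

theorem nablaForm_swap_right (i a b c : Fin 7) :
    nablaForm g φ y i a c b = - nablaForm g φ y i a b c := by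
  obtain ⟨L, hL⟩ := H.frame y hy
  have h1 : pd i (fun z => φ z a c b) y = - pd i (fun z => φ z a b c) y := by
    rw [← pd_neg]
    refine pd_congr H.isOpen (fun z hz => ?_) hy i
    obtain ⟨L, hL⟩ := H.frame z hz
    exact hL.form_swap_right a b c
  have h2 : ∀ a b c, φ y a c b = - φ y a b c := fun a b c => hL.form_swap_right a b c
  have h3 : ∀ k b, ∑ l, chris g y l i k * φ y a l b = - ∑ l, chris g y l i k * φ y a b l := by
    intro k b
    rw [← Finset.sum_neg_distrib]
    exact Finset.sum_congr rfl fun l _ => by rw [h2]; ring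
  have h4 : ∑ l, chris g y l i a * φ y l c b = - ∑ l, chris g y l i a * φ y l b c := by
    rw [← Finset.sum_neg_distrib]
    exact Finset.sum_congr rfl fun l _ => by rw [h2]; ring
  simp only [nablaForm]
  rw [h1, h3 c b, h3 b c, h4]
  ring

/-- This is the derivative of `|uv|² = |u|²|v|²`. The terms in `∇u` and `∇v` match on both sides by
the composition law, which leaves the defect of the Leibniz rule paired with `uv`. -/
theorem tri_nablaForm_cross (i : Fin 7) (u v : Vec) :
    tri (nablaForm g φ y i) u v (cross (g y) (φ y) u v) = 0 := by
  obtain ⟨L, hL⟩ := H.frame y hy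
  have hA : SmoothOct U fun _ => imag u := smoothOct_const _
  have hB : SmoothOct U fun _ => imag v := smoothOct_const _
  have hP := H.smooth_omul hA hB
  have h1 := H.pd_oip hy hP hP i
  have h2 := H.leibniz_oip hy hA hB (smoothOct_const (omul (g y) (φ y) (imag u) (imag v))) i
  have h3 : pd i (fun z => oip (g z) (omul (g z) (φ z) (imag u) (imag v))
      (omul (g z) (φ z) (imag u) (imag v))) y =
      pd i (fun z => oip (g z) (imag u) (imag u) * oip (g z) (imag v) (imag v)) y := by
    refine pd_congr H.isOpen (fun z hz => ?_) hy i
    obtain ⟨L, hL⟩ := H.frame z hz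
    simp only [hL.oip_omul_left, hL.oip_self]
  rw [pd_mul (H.diff (H.smooth_oip hA hA) hy) (H.diff (H.smooth_oip hB hB) hy),
    H.pd_oip hy hA hA, H.pd_oip hy hB hB, h1] at h3
  simp only [oip_sub_left, hL.oip_omul_left, hL.oip_omul_right] at h2
  rw [hL.oip_comm (omul _ _ _ _), hL.oip_comm (imag u) (nablaOct g _ y i),
    hL.oip_comm (imag v) (nablaOct g _ y i), hL.oip_self, hL.oip_self] at h3
  have h4 : (omul (g y) (φ y) (imag u) (imag v)).2 = cross (g y) (φ y) u v := by
    simp [omul, imag]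
  rw [h4] at h2
  change _ = tri (nablaForm g φ y i) u v _ at h2
  rw [← h2]
  linarith

/-- The formula `∇φ = 2T ⌟ ψ` in associator form. The previous lemma provides some vector `S`, and
contraction with `ψ` identifies it as the torsion. -/
theorem tri_nablaForm (i : Fin 7) (u v w : Vec) : tri (nablaForm g φ y i) u v w =
    - ip (g y) (asc (g y) (φ y) (imag u) (imag v) (torsionOct g φ y i)).2 w := by
  obtain ⟨L, hL⟩ := H.frame y hy
  obtain ⟨S, hS⟩ := hL.exists_of_tri_cross_eq_zero (H.nablaForm_swap_left hy i)
    (H.nablaForm_swap_right hy i) (H.tri_nablaForm_cross hy i)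
  have : torsion g φ y i = S := funext fun m => hL.torsion_contract hS m
  rw [hS, torsionOct, this]

/-- The covariant derivative of an octonion product. -/
theorem nabla_omul {A B : E7 → Oct} (hA : SmoothOct U A) (hB : SmoothOct U B) (i : Fin 7) :
    nablaOct g (fun z => omul (g z) (φ z) (A z) (B z)) y i =
      omul (g y) (φ y) (nablaOct g A y i) (B y) + omul (g y) (φ y) (A y) (nablaOct g B y i)
        - asc (g y) (φ y) (A y) (B y) (torsionOct g φ y i) := by
  obtain ⟨L, hL⟩ := H.frame y hy
  apply hL.ext_oip
  intro C
  have h1 := H.leibniz_oip hy hA hB (smoothOct_const C) i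
  rw [H.tri_nablaForm hy] at h1
  have h2 : oip (g y) (asc (g y) (φ y) (A y) (B y) (torsionOct g φ y i)) C =
      ip (g y) (asc (g y) (φ y) (imag (A y).2) (imag (B y).2) (torsionOct g φ y i)).2 C.2 := by
    rw [hL.asc_eq]
    simp [oip, imag, torsionOct]
  simp only [oip_sub_left, oip_add_left] at h1 ⊢
  rw [h2]
  linarith

/-- The associator in the Leibniz rule for `∇` is exactly the difference between `(AB)T` and
`A(BT)`. Hence `D` is compatible with left multiplication. -/
theorem octD_omul {A B : E7 → Oct} (hA : SmoothOct U A) (hB : SmoothOct U B) (i : Fin 7) :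
    octD g φ (fun z => omul (g z) (φ z) (A z) (B z)) y i =
      omul (g y) (φ y) (nablaOct g A y i) (B y) + omul (g y) (φ y) (A y) (octD g φ B y i) := by
  rw [octD, octD, H.nabla_omul hy hA hB, asc, omul_sub_right]
  abel

theorem octD_congr {A B : E7 → Oct} (h : Set.EqOn A B U) (i : Fin 7) :
    octD g φ A y i = octD g φ B y i := by
  rw [octD, octD, H.nabla_congr hy h, h hy]

theorem oip_octD_self {V : E7 → Oct} (hV : SmoothOct U V) (i : Fin 7) :
    2 * oip (g y) (octD g φ V y i) (V y) = pd i (fun z => normSq (g z) (V z)) y := by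
  obtain ⟨L, hL⟩ := H.frame y hy
  have h1 : pd i (fun z => normSq (g z) (V z)) y = pd i (fun z => oip (g z) (V z) (V z)) y := by
    refine pd_congr H.isOpen (fun z hz => ?_) hy i
    obtain ⟨L, hL⟩ := H.frame z hz
    exact (hL.oip_self _).symm
  -- `⟨V T, V⟩ = |V|² Re T`, and the torsion is imaginary.
  have h2 : oip (g y) (omul (g y) (φ y) (V y) (torsionOct g φ y i)) (V y) = 0 := by
    have := hL.oip_omul_left (V y) (torsionOct g φ y i) (1, 0)
    rw [omul_one, oip_one] at this
    rw [this]
    simp [torsionOct, imag]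
  rw [h1, H.pd_oip hy hV hV, octD, oip_sub_left, h2, hL.oip_comm (V y)]
  ring

end LocalG2

/-! ### The torsion of `σ_V(φ)` -/

section Sigma

variable {U : Set E7} {g : LMetric} {φ : LForm} (H : LocalG2 U g φ) {V : E7 → Oct}
  (hV : SmoothOct U V) (hV0 : ∀ z ∈ U, V z ≠ 0)
include H hV

theorem LocalG2.smooth_normSq : ContDiffOn ℝ ∞ (fun z => normSq (g z) (V z)) U :=
  (hV.1.pow 2).add (H.smooth_ip hV.2 hV.2)

include hV0

theorem LocalG2.sigma : LocalG2 U g (sigmaL g φ V) where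
  isOpen := H.isOpen
  metric := H.metric
  form b c d := by
    have hn : ∀ z ∈ U, normSq (g z) (V z) ≠ 0 := fun z hz => by
      obtain ⟨L, hL⟩ := H.frame z hz
      exact (hL.normSq_pos (hV0 z hz)).ne'
    have hf : ∀ b, ContDiffOn ℝ ∞ (fun z => ∑ m, g z b m * (V z).2 m) U := fun b =>
      ContDiffOn.sum fun m _ => (H.metric b m).mul (hV.2 m)
    have hc : ∀ c d, ContDiffOn ℝ ∞ (fun z => ∑ m, (V z).2 m * φ z m c d) U := fun c d =>
      ContDiffOn.sum fun m _ => (hV.2 m).mul (H.form m c d)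
    unfold sigmaL G2.sigma
    refine ((H.smooth_normSq hV).inv hn).mul (ContDiffOn.add (ContDiffOn.sub ?_ ?_) ?_)
    · exact ((hV.1.pow 2).sub (H.smooth_ip hV.2 hV.2)).mul (H.form b c d)
    · exact (contDiffOn_const.mul hV.1).mul
        (ContDiffOn.sum fun m _ => (hV.2 m).mul (H.smooth_hodge m b c d))
    · exact contDiffOn_const.mul
        ((((hf b).mul (hc c d)).add ((hf c).mul (hc d b))).add ((hf d).mul (hc b c)))
  frame z hz := by
    obtain ⟨L, hL⟩ := H.frame z hz
    exact hL.exists_isFrame_sigma (hV0 z hz)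

theorem LocalG2.contDiffOn_log : ContDiffOn ℝ ∞
    (fun z => Real.log (Real.sqrt (normSq (g z) (V z)))) U := by
  have hn : ∀ z ∈ U, 0 < normSq (g z) (V z) := fun z hz => by
    obtain ⟨L, hL⟩ := H.frame z hz
    exact hL.normSq_pos (hV0 z hz)
  exact ((H.smooth_normSq hV).sqrt fun z hz => (hn z hz).ne').log fun z hz =>
    (Real.sqrt_pos.2 (hn z hz)).ne'

variable {y : E7} (hy : y ∈ U)
include hy

theorem LocalG2.oip_octD_eq (i : Fin 7) :
    oip (g y) (octD g φ V y i) (V y) = dlog g V y i * normSq (g y) (V y) := by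
  obtain ⟨L, hL⟩ := H.frame y hy
  have hn := hL.normSq_pos (hV0 y hy)
  -- Writing `|V|² = exp(2 ln|V|)` turns its derivative into the derivative of the logarithm.
  have h1 : pd i (fun z => normSq (g z) (V z)) y =
      pd i (fun z => Real.exp (2 * Real.log (Real.sqrt (normSq (g z) (V z))))) y := by
    refine pd_congr H.isOpen (fun z hz => ?_) hy i
    obtain ⟨L, hL⟩ := H.frame z hz
    have hn := hL.normSq_pos (hV0 z hz)
    simp only [Real.log_sqrt hn.le, mul_div_cancel₀ _ (two_ne_zero' ℝ), Real.exp_log hn]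
  have hd := H.diff (H.contDiffOn_log hV hV0) hy
  have h2 := H.oip_octD_self hy hV i
  have h3 : pd i (fun z => Real.exp (2 * Real.log (Real.sqrt (normSq (g z) (V z))))) y =
      normSq (g y) (V y) * (2 * dlog g V y i) := by
    rw [pd, fderiv_exp (hd.const_mul 2), fderiv_const_mul hd]
    simp only [Real.log_sqrt hn.le, mul_div_cancel₀ _ (two_ne_zero' ℝ), Real.exp_log hn]
    rfl
  linarith

/-- Applying `D` to `(u ∘ v)V = u(vV)` in two ways shows that `-DV = SV` has the same associators
for `∘` as the torsion of `σ_V(φ)`. So `S` is that torsion up to a real part, and the real part is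
fixed by the derivative of `|V|`. -/
theorem LocalG2.torsionVmulV_eq (i : Fin 7) :
    torsionVmulV g φ V y i = dlog g V y i • V y - octD g φ V y i := by
  obtain ⟨L, hL⟩ := H.frame y hy
  have hVy := hV0 y hy
  have H' := H.sigma hV hV0
  obtain ⟨L', hL'⟩ := H'.frame y hy
  obtain ⟨S, hS⟩ := hL.omul_right_surjective hVy (- octD g φ V y i)
  have hD : octD g φ V y i = - omul (g y) (φ y) S (V y) := by rw [hS, neg_neg]
  -- `DV` is replaced by `-SV`, all terms are moved to the form `(…)V` by the intertwining identity,
  -- and `V` is cancelled. The Leibniz rule for `∘` brings in the torsion of `σ_V(φ)`.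
  have key : ∀ u v, asc (g y) (sigmaL g φ V y) (imag u) (imag v)
      (S - torsionOct g (sigmaL g φ V) y i) = 0 := by
    intro u v
    have hA : SmoothOct U fun _ => imag u := smoothOct_const _
    have hB : SmoothOct U fun _ => imag v := smoothOct_const _
    have h1 := H.octD_omul hy (H'.smooth_omul hA hB) hV i
    have h2 := H.octD_omul hy hA (H.smooth_omul hB hV) i
    have h3 : octD g φ (fun z => omul (g z) (φ z)
        (omul (g z) (sigmaL g φ V z) (imag u) (imag v)) (V z)) y i =
        octD g φ (fun z => omul (g z) (φ z) (imag u) (omul (g z) (φ z) (imag v) (V z))) y i := by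
      refine H.octD_congr hy (fun z hz => ?_) i
      obtain ⟨L, hL⟩ := H.frame z hz
      exact hL.omul_sigma_omul (hV0 z hz) _ _
    have e : ∀ A B, omul (g y) (φ y) A (omul (g y) (φ y) B (V y)) =
        omul (g y) (φ y) (omul (g y) (sigmaL g φ V y) A B) (V y) := fun A B =>
      (hL.omul_sigma_omul hVy A B).symm
    rw [h1, h2, H.octD_omul hy hB hV, H'.nabla_omul hy hA hB, hD] at h3
    simp only [omul_add_right, omul_neg_right, e, ← omul_add_left, ← omul_neg_left] at h3
    have h4 := hL.omul_right_cancel hVy h3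
    simp only [asc, omul_sub_right] at h4 ⊢
    rw [← sub_eq_zero] at h4
    rw [← h4]
    simp only [omul_neg_left, omul_neg_right]
    abel
  have h5 := hL'.snd_eq_zero_of_asc key
  have h6 : S = S.1 • (1, 0) + torsionOct g (sigmaL g φ V) y i := by
    conv_lhs => rw [oct_eq S]
    rw [torsionOct]
    congr 2
    simpa [torsionOct, imag, sub_eq_zero] using h5
  -- `⟨SV, V⟩ = Re S · |V|²`, while `⟨DV, V⟩` is the logarithmic derivative times `|V|²`.
  have h7 : S.1 = - dlog g V y i := by
    have h8 := H.oip_octD_eq hV hV0 hy i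
    have h9 := hL.oip_omul_right S (1, 0) (V y)
    rw [one_omul, oip_one] at h9
    rw [hD, oip_neg_left, h9] at h8
    have hn := hL.normSq_pos hVy
    have : (S.1 + dlog g V y i) * normSq (g y) (V y) = 0 := by linarith
    rcases mul_eq_zero.1 this with h | h
    · linarith
    · exact absurd h hn.ne'
  rw [torsionVmulV, eq_sub_of_add_eq' h6.symm, omul_sub_left, omul_smul_left, one_omul, hS, h7]
  simp only [neg_smul]
  abel

end Sigma

/-! ### Algebra of the curvature at a point -/

theorem sum_cycle_three {X : Type*} [AddCommMonoid X] (f : Fin 7 → Fin 7 → Fin 7 → X) :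
    ∑ i, ∑ k, ∑ l, f i k l = ∑ i, ∑ k, ∑ l, f l i k := by
  conv_rhs => rw [Finset.sum_comm]
  conv_rhs => enter [2, k]; rw [Finset.sum_comm]
  rw [Finset.sum_comm]
  conv_rhs => rw [Finset.sum_comm]
  conv_lhs => rw [Finset.sum_comm]
  exact Finset.sum_congr rfl fun _ _ => Finset.sum_comm

theorem deltaUp_eq (G : Matrix (Fin 7) (Fin 7) ℝ) (i : Fin 7) :
    deltaUp G i = imag (G⁻¹ i) := (imag_eq_sum _).symm

/-- The usual combination of four cyclic identities, one for each choice of the last index, after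
normalising by the two antisymmetries. -/
theorem pair_symm_of_bianchi {R : Fin 7 → Fin 7 → Fin 7 → Fin 7 → ℝ}
    (h1 : ∀ i j k l, R j i k l = - R i j k l) (h2 : ∀ i j k l, R i j l k = - R i j k l)
    (h3 : ∀ i j k l, R i j k l + R j k i l + R k i j l = 0) (i j k l : Fin 7) :
    R i j k l = R k l i j := by
  have a1 := h3 i j k l
  have a2 := h3 j k l i
  have a3 := h3 k l i j
  have a4 := h3 l i j k
  have b1 := h2 j k i l
  have b2 := h1 i k j l
  have b3 := h2 i k l j
  have b4 := h2 k l i j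
  have b5 := h2 l j k i
  have b6 := h1 j l k i
  have b7 := h2 l i k j
  have b8 := h2 i j k l
  have b9 := h1 i k l j
  have b10 := h2 j l k i
  have b11 := h2 l i j k
  have b12 := h1 i l j k
  have b13 := h1 i l k j
  have b14 := h1 j l i k
  have b15 := h1 i k j l
  linarith

namespace IsFrame

variable {G : Matrix (Fin 7) (Fin 7) ℝ} {p : Form3} {L : Vec ≃ₗ[ℝ] Vec} (h : IsFrame G p L)
include h

theorem ip_inv_row (k : Fin 7) (u : Vec) : ip G (G⁻¹ k) u = u k := by
  have h1 := h.ip_inv u (Pi.single k 1)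
  have h2 : G⁻¹.mulVec (Pi.single k 1) = G⁻¹ k := by
    ext m
    rw [Matrix.mulVec_single_one, Matrix.col_apply, h.inv_symm]
  rw [h2] at h1
  simpa using h1

theorem oip_deltaUp (k : Fin 7) (A : Oct) : oip G (deltaUp G k) A = A.2 k := by
  rw [deltaUp_eq, oip, imag, h.ip_inv_row]
  simp

theorem sum_oip_delta_smul {A : Oct} (hA : A.1 = 0) :
    ∑ l, oip G A (delta l) • deltaUp G l = A := by
  apply h.ext_oip
  intro C
  rw [oip_sum_left]
  simp only [oip_smul_left, h.oip_deltaUp]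
  have : C = C.1 • (1, 0) + ∑ l, C.2 l • delta l := by rw [← imag_eq_sum]; exact oct_eq C
  conv_rhs => rw [this]
  rw [oip_add_right, oip_smul_right, oip_one, hA, oip_sum_right]
  simp only [oip_smul_right]
  rw [mul_zero, zero_add]
  exact Finset.sum_congr rfl fun _ _ => mul_comm _ _

theorem clifford_deltaUp (k : Fin 7) (u : Vec) (A : Oct) :
    omul G p (deltaUp G k) (omul G p (imag u) A) =
      - omul G p (imag u) (omul G p (deltaUp G k) A) - (2 * u k) • A := by
  have := h.clifford (G⁻¹ k) u A
  rw [h.ip_inv_row, ← deltaUp_eq] at this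
  rw [eq_sub_of_add_eq this]
  module

theorem clifford_deltaUp_deltaUp (k l : Fin 7) (A : Oct) :
    omul G p (deltaUp G k) (omul G p (deltaUp G l) A) =
      - omul G p (deltaUp G l) (omul G p (deltaUp G k) A) - (2 * G⁻¹ l k) • A := by
  rw [deltaUp_eq G l, h.clifford_deltaUp]

/-- Contraction of a tensor satisfying the first Bianchi identity with a Clifford product. -/
theorem sum_clifford_of_bianchi {R : Fin 7 → Fin 7 → Fin 7 → ℝ}
    (h1 : ∀ i k l, R i l k = - R i k l) (h2 : ∀ i k l, R i k l + R k l i + R l i k = 0) (A : Oct) :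
    ∑ i, ∑ k, ∑ l, R i k l •
        omul G p (deltaUp G i) (omul G p (deltaUp G k) (omul G p (deltaUp G l) A)) =
      (2 : ℝ) • ∑ i, ∑ k, ∑ l, (R i k l * G⁻¹ i l) • omul G p (deltaUp G k) A := by
  set X : Fin 7 → Fin 7 → Fin 7 → Oct := fun i k l =>
    omul G p (deltaUp G i) (omul G p (deltaUp G k) (omul G p (deltaUp G l) A)) with hX
  set Y : Fin 7 → Oct := fun k => omul G p (deltaUp G k) A with hY
  -- Cyclic permutations of the Clifford product change it only by metric contractions.
  have c1 : ∀ i k l, X l i k = X i k l + (2 * G⁻¹ k l) • Y i - (2 * G⁻¹ i l) • Y k := by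
    intro i k l
    simp only [hX, hY]
    rw [h.clifford_deltaUp_deltaUp l i, h.clifford_deltaUp_deltaUp l k]
    simp only [omul_sub_right, omul_neg_right, omul_smul_right]
    module
  have c2 : ∀ i k l, X k l i = X i k l + (2 * G⁻¹ i k) • Y l - (2 * G⁻¹ i l) • Y k := by
    intro i k l
    simp only [hX, hY]
    rw [h.clifford_deltaUp_deltaUp l i, omul_sub_right, omul_neg_right, omul_smul_right,
      h.clifford_deltaUp_deltaUp k i]
    module
  have s0 : ∑ i, ∑ k, ∑ l, (R i k l + R k l i + R l i k) • X i k l = 0 := by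
    simp only [h2, zero_smul, Finset.sum_const_zero]
  have s1 : ∑ i, ∑ k, ∑ l, R k l i • X i k l = ∑ i, ∑ k, ∑ l, R i k l •
      (X i k l + (2 * G⁻¹ k l) • Y i - (2 * G⁻¹ i l) • Y k) :=
    (sum_cycle_three fun i k l => R k l i • X i k l).trans <| Finset.sum_congr rfl fun i _ =>
      Finset.sum_congr rfl fun k _ => Finset.sum_congr rfl fun l _ => by rw [c1]
  have s2 : ∑ i, ∑ k, ∑ l, R l i k • X i k l = ∑ i, ∑ k, ∑ l, R i k l •
      (X i k l + (2 * G⁻¹ i k) • Y l - (2 * G⁻¹ i l) • Y k) :=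
    (sum_cycle_three fun i k l => R i k l • X k l i).symm.trans <| Finset.sum_congr rfl fun i _ =>
      Finset.sum_congr rfl fun k _ => Finset.sum_congr rfl fun l _ => by rw [c2]
  -- The contraction over the antisymmetric pair vanishes; the other two contractions differ by a
  -- sign.
  have s3 : ∑ i, ∑ k, ∑ l, (R i k l * G⁻¹ k l) • Y i = 0 := by
    refine Finset.sum_eq_zero fun i _ => self_eq_neg.1 ?_
    conv_lhs => rw [Finset.sum_comm]
    simp only [← Finset.sum_neg_distrib]
    refine Finset.sum_congr rfl fun k _ => Finset.sum_congr rfl fun l _ => ?_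
    rw [h1 i k l, h.inv_symm l k, neg_mul, neg_smul]
  have s4 : ∑ i, ∑ k, ∑ l, (R i k l * G⁻¹ i k) • Y l =
      - ∑ i, ∑ k, ∑ l, (R i k l * G⁻¹ i l) • Y k := by
    simp only [← Finset.sum_neg_distrib]
    refine Finset.sum_congr rfl fun i _ => ?_
    rw [Finset.sum_comm]
    refine Finset.sum_congr rfl fun k _ => Finset.sum_congr rfl fun l _ => ?_
    rw [h1 i k l, neg_mul, neg_smul]
  simp only [add_smul, Finset.sum_add_distrib, s1, s2] at s0
  have e : ∀ (r c : ℝ) (B : Oct), r • (2 * c) • B = (2 : ℝ) • (r * c) • B := fun r c B => by module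
  simp only [smul_add, smul_sub, Finset.sum_add_distrib, Finset.sum_sub_distrib, e,
    ← Finset.smul_sum, s3, s4] at s0
  -- The cyclic sum of `R` is zero. After reordering it reads three copies of the left side minus
  -- six copies of the surviving contraction.
  have : (3 : ℝ) • ∑ i, ∑ k, ∑ l, R i k l • X i k l =
      (3 : ℝ) • (2 : ℝ) • ∑ i, ∑ k, ∑ l, (R i k l * G⁻¹ i l) • Y k := by
    rw [← sub_eq_zero, ← s0]
    module
  exact smul_right_injective Oct (three_ne_zero' ℝ) this

section Curvature

variable {K F : Oct →ₗ[ℝ] Oct}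
  (hKF : ∀ A B, F (omul G p A B) = omul G p (K A) B + omul G p A (F B))
  (hK : ∀ A, (K A).1 = 0) (hskew : ∀ A B, oip G (K A) B = - oip G A (K B))
  (hF : (F (1, 0)).1 = 0)
include hKF hK hskew hF

/-- The curvature of the octonion connection is the spin curvature. -/
theorem curvature_eq (A : Oct) : F A = (1 / 4 : ℝ) • ∑ k, ∑ l, oip G (K (delta k)) (delta l) •
    omul G p (deltaUp G k) (omul G p (deltaUp G l) A) := by
  set R : Fin 7 → Fin 7 → ℝ := fun k l => oip G (K (delta k)) (delta l) with hR
  have hRa : ∀ k l, R l k = - R k l := fun k l => by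
    simp only [hR]
    rw [hskew, h.oip_comm]
  -- `Q` is the candidate spin curvature; the Clifford relations give it the same Leibniz rule over
  -- `K` as `F`.
  set Q : Oct →ₗ[ℝ] Oct := (1 / 4 : ℝ) • ∑ k, ∑ l, R k l •
    (omulB G p (deltaUp G k) ∘ₗ omulB G p (deltaUp G l)) with hQ
  have hQA : ∀ A, Q A = (1 / 4 : ℝ) • ∑ k, ∑ l, R k l •
    omul G p (deltaUp G k) (omul G p (deltaUp G l) A) := by
    intro A
    simp only [hQ, LinearMap.smul_apply, LinearMap.sum_apply, LinearMap.comp_apply, omulB_apply]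
  have hKu : ∀ u : Vec, K (imag u) = ∑ k, ∑ l, (R k l * u k) • deltaUp G l := by
    intro u
    rw [imag_eq_sum, map_sum]
    refine Finset.sum_congr rfl fun k _ => ?_
    conv_lhs => rw [map_smul, ← h.sum_oip_delta_smul (hK (delta k)), Finset.smul_sum]
    exact Finset.sum_congr rfl fun l _ => by rw [smul_smul, mul_comm]
  have hQu : ∀ (u : Vec) A, Q (omul G p (imag u) A) =
      omul G p (K (imag u)) A + omul G p (imag u) (Q A) := by
    intro u A
    have c : ∀ k l, omul G p (deltaUp G k) (omul G p (deltaUp G l) (omul G p (imag u) A)) =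
        omul G p (imag u) (omul G p (deltaUp G k) (omul G p (deltaUp G l) A)) +
          (2 * u k) • omul G p (deltaUp G l) A - (2 * u l) • omul G p (deltaUp G k) A := by
      intro k l
      rw [h.clifford_deltaUp l, omul_sub_right, omul_neg_right, h.clifford_deltaUp k,
        omul_smul_right]
      module
    have s1 : ∑ k, ∑ l, (R k l * u l) • omul G p (deltaUp G k) A =
        - ∑ k, ∑ l, (R k l * u k) • omul G p (deltaUp G l) A := by
      rw [Finset.sum_comm]
      simp only [← Finset.sum_neg_distrib]
      refine Finset.sum_congr rfl fun k _ => Finset.sum_congr rfl fun l _ => ?_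
      rw [hRa k l, neg_mul, neg_smul]
    have e : ∀ (r c : ℝ) (B : Oct), r • (2 * c) • B = (2 : ℝ) • (r * c) • B :=
      fun r c B => by module
    rw [hQA, hQA, hKu]
    simp only [c, smul_add, smul_sub, Finset.sum_add_distrib, Finset.sum_sub_distrib, e,
      ← Finset.smul_sum, s1, omul_smul_right, omul_sum_right, omul_sum_left, omul_smul_left]
    module
  -- The difference therefore commutes with left multiplications, so it is right multiplication by
  -- its value at `1`.
  have hm : ∀ B A, (F - Q) (omul G p B A) = omul G p B ((F - Q) A) := by
    intro B A
    conv_lhs => rw [oct_eq B]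
    conv_rhs => rw [oct_eq B]
    simp only [omul_add_left, omul_smul_left, one_omul, map_add, map_smul, LinearMap.sub_apply,
      hKF, hQu, omul_sub_right]
    module
  have hm1 : ∀ B, (F - Q) B = omul G p B ((F - Q) (1, 0)) := fun B => by
    rw [← hm, omul_one]
  -- That value `m` satisfies `u(vm) = (uv)m`, hence is real.
  have hm2 : ((F - Q) (1, 0)).2 = 0 := by
    refine h.snd_eq_zero_of_asc fun u v => ?_
    rw [asc, ← hm, omul_one, ← hm, ← hm, omul_one, sub_self]
  -- Its real part is zero: `Re F1 = 0` by hypothesis, and `Re Q1` is a trace of the antisymmetric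
  -- `R`.
  have hm3 : ((F - Q) (1, 0)).1 = 0 := by
    have : ∑ k, ∑ l, R k l * G⁻¹ l k = 0 := by
      refine self_eq_neg.1 ?_
      conv_lhs => rw [Finset.sum_comm]
      simp only [← Finset.sum_neg_distrib]
      refine Finset.sum_congr rfl fun k _ => Finset.sum_congr rfl fun l _ => ?_
      rw [hRa k l, h.inv_symm, neg_mul]
    have e : ∀ k l, (omul G p (deltaUp G k) (deltaUp G l)).1 = - G⁻¹ l k := by
      intro k l
      simp only [omul, deltaUp_eq, imag, h.ip_inv_row]
      ring
    rw [LinearMap.sub_apply, Prod.fst_sub, hF, hQA]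
    simp only [omul_one, Prod.smul_fst, Prod.fst_sum, e, smul_eq_mul, mul_neg,
      Finset.sum_neg_distrib, this]
    ring
  have hm0 : (F - Q) (1, 0) = 0 := Prod.ext hm3 hm2
  have := hm1 A
  rw [hm0, omul_zero_right, LinearMap.sub_apply, sub_eq_zero] at this
  rw [this, hQA]

end Curvature

/-- The Clifford contraction of the octonion curvature is the Clifford action of a symmetric
tensor. -/
theorem exists_symm_clifford_contraction {K F : Fin 7 → Fin 7 → Oct →ₗ[ℝ] Oct}
    (hKF : ∀ i j A B, F i j (omul G p A B) = omul G p (K i j A) B + omul G p A (F i j B))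
    (hK : ∀ i j A, (K i j A).1 = 0) (hskew : ∀ i j A B, oip G (K i j A) B = - oip G A (K i j B))
    (hF : ∀ i j, (F i j (1, 0)).1 = 0) (hanti : ∀ i j A, K j i A = - K i j A)
    (hb : ∀ i j k, K i j (delta k) + K j k (delta i) + K k i (delta j) = 0) :
    ∃ w : Fin 7 → Fin 7 → ℝ, (∀ j k, w j k = w k j) ∧ ∀ j A,
      ∑ i, omul G p (deltaUp G i) (F i j A) = ∑ k, w j k • omul G p (deltaUp G k) A := by
  set R : Fin 7 → Fin 7 → Fin 7 → Fin 7 → ℝ := fun i j k l => oip G (K i j (delta k)) (delta l)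
    with hR
  have r1 : ∀ i j k l, R j i k l = - R i j k l := fun i j k l => by
    simp only [hR]
    rw [hanti i j, oip_neg_left]
  have r2 : ∀ i j k l, R i j l k = - R i j k l := fun i j k l => by
    simp only [hR]
    rw [hskew, h.oip_comm]
  have r3 : ∀ i j k l, R i j k l + R j k i l + R k i j l = 0 := fun i j k l => by
    simp only [hR]
    rw [← oip_add_left, ← oip_add_left, hb, ← oipB_apply, map_zero, LinearMap.zero_apply]
  have r4 := pair_symm_of_bianchi r1 r2 r3
  -- The tensor is half the Ricci contraction up to the sign convention: the factor is `¼ · 2`. Its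
  -- symmetry follows from pair symmetry of `R`.
  refine ⟨fun j k => (1 / 2) * ∑ i, ∑ l, R i j k l * G⁻¹ i l, fun j k => ?_, fun j A => ?_⟩
  · change (1 / 2 : ℝ) * _ = (1 / 2 : ℝ) * _
    congr 1
    rw [Finset.sum_comm]
    refine Finset.sum_congr rfl fun i _ => Finset.sum_congr rfl fun l _ => ?_
    rw [h.inv_symm l i, r4 l j k i, r1 i k, r2 i k j l, neg_neg]
  · have e1 : ∀ i, omul G p (deltaUp G i) (F i j A) = (1 / 4 : ℝ) • ∑ k, ∑ l, R i j k l •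
        omul G p (deltaUp G i) (omul G p (deltaUp G k) (omul G p (deltaUp G l) A)) := by
      intro i
      rw [h.curvature_eq (hKF i j) (hK i j) (hskew i j) (hF i j) A]
      simp only [omul_smul_right, omul_sum_right, hR]
    simp only [e1, ← Finset.smul_sum]
    rw [h.sum_clifford_of_bianchi (R := fun i k l => R i j k l) (fun i k l => r2 i j k l)
      (fun i k l => by
        have := r3 k l i j
        rw [r4 i j k l, r4 k j l i, r4 l j i k]
        linarith)]
    rw [Finset.sum_comm, smul_smul, Finset.smul_sum]
    refine Finset.sum_congr rfl fun k _ => ?_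
    simp only [← Finset.sum_smul, smul_smul]
    norm_num

end IsFrame

/-! ### Curvature of the octonion connection -/

/-- The curvature of `∇` on octonion sections. -/
def curvN (g : LMetric) (A : E7 → Oct) (y : E7) (i j : Fin 7) : Oct :=
  nablaOct g (fun z => nablaOct g A z j) y i - nablaOct g (fun z => nablaOct g A z i) y j

/-- The curvature of `D` on octonion sections. -/
def curvD (g : LMetric) (φ : LForm) (A : E7 → Oct) (y : E7) (i j : Fin 7) : Oct :=
  octD g φ (fun z => octD g φ A z j) y i - octD g φ (fun z => octD g φ A z i) y j

theorem octD_one (g : LMetric) (φ : LForm) (y : E7) (i : Fin 7) :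
    octD g φ one y i = - torsionOct g φ y i := by
  rw [octD, nabla_one, one, one_omul, zero_sub]

/-- Additivity and linearity over functions make the value at `y` depend only on `A y`, by expanding
in constant sections. This allows the pointwise curvature algebra to be applied to `curvN` and
`curvD`. -/
theorem exists_linear_of_tensorial {U : Set E7} {c : (E7 → Oct) → Oct} (y : E7)
    (hadd : ∀ A B, SmoothOct U A → SmoothOct U B → c (fun z => A z + B z) = c A + c B)
    (hsmul : ∀ (f : E7 → ℝ) (A : E7 → Oct), ContDiffOn ℝ ∞ f U → SmoothOct U A →
      c (fun z => f z • A z) = f y • c A) :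
    ∃ f : Oct →ₗ[ℝ] Oct, ∀ A, SmoothOct U A → c A = f (A y) := by
  let f : Oct →ₗ[ℝ] Oct :=
    { toFun := fun a => c fun _ => a
      map_add' := fun a b => hadd _ _ (smoothOct_const a) (smoothOct_const b)
      map_smul' := fun r a => hsmul (fun _ => r) _ contDiffOn_const (smoothOct_const a) }
  refine ⟨f, fun A hA => ?_⟩
  have h0 : c (fun _ => 0) = 0 := f.map_zero
  have hs : ∀ s : Finset (Fin 7), c (fun z => ∑ k ∈ s, (A z).2 k • delta k) =
      ∑ k ∈ s, (A y).2 k • c (fun _ => delta k) := by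
    intro s
    induction s using Finset.induction_on with
    | empty => simpa using h0
    | insert a s ha ih =>
      simp only [Finset.sum_insert ha]
      rw [hadd (fun z => (A z).2 a • delta a) (fun z => ∑ k ∈ s, (A z).2 k • delta k)
        (SmoothOct.smul (hA.2 a) (smoothOct_const _))
        (SmoothOct.sum s fun k => SmoothOct.smul (hA.2 k) (smoothOct_const _)), ih,
        hsmul (fun z => (A z).2 a) (fun _ => delta a) (hA.2 a) (smoothOct_const _)]
  have e : ∀ a : Oct, a = a.1 • (1, 0) + ∑ k, a.2 k • delta k := fun a => by
    rw [← imag_eq_sum]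
    exact oct_eq a
  have h1 : A = fun z => (A z).1 • (1, 0) + ∑ k, (A z).2 k • delta k := funext fun z => e (A z)
  conv_rhs => rw [e (A y)]
  conv_lhs => rw [h1]
  rw [hadd (fun z => (A z).1 • ((1, 0) : Oct)) (fun z => ∑ k, (A z).2 k • delta k)
      (SmoothOct.smul hA.1 (smoothOct_const _))
      (SmoothOct.sum _ fun k => SmoothOct.smul (hA.2 k) (smoothOct_const _)), hs,
    hsmul (fun z => (A z).1) (fun _ => (1, 0)) hA.1 (smoothOct_const _)]
  simp only [map_add, map_smul, map_sum]
  rfl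

namespace LocalG2

variable {U : Set E7} {g : LMetric} {φ : LForm} (H : LocalG2 U g φ) {y : E7} (hy : y ∈ U)
include H hy

theorem octD_add {A B : E7 → Oct} (hA : SmoothOct U A) (hB : SmoothOct U B) (i : Fin 7) :
    octD g φ (fun z => A z + B z) y i = octD g φ A y i + octD g φ B y i := by
  simp only [octD, H.nabla_add hy hA hB, omul_add_left]
  abel

theorem octD_smul {f : E7 → ℝ} {A : E7 → Oct} (hf : ContDiffOn ℝ ∞ f U) (hA : SmoothOct U A)
    (i : Fin 7) : octD g φ (fun z => f z • A z) y i = pd i f y • A y + f y • octD g φ A y i := by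
  simp only [octD, H.nabla_smul hy hf hA, omul_smul_left]
  module

theorem octD_neg {A : E7 → Oct} (hA : SmoothOct U A) (i : Fin 7) :
    octD g φ (fun z => - A z) y i = - octD g φ A y i := by
  simp only [octD, H.nabla_neg hy hA, omul_neg_left]
  abel

theorem octD_sub {A B : E7 → Oct} (hA : SmoothOct U A) (hB : SmoothOct U B) (i : Fin 7) :
    octD g φ (fun z => A z - B z) y i = octD g φ A y i - octD g φ B y i := by
  simp only [octD, H.nabla_sub hy hA hB, omul_sub_left]
  abel

theorem octD_sum {ι : Type*} (s : Finset ι) {A : ι → E7 → Oct} (hA : ∀ j, SmoothOct U (A j))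
    (i : Fin 7) : octD g φ (fun z => ∑ j ∈ s, A j z) y i = ∑ j ∈ s, octD g φ (A j) y i := by
  simp only [octD, H.nabla_sum hy s hA, omul_sum_left, Finset.sum_sub_distrib]

theorem curvN_add {A B : E7 → Oct} (hA : SmoothOct U A) (hB : SmoothOct U B) (i j : Fin 7) :
    curvN g (fun z => A z + B z) y i j = curvN g A y i j + curvN g B y i j := by
  have e : ∀ i j, nablaOct g (fun z => nablaOct g (fun z => A z + B z) z j) y i =
      nablaOct g (fun z => nablaOct g A z j) y i + nablaOct g (fun z => nablaOct g B z j) y i := by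
    intro i j
    rw [H.nabla_congr hy (fun z hz => H.nabla_add hz hA hB j),
      H.nabla_add hy (H.smooth_nabla hA j) (H.smooth_nabla hB j)]
  rw [curvN, curvN, curvN, e, e]
  abel

theorem curvD_add {A B : E7 → Oct} (hA : SmoothOct U A) (hB : SmoothOct U B) (i j : Fin 7) :
    curvD g φ (fun z => A z + B z) y i j = curvD g φ A y i j + curvD g φ B y i j := by
  have e : ∀ i j, octD g φ (fun z => octD g φ (fun z => A z + B z) z j) y i =
      octD g φ (fun z => octD g φ A z j) y i + octD g φ (fun z => octD g φ B z j) y i := by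
    intro i j
    rw [H.octD_congr hy (fun z hz => H.octD_add hz hA hB j),
      H.octD_add hy (H.smooth_octD hA j) (H.smooth_octD hB j)]
  rw [curvD, curvD, curvD, e, e]
  abel

theorem curvN_smul {f : E7 → ℝ} {A : E7 → Oct} (hf : ContDiffOn ℝ ∞ f U) (hA : SmoothOct U A)
    (i j : Fin 7) : curvN g (fun z => f z • A z) y i j = f y • curvN g A y i j := by
  have e : ∀ i j, nablaOct g (fun z => nablaOct g (fun z => f z • A z) z j) y i =
      pd i (pd j f) y • A y + pd j f y • nablaOct g A y i + (pd i f y • nablaOct g A y j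
        + f y • nablaOct g (fun z => nablaOct g A z j) y i) := by
    intro i j
    have hp := contDiffOn_pd H.isOpen hf j
    rw [H.nabla_congr hy (fun z hz => H.nabla_smul hz hf hA j),
      H.nabla_add hy (SmoothOct.smul hp hA) (SmoothOct.smul hf (H.smooth_nabla hA j)),
      H.nabla_smul hy hp hA, H.nabla_smul hy hf (H.smooth_nabla hA j)]
  rw [curvN, curvN, e, e, pd_comm H.isOpen hf hy i j]
  module

theorem curvD_smul {f : E7 → ℝ} {A : E7 → Oct} (hf : ContDiffOn ℝ ∞ f U) (hA : SmoothOct U A)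
    (i j : Fin 7) : curvD g φ (fun z => f z • A z) y i j = f y • curvD g φ A y i j := by
  have e : ∀ i j, octD g φ (fun z => octD g φ (fun z => f z • A z) z j) y i =
      pd i (pd j f) y • A y + pd j f y • octD g φ A y i + (pd i f y • octD g φ A y j
        + f y • octD g φ (fun z => octD g φ A z j) y i) := by
    intro i j
    have hp := contDiffOn_pd H.isOpen hf j
    rw [H.octD_congr hy (fun z hz => H.octD_smul hz hf hA j),
      H.octD_add hy (SmoothOct.smul hp hA) (SmoothOct.smul hf (H.smooth_octD hA j)),
      H.octD_smul hy hp hA, H.octD_smul hy hf (H.smooth_octD hA j)]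
  rw [curvD, curvD, e, e, pd_comm H.isOpen hf hy i j]
  module

/-- The mixed terms `(∇_j A)(D_i B) + (∇_i A)(D_j B)` are symmetric in the two indices and cancel.
-/
theorem curvD_omul {A B : E7 → Oct} (hA : SmoothOct U A) (hB : SmoothOct U B) (i j : Fin 7) :
    curvD g φ (fun z => omul (g z) (φ z) (A z) (B z)) y i j =
      omul (g y) (φ y) (curvN g A y i j) (B y) + omul (g y) (φ y) (A y) (curvD g φ B y i j) := by
  have e : ∀ i j, octD g φ (fun z => octD g φ (fun z => omul (g z) (φ z) (A z) (B z)) z j) y i =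
      omul (g y) (φ y) (nablaOct g (fun z => nablaOct g A z j) y i) (B y)
      + omul (g y) (φ y) (nablaOct g A y j) (octD g φ B y i)
      + (omul (g y) (φ y) (nablaOct g A y i) (octD g φ B y j)
      + omul (g y) (φ y) (A y) (octD g φ (fun z => octD g φ B z j) y i)) := by
    intro i j
    rw [H.octD_congr hy (fun z hz => H.octD_omul hz hA hB j),
      H.octD_add hy (H.smooth_omul (H.smooth_nabla hA j) hB)
        (H.smooth_omul hA (H.smooth_octD hB j)),
      H.octD_omul hy (H.smooth_nabla hA j) hB, H.octD_omul hy hA (H.smooth_octD hB j)]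
  rw [curvD, curvN, curvD, e, e, omul_sub_left, omul_sub_right]
  abel

theorem curvN_fst {A : E7 → Oct} (hA : SmoothOct U A) (i j : Fin 7) : (curvN g A y i j).1 = 0 := by
  have : (curvN g A y i j).1 = pd i (pd j fun z => (A z).1) y - pd j (pd i fun z => (A z).1) y :=
    rfl
  rw [this, pd_comm H.isOpen hA.1 hy, sub_self]

theorem oip_curvN {A B : E7 → Oct} (hA : SmoothOct U A) (hB : SmoothOct U B) (i j : Fin 7) :
    oip (g y) (curvN g A y i j) (B y) = - oip (g y) (A y) (curvN g B y i j) := by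
  have e : ∀ i j, pd i (pd j fun z => oip (g z) (A z) (B z)) y =
      oip (g y) (nablaOct g (fun z => nablaOct g A z j) y i) (B y)
      + oip (g y) (nablaOct g A y j) (nablaOct g B y i)
      + (oip (g y) (nablaOct g A y i) (nablaOct g B y j)
      + oip (g y) (A y) (nablaOct g (fun z => nablaOct g B z j) y i)) := by
    intro i j
    rw [pd_congr H.isOpen (fun z hz => H.pd_oip hz hA hB j) hy,
      pd_add (H.diff (H.smooth_oip (H.smooth_nabla hA j) hB) hy)
        (H.diff (H.smooth_oip hA (H.smooth_nabla hB j)) hy),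
      H.pd_oip hy (H.smooth_nabla hA j) hB, H.pd_oip hy hA (H.smooth_nabla hB j)]
  have h1 := pd_comm H.isOpen (H.smooth_oip hA hB) hy i j
  rw [e, e] at h1
  rw [curvN, curvN, oip_sub_left, oip_sub_right]
  linarith

theorem nabla_delta_comm (i k : Fin 7) :
    nablaOct g (fun _ => delta k) y i = nablaOct g (fun _ => delta i) y k := by
  rw [nabla_delta, nabla_delta]
  exact Finset.sum_congr rfl fun l _ => by rw [H.chris_symm hy]

/-- Since `∇_i δ_k = ∇_k δ_i`, the six second derivatives cancel in pairs. -/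
theorem curvN_bianchi (i j k : Fin 7) : curvN g (fun _ => delta k) y i j +
    curvN g (fun _ => delta i) y j k + curvN g (fun _ => delta j) y k i = 0 := by
  have e : ∀ i j k, nablaOct g (fun z => nablaOct g (fun _ => delta k) z j) y i =
      nablaOct g (fun z => nablaOct g (fun _ => delta j) z k) y i := fun i j k =>
    H.nabla_congr hy (fun z hz => H.nabla_delta_comm hz j k) i
  rw [curvN, curvN, curvN, e i j k, e j i k, e k i j]
  abel

/-- `D_j 1 = -T_j`, and `Re D_i(-T_j) = -⟨T_j, T_i⟩` is symmetric in the indices. -/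
theorem curvD_one_fst (i j : Fin 7) : (curvD g φ one y i j).1 = 0 := by
  obtain ⟨L, hL⟩ := H.frame y hy
  have e : ∀ i j, (octD g φ (fun z => octD g φ one z j) y i).1 =
      - ip (g y) (torsion g φ y j) (torsion g φ y i) := by
    intro i j
    have h1 : (fun z => octD g φ one z j) = fun z => - torsionOct g φ z j :=
      funext fun z => octD_one g φ z j
    rw [h1, H.octD_neg hy (H.smooth_torsionOct j)]
    simp [octD, nablaOct, torsionOct, imag, omul, pd_const]
  rw [curvD, Prod.fst_sub, e, e, hL.ip_comm, sub_self]

/-- The pairing of `δⁱ` with a constant `C` is the constant component `Cⁱ`; metric compatibility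
then gives the derivative of `δⁱ`. -/
theorem nabla_deltaUp (i j : Fin 7) : nablaOct g (fun z => deltaUp (g z) i) y j =
    - ∑ l, chris g y i j l • deltaUp (g y) l := by
  obtain ⟨L, hL⟩ := H.frame y hy
  apply hL.ext_oip
  intro C
  have hu := H.smooth_deltaUp i
  have h1 := H.pd_oip hy hu (smoothOct_const C) j
  have h2 : pd j (fun z => oip (g z) (deltaUp (g z) i) C) y = 0 := by
    rw [pd_congr H.isOpen (f' := fun _ => C.2 i) (fun z hz => ?_) hy, pd_const]
    obtain ⟨L, hL⟩ := H.frame z hz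
    exact hL.oip_deltaUp i C
  rw [h2, hL.oip_deltaUp, nabla_const] at h1
  rw [oip_neg_left, oip_sum_left]
  simp only [oip_smul_left, hL.oip_deltaUp]
  have h3 : (gam g y j C).2 i = ∑ l, chris g y i j l * C.2 l := rfl
  rw [h3] at h1
  linarith

theorem exists_clifford_contraction : ∃ w : Fin 7 → Fin 7 → ℝ, (∀ j k, w j k = w k j) ∧
    ∀ j A, SmoothOct U A → ∑ i, omul (g y) (φ y) (deltaUp (g y) i) (curvD g φ A y i j) =
      ∑ k, w j k • omul (g y) (φ y) (deltaUp (g y) k) (A y) := by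
  obtain ⟨L, hL⟩ := H.frame y hy
  have hK := fun i j => exists_linear_of_tensorial (U := U) (c := fun A => curvN g A y i j) y
    (fun A B hA hB => H.curvN_add hy hA hB i j) (fun f A hf hA => H.curvN_smul hy hf hA i j)
  have hF := fun i j => exists_linear_of_tensorial (U := U) (c := fun A => curvD g φ A y i j) y
    (fun A B hA hB => H.curvD_add hy hA hB i j) (fun f A hf hA => H.curvD_smul hy hf hA i j)
  choose K hK using hK
  choose F hF using hF
  have c := fun a => smoothOct_const (U := U) a
  obtain ⟨w, hw, h⟩ := hL.exists_symm_clifford_contraction (K := K) (F := F)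
    (fun i j A B => by
      have := H.curvD_omul hy (c A) (c B) i j
      rwa [hF i j _ (H.smooth_omul (c A) (c B)), hK i j _ (c A), hF i j _ (c B)] at this)
    (fun i j A => by rw [← hK i j _ (c A), H.curvN_fst hy (c A)])
    (fun i j A B => by
      have := H.oip_curvN hy (c A) (c B) i j
      rwa [hK i j _ (c A), hK i j _ (c B)] at this)
    (fun i j => by
      have := H.curvD_one_fst hy i j
      rwa [hF i j one (c (1, 0))] at this)
    (fun i j A => by rw [← hK i j _ (c A), ← hK j i _ (c A), curvN, curvN, neg_sub])
    (fun i j k => by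
      rw [← hK i j _ (c (delta k)), ← hK j k _ (c (delta i)), ← hK k i _ (c (delta j)),
        H.curvN_bianchi hy])
  refine ⟨w, hw, fun j A hA => ?_⟩
  simp only [fun i j => hF i j A hA, h]

/-- Clifford contraction commutes with `D`, because the Christoffel terms from `δⁱ` match those of
the 1-form index. -/
theorem octD_sum_deltaUp_omul {P : E7 → Fin 7 → Oct} (hP : ∀ i, SmoothOct U fun z => P z i)
    (j : Fin 7) : octD g φ (fun z => ∑ i, omul (g z) (φ z) (deltaUp (g z) i) (P z i)) y j =
      ∑ i, omul (g y) (φ y) (deltaUp (g y) i) (octD1 g φ P y j i) := by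
  rw [H.octD_sum hy _ fun i => H.smooth_omul (H.smooth_deltaUp i) (hP i)]
  simp only [fun i => H.octD_omul hy (H.smooth_deltaUp i) (hP i) j, H.nabla_deltaUp hy,
    omul_neg_left, omul_sum_left, omul_smul_left, Finset.sum_add_distrib, Finset.sum_neg_distrib]
  have e : ∀ i, octD1 g φ P y j i = octD g φ (fun z => P z i) y j -
      ∑ l, chris g y l j i • P y l := by
    intro i
    rw [octD1, nablaOct1, octD]
    abel
  simp only [e, omul_sub_right, omul_sum_right, omul_smul_right, Finset.sum_sub_distrib]
  rw [Finset.sum_comm]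
  abel

/-- The Dirac operator on a 1-form, compared with the derivative of its contraction. -/
theorem dirac1_sub_octD {P : E7 → Fin 7 → Oct} (hP : ∀ i, SmoothOct U fun z => P z i)
    (j : Fin 7) : dirac1 g φ P y j -
      octD g φ (fun z => ∑ i, omul (g z) (φ z) (deltaUp (g z) i) (P z i)) y j =
      ∑ i, omul (g y) (φ y) (deltaUp (g y) i)
        (octD g φ (fun z => P z j) y i - octD g φ (fun z => P z i) y j) := by
  rw [H.octD_sum_deltaUp_omul hy hP, dirac1, ← Finset.sum_sub_distrib]
  refine Finset.sum_congr rfl fun i _ => ?_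
  rw [← omul_sub_right]
  congr 1
  -- Symmetry of the Christoffel symbols removes them from the antisymmetrised derivative.
  simp only [octD1, nablaOct1, octD, H.chris_symm hy _ i j]
  abel

/-- With `T = -D1`, the antisymmetrised derivative of `T` is minus the curvature of `D` on `1`, and
`δⁱ T_i = -D̸1`. -/
theorem dirac1_torsionOct_add (j : Fin 7) :
    dirac1 g φ (torsionOct g φ) y j + octD g φ (dirac g φ one) y j =
      - ∑ i, omul (g y) (φ y) (deltaUp (g y) i) (curvD g φ one y i j) := by
  have hT := fun i => H.smooth_torsionOct i
  have h1 := H.dirac1_sub_octD hy hT j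
  have h2 : dirac g φ one = fun z => - ∑ i, omul (g z) (φ z) (deltaUp (g z) i) (torsionOct g φ z i) := by
    funext z
    simp only [dirac, octD_one, omul_neg_right, Finset.sum_neg_distrib]
  rw [h2, H.octD_neg hy (SmoothOct.sum _ fun i => H.smooth_omul (H.smooth_deltaUp i) (hT i)),
    ← sub_eq_add_neg, h1, ← Finset.sum_neg_distrib]
  refine Finset.sum_congr rfl fun i _ => ?_
  rw [← omul_neg_right, curvD]
  simp only [octD_one]
  rw [H.octD_neg hy (hT i), H.octD_neg hy (hT j)]
  congr 1
  abel

end LocalG2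

/-! ### Transposition and the comparison identity -/

theorem IsFrame.transp_symm {G : Matrix (Fin 7) (Fin 7) ℝ} {p : Form3} {L : Vec ≃ₗ[ℝ] Vec}
    (h : IsFrame G p L) {w : Fin 7 → Fin 7 → ℝ} (hw : ∀ j k, w j k = w k j) (j : Fin 7) :
    transp G (fun j => ∑ k, w j k • deltaUp G k) j = ∑ k, w j k • deltaUp G k := by
  have h1 : ∀ j : Fin 7, (∑ k, w j k • deltaUp G k : Oct).1 = 0 := fun j => by
    simp [Prod.fst_sum, deltaUp_eq, imag]
  have h2 : ∀ i j : Fin 7, ip G (delta i).2 (∑ k, w j k • deltaUp G k : Oct).2 = w j i := fun i j => by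
    have : ip G (delta i).2 (∑ k, w j k • deltaUp G k : Oct).2 =
        oip G (delta i) (∑ k, w j k • deltaUp G k) := by simp [oip, delta, imag]
    rw [this, h.oip_comm, oip_sum_left]
    simp only [oip_smul_left, h.oip_deltaUp]
    simp [delta, imag, Pi.single_apply]
  rw [transp, h1]
  simp only [h2, hw _ j]
  simp

theorem transp_add (G : Matrix (Fin 7) (Fin 7) ℝ) (P Q : Fin 7 → Oct) (j : Fin 7) :
    transp G (fun j => P j + Q j) j = transp G P j + transp G Q j := by
  simp only [transp, Prod.fst_add, Prod.snd_add, ip_add_right, add_smul, Finset.sum_add_distrib]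
  ext
  · simp
    ring
  · simp

theorem LocalG2.gradLog_eq {U : Set E7} {g : LMetric} {φ : LForm} (H : LocalG2 U g φ) (V : E7 → Oct)
    {y : E7} (hy : y ∈ U) : gradLog g V y = ∑ i, dlog g V y i • deltaUp (g y) i := by
  obtain ⟨L, hL⟩ := H.frame y hy
  have : ∀ i, deltaUp (g y) i = imagL ((g y)⁻¹ i) := fun i => deltaUp_eq _ i
  simp only [this, ← map_smul, ← map_sum]
  rw [imagL_apply, gradLog]
  congr 1
  ext i
  simp only [Finset.sum_apply, Pi.smul_apply, smul_eq_mul]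
  exact Finset.sum_congr rfl fun j _ => by rw [hL.inv_symm, mul_comm]

/-- `D̸^(V) 1` is minus the contraction `δⁱ ∘ T^(V)_i`; right multiplication by `V` replaces `∘` by
the product of `φ`. -/
theorem LocalG2.diracV1_omul {U : Set E7} {g : LMetric} {φ : LForm} (H : LocalG2 U g φ) {V : E7 → Oct}
    (hV0 : ∀ z ∈ U, V z ≠ 0) {y : E7} (hy : y ∈ U) : omul (g y) (φ y) (diracV1 g φ V y) (V y) =
    - ∑ i, omul (g y) (φ y) (deltaUp (g y) i) (torsionVmulV g φ V y i) := by
  obtain ⟨L, hL⟩ := H.frame y hy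
  rw [diracV1, dirac, omul_sum_left, ← Finset.sum_neg_distrib]
  refine Finset.sum_congr rfl fun i _ => ?_
  rw [sigmaL, hL.omul_sigma_omul (hV0 y hy)]
  have := octD_one g (sigmaL g φ V) y i
  rw [this, omul_neg_left, omul_neg_right, torsionVmulV]

section Sigma

variable {U : Set E7} {g : LMetric} {φ : LForm} (H : LocalG2 U g φ) {V : E7 → Oct}
  (hV : SmoothOct U V) (hV0 : ∀ z ∈ U, V z ≠ 0) {y : E7} (hy : y ∈ U)
include H hV hV0

theorem LocalG2.smooth_torsionVmulV (i : Fin 7) : SmoothOct U fun z => torsionVmulV g φ V z i :=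
  H.smooth_omul ((H.sigma hV hV0).smooth_torsionOct i) hV

include hy

/-- `T^(V) V = (d ln|V|)V - DV` is differentiated once more. Second derivatives of `ln|V|` cancel,
and `DV` is eliminated again with the same formula, whose terms in `V` are symmetric. -/
theorem LocalG2.octD_torsionVmulV_sub (i j : Fin 7) :
    octD g φ (fun z => torsionVmulV g φ V z j) y i - octD g φ (fun z => torsionVmulV g φ V z i) y j =
      dlog g V y i • torsionVmulV g φ V y j - dlog g V y j • torsionVmulV g φ V y i
        - curvD g φ V y i j := by
  have hl := H.contDiffOn_log hV hV0
  have e : ∀ i j, octD g φ (fun z => torsionVmulV g φ V z j) y i =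
      pd i (dlog g V · j) y • V y + dlog g V y j • octD g φ V y i
        - octD g φ (fun z => octD g φ V z j) y i := by
    intro i j
    have hd : ContDiffOn ℝ ∞ (fun z => dlog g V z j) U := contDiffOn_pd H.isOpen hl j
    rw [H.octD_congr hy (fun z hz => H.torsionVmulV_eq hV hV0 hz j),
      H.octD_sub hy (SmoothOct.smul hd hV) (H.smooth_octD hV j), H.octD_smul hy hd hV]
  have h1 : pd i (dlog g V · j) y = pd j (dlog g V · i) y := pd_comm H.isOpen hl hy i j
  rw [e, e, h1, H.torsionVmulV_eq hV hV0 hy, H.torsionVmulV_eq hV hV0 hy, curvD]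
  module

/-- The comparison identity for `φ` and `σ_V(φ)`, in terms of the curvature. -/
theorem LocalG2.octD_diracV1_add (j : Fin 7) :
    octD g φ (fun z => omul (g z) (φ z) (diracV1 g φ V z) (V z)) y j
      - omul (g y) (φ y) (gradLog g V y) (torsionVmulV g φ V y j)
      - dlog g V y j • omul (g y) (φ y) (diracV1 g φ V y) (V y)
      + dirac1 g φ (torsionVmulV g φ V) y j =
    - ∑ i, omul (g y) (φ y) (deltaUp (g y) i) (curvD g φ V y i j) := by
  have hT := H.smooth_torsionVmulV hV hV0
  have h1 := H.dirac1_sub_octD hy hT j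
  have h2 : octD g φ (fun z => omul (g z) (φ z) (diracV1 g φ V z) (V z)) y j = - octD g φ (fun z =>
      ∑ i, omul (g z) (φ z) (deltaUp (g z) i) (torsionVmulV g φ V z i)) y j := by
    rw [H.octD_congr hy (fun z hz => H.diracV1_omul hV0 hz), H.octD_neg hy
      (SmoothOct.sum _ fun i => H.smooth_omul (H.smooth_deltaUp i) (hT i))]
  rw [sub_eq_iff_eq_add] at h1
  rw [h2, h1, H.diracV1_omul hV0 hy, H.gradLog_eq V hy]
  simp only [H.octD_torsionVmulV_sub hV hV0 hy, omul_sub_right, omul_smul_right,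
    Finset.sum_sub_distrib, omul_sum_left, omul_smul_left, smul_neg, Finset.smul_sum]
  abel

/-- The curvature contraction is left multiplication by one octonion `w_jk δᵏ`, whether applied to
`1` or to `V`. Multiplying the identity for `1` on the right by `V` therefore gives the curvature
term of the identity for `V`. -/
theorem LocalG2.comparison (j : Fin 7) :
    omul (g y) (φ y) (dirac1 g φ (torsionOct g φ) y j) (V y) - dirac1 g φ (torsionVmulV g φ V) y j
        = compRHS g φ V (octD g φ (dirac g φ one) y) y j
      ∧ omul (g y) (φ y) (transp (g y) (dirac1 g φ (torsionOct g φ) y) j) (V y)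
          - dirac1 g φ (torsionVmulV g φ V) y j
        = compRHS g φ V (transp (g y) (octD g φ (dirac g φ one) y)) y j := by
  obtain ⟨L, hL⟩ := H.frame y hy
  obtain ⟨w, hw, hc⟩ := H.exists_clifford_contraction hy
  have h1 : ∀ j, dirac1 g φ (torsionOct g φ) y j + octD g φ (dirac g φ one) y j =
      ∑ k, (- w j k) • deltaUp (g y) k := by
    intro j
    rw [H.dirac1_torsionOct_add hy, hc j one (smoothOct_const _), ← Finset.sum_neg_distrib]
    exact Finset.sum_congr rfl fun k _ => by rw [one, omul_one, neg_smul]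
  have h2 := H.octD_diracV1_add hV hV0 hy j
  rw [hc j V hV] at h2
  -- The sum `D̸T + DD̸1` is imaginary with symmetric components, so it equals its transpose. The
  -- two summands need not be symmetric separately.
  have h3 : transp (g y) (dirac1 g φ (torsionOct g φ) y) j +
      transp (g y) (octD g φ (dirac g φ one) y) j = ∑ k, (- w j k) • deltaUp (g y) k := by
    rw [← transp_add]
    simp only [h1]
    exact hL.transp_symm (fun j k => by rw [hw]) j
  have h4 : omul (g y) (φ y) (∑ k, (- w j k) • deltaUp (g y) k) (V y) =
      - ∑ k, w j k • omul (g y) (φ y) (deltaUp (g y) k) (V y) := by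
    rw [omul_sum_left, ← Finset.sum_neg_distrib]
    exact Finset.sum_congr rfl fun k _ => by rw [omul_smul_left, neg_smul]
  rw [← h4] at h2
  constructor
  · rw [← h1, omul_add_left] at h2
    rw [compRHS, ← sub_eq_zero]
    rw [← sub_eq_zero] at h2
    rw [← neg_eq_zero, ← h2]
    abel
  · rw [← h3, omul_add_left] at h2
    rw [compRHS, ← sub_eq_zero]
    rw [← sub_eq_zero] at h2
    rw [← neg_eq_zero, ← h2]
    abel

end Sigma

/-! ### Chart components of geometric objects -/

theorem phi0_eq_cr (u v w : E7) : phi0 u v w = cr (R := ℝ) u v ⬝ᵥ w := by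
  simp only [phi0, wedge3, Matrix.det_fin_three, dot_seven, cr_0, cr_1, cr_2, cr_3, cr_4, cr_5, cr_6,
    Matrix.of_apply, Matrix.cons_val', Matrix.cons_val_zero, Matrix.cons_val_one,
    Matrix.cons_val]
  ring

theorem tri_phiZ (u v w : Vec) : tri (fun a b c => (phiZ a b c : ℝ)) u v w = cr u v ⬝ᵥ w := by
  rw [tri, dotProduct]
  simp only [cr_eq_sum, Finset.sum_mul]
  exact (sum_cycle_three fun c a b => (phiZ a b c : ℝ) * u a * v b * w c).symm

theorem isFrame_of_basis {G : Matrix (Fin 7) (Fin 7) ℝ} {p : Form3} (Λ : Vec ≃ₗ[ℝ] Vec)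
    (hG : ∀ a b, G a b = Λ (Pi.single a 1) ⬝ᵥ Λ (Pi.single b 1))
    (hp : ∀ a b c, p a b c = cr (Λ (Pi.single a 1)) (Λ (Pi.single b 1)) ⬝ᵥ Λ (Pi.single c 1)) :
    IsFrame G p Λ where
  ip_eq u v := by
    conv_rhs => rw [vec_eq_sum u, vec_eq_sum v]
    simp only [map_sum, map_smul, sum_dotProduct, dotProduct_sum, smul_dotProduct, dotProduct_smul,
      smul_eq_mul, ← hG, ip, Finset.mul_sum]
    conv_rhs => rw [Finset.sum_comm]
    exact Finset.sum_congr rfl fun _ _ => Finset.sum_congr rfl fun _ _ => by ring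
  tri_eq u v w := by
    have h1 := tri_eq_sum_frame (fun a b c => (phiZ a b c : ℝ)) Λ.symm (Λ u) (Λ v) (Λ w)
    simp only [LinearEquiv.symm_symm, LinearEquiv.symm_apply_apply, tri_phiZ, ← hp] at h1
    exact h1.symm

theorem mdifferentiable_of_mem_maximalAtlas {M : Type*} [TopologicalSpace M] [ChartedSpace E7 M]
    {e : OpenPartialHomeomorph M E7} (he : e ∈ IsManifold.maximalAtlas (𝓡 7) ∞ M) :
    e.MDifferentiable (𝓡 7) (𝓡 7) :=
  ⟨(contMDiffOn_of_mem_maximalAtlas he).mdifferentiableOn (by simp),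
    (contMDiffOn_symm_of_mem_maximalAtlas he).mdifferentiableOn (by simp)⟩

section Chart

variable {M : Type*} [TopologicalSpace M] [ChartedSpace E7 M] [IsManifold (𝓡 7) ∞ M]
  {e : OpenPartialHomeomorph M E7} (he : e ∈ IsManifold.maximalAtlas (𝓡 7) ∞ M)
include he

/-- The coordinate field is the image of a constant field under the tangent map of the inverse
chart; on an open set derivatives within the set are ordinary ones. -/
theorem contMDiffOn_coordVec (a : Fin 7) : ContMDiffOn (𝓡 7) (𝓡 7).tangent ∞
    (fun y => (⟨e.symm y, coordVec e y a⟩ : TangentBundle (𝓡 7) M)) e.target := by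
  have h1 := (contMDiffOn_symm_of_mem_maximalAtlas he).contMDiffOn_tangentMapWithin
    (m := ∞) (by simp) e.open_target.uniqueMDiffOn
  have h2 : ContMDiffOn (𝓡 7) (𝓡 7).tangent ∞ (fun y : E7 =>
      (⟨y, EuclideanSpace.single a (1 : ℝ)⟩ : TangentBundle (𝓡 7) E7)) e.target :=
    contMDiffOn_vectorSpace_iff_contDiffOn.2 contDiffOn_const
  refine (h1.comp h2 fun y hy => hy).congr fun y hy => ?_
  simp only [Function.comp_apply, tangentMapWithin, coordVec]
  rw [mfderivWithin_of_isOpen e.open_target hy]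

theorem contDiffOn_metricComp (g : Metric M) (a b : Fin 7) :
    ContDiffOn ℝ ∞ (fun y => metricComp g e y a b) e.target := by
  have h1 : ContMDiffOn (𝓡 7) ((𝓡 7).prod 𝓘(ℝ, ℝ)) ∞ (fun y => Bundle.TotalSpace.mk' ℝ
      (E := Bundle.Trivial M ℝ) (e.symm y)
      (g.inner (e.symm y) (coordVec e y a) (coordVec e y b))) e.target := by
    refine ContMDiffOn.clm_bundle_apply₂ (F₁ := E7) (F₂ := E7) ?_ (contMDiffOn_coordVec he a)
      (contMDiffOn_coordVec he b)
    exact g.contMDiff.comp_contMDiffOn (contMDiffOn_symm_of_mem_maximalAtlas he)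
  rw [← contMDiffOn_iff_contDiffOn]
  intro y hy
  have h2 := h1 y hy
  simp only [Bundle.contMDiffWithinAt_totalSpace] at h2
  exact h2.2

theorem smoothOct_octComp (V : OctSection M) : SmoothOct e.target (octComp V e) := by
  have hs := contMDiffOn_symm_of_mem_maximalAtlas he
  refine ⟨contMDiffOn_iff_contDiffOn.1 (V.smooth_re.comp_contMDiffOn hs), fun k => ?_⟩
  have h1 := (contMDiffOn_of_mem_maximalAtlas he).contMDiffOn_tangentMapWithin
    (m := ∞) (by simp) e.open_source.uniqueMDiffOn
  have h2 := h1.comp (V.smooth_im.comp_contMDiffOn hs) fun y hy => e.map_target hy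
  have h3 : ContMDiffOn (𝓡 7) (𝓡 7).tangent ∞ (fun y : E7 => (⟨y, show E7 from
      mfderiv (𝓡 7) (𝓡 7) e (e.symm y) (V.im (e.symm y))⟩ : TangentBundle (𝓡 7) E7)) e.target := by
    refine h2.congr fun y hy => ?_
    simp only [Function.comp_apply, tangentMapWithin]
    rw [mfderivWithin_of_isOpen e.open_source (e.map_target hy)]
    -- The tangent map has base point `e (e.symm y)`, which must be replaced by `y`.
    exact congrArg (fun q : E7 => (⟨q, show E7 from
      mfderiv (𝓡 7) (𝓡 7) e (e.symm y) (V.im (e.symm y))⟩ : TangentBundle (𝓡 7) E7))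
      (e.right_inv hy).symm
  have h4 := contMDiffOn_vectorSpace_iff_contDiffOn.1 h3
  exact (contDiffOn_euclidean.1 h4) k

theorem octComp_ne_zero (V : OctSection M) (hV : ∀ x, V.re x ≠ 0 ∨ V.im x ≠ 0) {y : E7}
    (hy : y ∈ e.target) : octComp V e y ≠ 0 := by
  intro h0
  rcases hV (e.symm y) with h | h
  · exact h (congrArg Prod.fst h0)
  · apply h
    apply (mdifferentiable_of_mem_maximalAtlas he).mfderiv_injective (e.map_target hy)
    rw [map_zero]
    have : ∀ a, (show E7 from mfderiv (𝓡 7) (𝓡 7) e (e.symm y) (V.im (e.symm y))) a = 0 :=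
      fun a => congrFun (congrArg Prod.snd h0) a
    exact (PiLp.ext this : (show E7 from mfderiv (𝓡 7) (𝓡 7) e (e.symm y) (V.im (e.symm y))) = 0)

/-- At each point the adapted identification is composed with the derivative of the inverse chart,
which sends basis vectors to coordinate vectors. -/
theorem localG2_of_isG2Structure {g : Metric M} {φ : ThreeForm M} (hφ : IsG2Structure g φ) :
    LocalG2 e.target (metricComp g e) (formComp φ e) where
  isOpen := e.open_target
  metric := contDiffOn_metricComp he g
  form := hφ.smooth e he
  frame y hy := by
    obtain ⟨L, h1, h2⟩ := hφ.adapted (e.symm y)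
    let D : E7 ≃ₗ[ℝ] TangentSpace (𝓡 7) (e.symm y) :=
      ((mdifferentiable_of_mem_maximalAtlas he).symm.mfderiv hy).toLinearEquiv
    let w := WithLp.linearEquiv 2 ℝ (Fin 7 → ℝ)
    let Λ : Vec ≃ₗ[ℝ] Vec := (w.symm.trans (D.trans L)).trans w
    have hΛ : ∀ a : Fin 7, Λ (Pi.single a 1) = (L (coordVec e y a) : E7) := fun a => rfl
    refine ⟨Λ, isFrame_of_basis Λ (fun a b => ?_) fun a b c => ?_⟩
    · simp only [hΛ, metricComp, Matrix.of_apply, h2]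
      rw [EuclideanSpace.inner_eq_star_dotProduct, dotProduct_comm]
      rfl
    · simp only [hΛ, formComp, h1, phi0_eq_cr]

end Chart

end G2

end

/-- The identity relating the torsions of the isometric `G₂`-structures `φ` and `σ_V(φ)`, and its
transposed form, as identities of octonion-valued 1-forms, in components in every chart. -/
theorem mainTheorem6 {M : Type*} [TopologicalSpace M] [ChartedSpace G2.E7 M]
    [IsManifold (𝓡 7) ∞ M] (g : G2.Metric M) (φ : G2.ThreeForm M) (hφ : G2.IsG2Structure g φ)
    (V : G2.OctSection M) (hV : ∀ x, V.re x ≠ 0 ∨ V.im x ≠ 0)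
    (e : OpenPartialHomeomorph M G2.E7) (he : e ∈ IsManifold.maximalAtlas (𝓡 7) ∞ M)
    (gc : G2.LMetric) (hgc : gc = G2.metricComp g e)
    (φc : G2.LForm) (hφc : φc = G2.formComp φ e)
    (Vc : G2.E7 → G2.Oct) (hVc : Vc = G2.octComp V e) :
    ∀ y ∈ e.target, ∀ j : Fin 7,
      G2.omul (gc y) (φc y) (G2.dirac1 gc φc (G2.torsionOct gc φc) y j) (Vc y)
          - G2.dirac1 gc φc (G2.torsionVmulV gc φc Vc) y j
        = G2.compRHS gc φc Vc (G2.octD gc φc (G2.dirac gc φc G2.one) y) y j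
      ∧ G2.omul (gc y) (φc y)
            (G2.transp (gc y) (G2.dirac1 gc φc (G2.torsionOct gc φc) y) j) (Vc y)
          - G2.dirac1 gc φc (G2.torsionVmulV gc φc Vc) y j
        = G2.compRHS gc φc Vc
            (G2.transp (gc y) (G2.octD gc φc (G2.dirac gc φc G2.one) y)) y j := by
  subst hgc hφc hVc
  intro y hy j
  exact (G2.localG2_of_isG2Structure he hφ).comparison (G2.smoothOct_octComp he V)
    (fun z hz => G2.octComp_ne_zero he V hV hz) hy j
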